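/- **Model.** Let $F$ be a probability measure on $\mathbb R$ with $F(\{0\})=0$, let $\sigma_X>0$, and for each $T$ let $q=q_T\in(0,1)$ with $q_T\to 0$ as $T\to\infty$. For each $T$ one observes $X(t)=\mu(t)+\epsilon(t)$, $1\le t\le T$, where $\epsilon(1),\dots,\epsilon(T)$ are i.i.d. $N(0,\sigma_X^2)$ and independent of $(\mu(1),\dots,\mu(T))$, and $\mu(t+1)=\mu(t)+Y(t)\Delta(t)$ for $1\le t\le T-1$, where $Y(1),\dots,Y(T-1)$ are independent Bernoulli$(q)$ variables. The change-points are ${\boldsymbol\tau}=\{t:Y(t)=1\}=\{\tau_1<\dots<\tau_J\}$, with $\tau_0=0$, $\tau_{J+1}=T$. Conditionally on ${\boldsymbol\tau}$, each jump $\Delta(\tau_j)$ has law $F$, and the joint law of $(\mu(1),\Delta(\tau_1),\dots,\Delta(\tau_J))$ depends on ${\boldsymbol\tau}$ only through $J$ (the jumps may be dependent). **Algorithms and errors.** A change-point algorithm is, for each $T$, a measurable function of $(X(1),\dots,X(T))$ with values $\widehat Y(t)\in\{0,1\}$, $1\le t\le T-1$; put $\widehat{\boldsymbol\tau}=\{t:\widehat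 Y(t)=1\}$ and $$\kappa(\tau_j)=\#\{\widehat\tau\in\widehat{\boldsymbol\tau}:|\tau_j-\widehat\tau|<\tfrac12\min(\tau_{j+1}-\tau_j,\tau_j-\tau_{j-1})\}.$$ Given $J\ge1$, let $\tau$ be a uniformly random element of ${\boldsymbol\tau}$ (selected independently of everything else given ${\boldsymbol\tau}$), let $d(t,A)=\min_{u\in A}|u-t|$, and for $\Delta_0>0$ let $$\alpha_T=P(\kappa(\tau)\ne1\mid J\ge1),\qquad \beta_T=P(\widehat Y(\tau)=1,\ \kappa(\tau)=1\mid J\ge1),$$ $$\gamma_T(\Delta_0)=E\big(d(\tau,\widehat{\boldsymbol\tau})\mid J\ge1,\ \kappa(\tau)=1,\ |\Delta(\tau)|\ge\Delta_0\big).$$ **Limits.** Let $\Delta$ have the law of $\xi/\sigma_X$ with $\xi\sim F$. Put $$\beta_{\rm upper}=\tfrac12E(\Delta^2\nu(\Delta)),\qquad \nu(x)=2x^{-2}\exp\Big(-2\sum_{i=1}^\infty i^{-1}\Phi\big(-\tfrac{\sqrt i}{2}|x|\big)\Big),$$ where $\Phi$ is the standard normal distribution function. Let $S^+(i)=\sum_{u=1}^iZ^+(u)$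 and $S^-(i)=\sum_{u=1}^iZ^-(u)$, where $Z^\pm(u)$, $u\ge1$, are independent standard normal variables, independent of $\Delta$, and let $p(0)=1$ and $p(\pm i)=\exp(\Delta S^{\pm}(i)-\tfrac{i\Delta^2}{2})$ for $i\ge1$. For a non-negative function $r$ on $\mathbb Z$ with positive finite sum $s$, ${\rm med}(r)$ is the integer $u$ with $\sum_{i<u}r(i)<\tfrac s2\le\sum_{i\le u}r(i)$. For $c>0$ with $P(|\Delta|\ge c)>0$ put $$\gamma_{\rm lower}(c)=E\big(|{\rm med}(p)|\,\big|\,|\Delta|\ge c\big).$$ **Theorem.** Every change-point algorithm satisfies $\limsup_{T\to\infty}\beta_T\le\beta_{\rm upper}$. If $\Delta_0>0$ with $F(\{x:|x|\ge\Delta_0\})>0$, and the algorithm satisfies $\alpha_T\to0$, then $$\liminf_{T\to\infty}\gamma_T(\Delta_0)\ge\gamma_{\rm lower}\big(\tfrac{\Delta_0}{\sigma_X}\big).$$ -/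

import Mathlib

open Filter Topology MeasureTheory ProbabilityTheory
open scoped ENNReal

noncomputable section

namespace ChangePoint

/-- The set `{t : 1 ≤ t ≤ T - 1, y t = 1}` of (true or estimated) change-points. -/
def points (T : ℕ) (y : ℕ → Bool) : Finset ℕ :=
  (Finset.Ico 1 T).filter (fun t => y t = true)

/-- The mean `μ(1)` of the first segment, and the jumps `Δ(t)` at the points `t` of `s`, listed in
increasing order of `t`. -/
def startAndJumps {Ω : Type*} (μ Δ : ℕ → Ω → ℝ) (s : Finset ℕ) {n : ℕ} (hs : s.card = n)
    (ω : Ω) : ℝ × (Fin n → ℝ) :=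
  (μ 1 ω, fun i => Δ (s.orderEmbOfFin hs i) ω)

/-- The change-point model for a Gaussian sequence `X(1), …, X(T)` with constant intensity `q`,
jump distribution `F` and noise standard deviation `σ`. -/
structure IsModel {Ω : Type*} [MeasurableSpace Ω] (P : Measure Ω) (T : ℕ) (q σ : ℝ)
    (F : Measure ℝ) (Y : ℕ → Ω → Bool) (Δ μ X : ℕ → Ω → ℝ) : Prop where
  measurable_Y : ∀ t ∈ Finset.Ico 1 T, Measurable (Y t)
  measurable_jump : ∀ t ∈ Finset.Ico 1 T, Measurable (Δ t)
  measurable_mean : ∀ t ∈ Finset.Icc 1 T, Measurable (μ t)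
  measurable_obs : ∀ t ∈ Finset.Icc 1 T, Measurable (X t)
  /-- The change-point indicators are independent. -/
  indep_Y : iIndepFun (fun (t : Finset.Ico 1 T) => Y t) P
  /-- Each of them is Bernoulli with success probability `q`. -/
  intensity : ∀ t ∈ Finset.Ico 1 T, P {ω | Y t ω = true} = ENNReal.ofReal q
  /-- `μ(t+1) = μ(t) + Y(t) Δ(t)`. -/
  mean_step : ∀ t ∈ Finset.Ico 1 T, ∀ ω,
    μ (t + 1) ω = μ t ω + ((Y t ω).toNat : ℝ) * Δ t ω
  /-- Given the change-points, the jump at each of them has law `F`; in particular `Δ(t)` given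
  `Y(t) = 1` has law `F`, for all `t`. -/
  jump_law : ∀ s ⊆ Finset.Ico 1 T, ∀ t ∈ s,
    (P[|{ω | points T (fun u => Y u ω) = s}]).map (Δ t) = F
  /-- The locations of the change-points carry no information on the segment means: given the
  change-points, the joint law of the initial mean and the successive jumps depends only on the
  number of change-points. -/
  level_law : ∀ (n : ℕ) (s s' : Finset ℕ) (hs : s.card = n) (hs' : s'.card = n),
    s ⊆ Finset.Ico 1 T → s' ⊆ Finset.Ico 1 T →
    (P[|{ω | points T (fun u => Y u ω) = s}]).map (startAndJumps μ Δ s hs) =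
      (P[|{ω | points T (fun u => Y u ω) = s'}]).map (startAndJumps μ Δ s' hs')
  /-- `X(t) - μ(t)` is `N(0, σ²)`. -/
  noise_law : ∀ t ∈ Finset.Icc 1 T,
    P.map (fun ω => X t ω - μ t ω) = gaussianReal 0 (σ ^ 2).toNNReal
  /-- The noise variables are independent of each other. -/
  indep_noise : iIndepFun (fun (t : Finset.Icc 1 T) ω => X t ω - μ t ω) P
  /-- The noise is independent of the means. -/
  indep_noise_mean : IndepFun (fun ω (t : Finset.Icc 1 T) => μ t ω)
    (fun ω (t : Finset.Icc 1 T) => X t ω - μ t ω) P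

/-- A change-point algorithm for sequences of length `T`: from the observations
`x(1), …, x(T)` it computes indicators `Ŷ(t)`, `1 ≤ t ≤ T - 1`. -/
structure Algorithm (T : ℕ) where
  Yhat : (Finset.Icc 1 T → ℝ) → ℕ → Bool
  measurable_Yhat : ∀ t ∈ Finset.Ico 1 T, Measurable (fun x => Yhat x t)

/-- The set of change-points that the algorithm estimates from the data `X(1), …, X(T)`. -/
def Algorithm.estimate {T : ℕ} (A : Algorithm T) {Ω : Type*} (X : ℕ → Ω → ℝ) (ω : Ω) :
    Finset ℕ :=
  points T (A.Yhat (fun t => X t ω))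

/-- The last point of `s` before `t`, and `0` if there is none. -/
def prevPoint (s : Finset ℕ) (t : ℕ) : ℕ := (s.filter (· < t)).sup id

/-- The first point of `s` after `t`, and `T` if there is none (for `t < T`). -/
def nextPoint (T : ℕ) (s : Finset ℕ) (t : ℕ) : ℕ := sInf {u | t < u ∧ u ∈ insert T s}

/-- `κ(t)`: the number of estimated change-points (in `shat`) whose distance to the change-point
`t` is less than half the distance of `t` to its nearest neighbour among the other change-points
(in `s`) and the end points `0` and `T`. -/
def kappa (T : ℕ) (s shat : Finset ℕ) (t : ℕ) : ℕ :=
  (shat.filter (fun u : ℕ => |(t : ℝ) - (u : ℝ)| <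
    1 / 2 * min ((nextPoint T s t : ℝ) - (t : ℝ)) ((t : ℝ) - (prevPoint s t : ℝ)))).card

/-- The distance `d(t, A)`, infinite when `A` is empty. -/
def distTo (t : ℕ) (A : Finset ℕ) : ℝ≥0∞ := ⨅ u ∈ A, ENNReal.ofReal |(u : ℝ) - (t : ℝ)|

/-- `E(f(τ) | J ≥ 1)`, where `J` is the number of elements of the random set `S` and, given
everything else, `τ` is selected uniformly at random from the `J` elements of `S`. -/
def selectE {Ω : Type*} [MeasurableSpace Ω] (P : Measure Ω) (S : Ω → Finset ℕ)
    (f : Ω → ℕ → ℝ≥0∞) : ℝ≥0∞ :=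
  ∫⁻ ω, (∑ t ∈ S ω, f ω t) / ((S ω).card : ℝ≥0∞) ∂(P[|{ω | 1 ≤ (S ω).card}])

open Classical in
/-- The indicator of a proposition. -/
def ind (p : Prop) : ℝ≥0∞ := if p then 1 else 0

section Performance

variable {Ω : Type*} [MeasurableSpace Ω] (P : Measure Ω) {T : ℕ}
  (Y : ℕ → Ω → Bool) (Δ X : ℕ → Ω → ℝ) (A : Algorithm T)

/-- `α_T = P(κ(τ) ≠ 1 | J ≥ 1)`. -/
def alpha : ℝ≥0∞ :=
  selectE P (fun ω => points T (fun u => Y u ω)) (fun ω t =>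
    ind (kappa T (points T (fun u => Y u ω)) (A.estimate X ω) t ≠ 1))

/-- `β_T = P(Ŷ(τ) = 1 and κ(τ) = 1 | J ≥ 1)`. -/
def beta : ℝ≥0∞ :=
  selectE P (fun ω => points T (fun u => Y u ω)) (fun ω t =>
    ind (t ∈ A.estimate X ω ∧
      kappa T (points T (fun u => Y u ω)) (A.estimate X ω) t = 1))

/-- `γ_T(Δ₀) = E(d(τ, τ̂) | J ≥ 1, κ(τ) = 1, |Δ(τ)| ≥ Δ₀)`. -/
def gamma (Δ₀ : ℝ) : ℝ≥0∞ :=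
  selectE P (fun ω => points T (fun u => Y u ω)) (fun ω t =>
      distTo t (A.estimate X ω) *
        ind (kappa T (points T (fun u => Y u ω)) (A.estimate X ω) t = 1 ∧ Δ₀ ≤ |Δ t ω|)) /
    selectE P (fun ω => points T (fun u => Y u ω)) (fun ω t =>
      ind (kappa T (points T (fun u => Y u ω)) (A.estimate X ω) t = 1 ∧ Δ₀ ≤ |Δ t ω|))

end Performance

/-- The overshoot function
`ν(x) = 2 x⁻² exp(-2 ∑_{i ≥ 1} i⁻¹ Φ(-√i |x| / 2))`, for `x ≠ 0`. -/
def overshoot (x : ℝ) : ℝ :=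
  2 * (x ^ 2)⁻¹ * Real.exp (-2 * ∑' i : ℕ,
    ((i : ℝ) + 1)⁻¹ * cdf (gaussianReal 0 1) (-(Real.sqrt ((i : ℝ) + 1) / 2 * |x|)))

/-- `β_upper = ½ E(Δ² ν(Δ))` for `Δ` with law `G`. -/
def betaUpper (G : Measure ℝ) : ℝ≥0∞ :=
  2⁻¹ * ∫⁻ x, ENNReal.ofReal (x ^ 2 * overshoot x) ∂G

/-- `S(i) = z(1) + … + z(i)`. -/
def walk (z : ℕ → ℝ) (i : ℕ) : ℝ := ∑ u ∈ Finset.Icc 1 i, z u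

/-- The two-sided likelihood ratio process: `p(i) = exp(Δ S⁺(i) - i Δ² / 2)`,
`p(-i) = exp(Δ S⁻(i) - i Δ² / 2)` for `i > 0`, and `p(0) = 1`. -/
def likelihoodRatio (Δ : ℝ) (zp zm : ℕ → ℝ) (i : ℤ) : ℝ :=
  if 0 < i then Real.exp (Δ * walk zp i.natAbs - (i.natAbs : ℝ) * Δ ^ 2 / 2)
  else if i < 0 then Real.exp (Δ * walk zm i.natAbs - (i.natAbs : ℝ) * Δ ^ 2 / 2)
  else 1

/-- `u` is the median of the non-negative summable function `r` on the integers. -/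
def IsMed (r : ℤ → ℝ) (u : ℤ) : Prop :=
  Summable r ∧ ∑' i : Set.Iio u, r i < (∑' i, r i) / 2 ∧
    (∑' i, r i) / 2 ≤ ∑' i : Set.Iic u, r i

open Classical in
/-- The median of `r` (it exists and is unique if `r` is non-negative with positive finite sum; in
the other cases, which do not matter, it is set to `0`). -/
def med (r : ℤ → ℝ) : ℤ := if h : ∃ u, IsMed r u then h.choose else 0

/-- The joint law of `Δ`, `(Z⁺(u))` and `(Z⁻(u))`: they are independent, `Δ` has law `G`, and the
`Z⁺(u)` and `Z⁻(u)` are independent standard normal variables. -/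
def limitLaw (G : Measure ℝ) : Measure (ℝ × (ℕ → ℝ) × (ℕ → ℝ)) :=
  G.prod ((Measure.infinitePi fun _ : ℕ => gaussianReal 0 1).prod
    (Measure.infinitePi fun _ : ℕ => gaussianReal 0 1))

/-- `γ_lower(c) = E(|med(p)| | |Δ| ≥ c)` for `Δ` with law `G`. -/
def gammaLower (G : Measure ℝ) (c : ℝ) : ℝ≥0∞ :=
  ∫⁻ w, ((med (likelihoodRatio w.1 w.2.1 w.2.2)).natAbs : ℝ≥0∞)
    ∂((limitLaw G)[|{w | c ≤ |w.1|}])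

end ChangePoint

end

/-!
Given all the change-points except one, and given that the remaining one lies in a window of
consecutive times without other change-points, its location in the window is uniformly distributed,
because the probability of a set of change-points depends only on its size, and the levels and
jumps carry no information on the location, because their law depends only on the number of
change-points. So the location is the parameter of a Gaussian sequence with a single level shift,
with the uniform prior on the window, and no algorithm can do better than the Bayes rules: the
maximizer of the likelihood for the probability of exact location (`sum_lintegral_shiftLaw_le`), and
the median of the likelihood for the mean distance (`le_sum_lintegral_shiftLaw`). Seen from the true
location, the normalized likelihood is the two-sided likelihood ratio process
(`shiftDensity_twoSided`). The two Bayes risks are bounded by `exactRisk` and `medianRisk`.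

To use this for all change-points at once, the times are divided into blocks of a fixed length
`n + 1`. A sum over a set of change-points and one of its points is a sum over the set of the other
points and a further point (`sum_powerset_sum_mem`), and all but a number proportional to the size
of the set of these further points lie in blocks that are isolated from the set
(`card_sdiff_isolatedPoints`). When `q → 0`, the other points contribute a proportion of at most
`(1 / (T - 1) + q) / (1 - q)`, up to a constant factor (`addedMass_div_probSome_le`). Within an
isolated block, the estimates that are counted by `κ` cannot depend on the location: at most one
point of the block is located exactly with `κ = 1` (`sum_ind_exact_le_one`), and there is one point
of the block that is as close as the estimates to all points of the block with `κ = 1`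
(`exists_estimate_in_block`). In the bound for the estimation error, the change-points with `κ ≠ 1`
are charged `n`, which costs `n` times the probability `α_T → 0`. This gives `beta_le` and `le_gamma`
for fixed `T` and `n`.

In the limits `T → ∞` and then `n → ∞`, the window grows on both sides of the change-point. The
probability that the likelihood ratio process is maximal at the origin is the square of the
probability that a Gaussian random walk with negative drift stays non-positive. By Spitzer's
identity the latter is at most `exp (-∑ i⁻¹ Φ(-√i |x| / 2))` (`iInf_negProb_le`), whose square is
`x² ν(x) / 2`. Spitzer's identity is obtained in the convolution ring of finitely supported measures
from the uniqueness of the Wiener-Hopf factorization of `1 - s F` (`exists_split_pow`), for walks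
with finitely many step values, and by approximation for Gaussian walks (`negProb_recursion`). The
medians on the windows converge to the median on the integers unless the latter cuts the total mass
exactly in half (`exists_windowMed_eq`), which has probability `0` (`tieSet_null`); this
gives `gammaLower_le`.
-/

/-! ### Wiener-Hopf factorization in a commutative ring -/

open PowerSeries in
lemma coeff_X_mul_derivative {R : Type*} [CommRing R] (A : PowerSeries R) (n : ℕ) :
    coeff n (X * derivative R A) = n * coeff n A := by
  cases n with
  | zero => simp
  | succ n => rw [coeff_succ_X_mul, coeff_derivative]; push_cast; ring

open PowerSeries in
/-- If the coefficients of a power series `A` with constant term `1` lie in a multiplicatively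
closed additive subgroup, then so do those of its logarithmic derivative `X A' / A`. -/
lemma coeff_logDeriv_mem {R : Type*} [CommRing R] (N : AddSubgroup R)
    (hN : ∀ a ∈ N, ∀ b ∈ N, a * b ∈ N) (A U : PowerSeries R) (h0 : coeff 0 A = 1)
    (hA : ∀ n, 1 ≤ n → coeff n A ∈ N) (hU : U * A = X * derivative R A) :
    coeff 0 U = 0 ∧ ∀ n, 1 ≤ n → coeff n U ∈ N := by
  have key : ∀ n, ∑ p ∈ Finset.HasAntidiagonal.antidiagonal n, coeff p.1 U * coeff p.2 A = n * coeff n A := by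
    intro n
    rw [← coeff_mul, hU, coeff_X_mul_derivative]
  have hU0 : coeff 0 U = 0 := by
    have := key 0
    simpa [h0] using this
  refine ⟨hU0, fun n => ?_⟩
  induction n using Nat.strong_induction_on with
  | _ n ih =>
    intro hn
    have h := key n
    rw [Finset.Nat.sum_antidiagonal_eq_sum_range_succ (fun i j => coeff i U * coeff j A),
      Finset.sum_range_succ, Nat.sub_self, h0, mul_one] at h
    rw [← eq_sub_iff_add_eq'] at h
    rw [h]
    refine N.sub_mem ?_ (N.sum_mem fun i hi => ?_)
    · rw [← nsmul_eq_mul]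
      exact N.nsmul_mem (hA n hn) n
    · have hi' := Finset.mem_range.1 hi
      rcases Nat.eq_zero_or_pos i with rfl | hpos
      · simp [hU0]
      · exact hN _ (ih i hi' hpos) _ (hA _ (by omega))

open PowerSeries in
/-- The algebraic core of Spitzer's identity. In the application the ring consists of the finitely
supported measures on the line with convolution, `N` and `Q` are the measures on the negative and
on the non-negative half-line, `F` is the step law of a random walk, `p n` is the law of `S n` on
the event that the walk is negative up to time `n`, and `H n` is its law at the time `n` of its
first visit to the non-negative half-line. -/
lemma exists_split_pow {R : Type*} [CommRing R] (N Q : AddSubgroup R)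
    (hN : ∀ a ∈ N, ∀ b ∈ N, a * b ∈ N) (hQ : ∀ a ∈ Q, ∀ b ∈ Q, a * b ∈ Q)
    (F : R) (p H : ℕ → R) (hp0 : p 0 = 1) (hp : ∀ n, 1 ≤ n → p n ∈ N)
    (hH : ∀ n, 1 ≤ n → H n ∈ Q) (hstep : ∀ n, p n * F = p (n + 1) + H (n + 1)) :
    ∃ U : ℕ → R, U 0 = 0 ∧ (∀ n, 1 ≤ n → U n ∈ N ∧ F ^ n - U n ∈ Q) ∧
      ∀ n : ℕ, n * p n = ∑ i ∈ Finset.range (n + 1), U i * p (n - i) := by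
  let A : PowerSeries R := mk p
  have hA0 : coeff 0 A = 1 := by simp [A, hp0]
  let I : PowerSeries R := invOfUnit A 1
  have hI : A * I = 1 := mul_invOfUnit A 1 (by simpa using hA0)
  -- `A * K = 1 - ∑ H n * X ^ n` is the Wiener-Hopf factorization; its logarithmic derivative
  -- splits `W`, the negative of that of `K`, into parts in `N` and in `Q`
  let K : PowerSeries R := 1 - X * C F
  let W : PowerSeries R := mk fun n => if n = 0 then 0 else F ^ n
  have hWK : W * K = C F * X := by
    ext n
    have : W * K = W - X * (W * C F) := by simp only [K]; ring
    rw [this, map_sub]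
    rcases n with _ | n
    · simp [W]
    · rw [coeff_succ_X_mul, coeff_mul_C, coeff_succ_mul_X, coeff_mk, coeff_mk]
      rcases n with _ | n
      · simp
      · simp [pow_succ]
  have hK' : derivative R K = - C F := by
    simp only [K, map_sub, Derivation.leibniz, derivative_X, derivative_C]
    simp
  let U : PowerSeries R := X * derivative R A * I
  have hU : U * A = X * derivative R A := by
    calc U * A = X * derivative R A * (A * I) := by simp only [U]; ring
      _ = _ := by rw [hI, mul_one]
  have hG : (U - W) * (A * K) = X * derivative R (A * K) := by
    rw [Derivation.leibniz, hK', smul_eq_mul, smul_eq_mul]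
    calc (U - W) * (A * K) = (U * A) * K - A * (W * K) := by ring
      _ = _ := by rw [hU, hWK]; ring
  have hAK : ∀ n, coeff (n + 1) (A * K) = - H (n + 1) := by
    intro n
    have : A * K = A - X * (A * C F) := by simp only [K]; ring
    rw [this, map_sub, coeff_succ_X_mul, coeff_mul_C, coeff_mk, coeff_mk, hstep]
    ring
  obtain ⟨hU0, hU1⟩ := coeff_logDeriv_mem N hN A U hA0 (fun n hn => by simpa [A] using hp n hn) hU
  obtain ⟨-, hV1⟩ := coeff_logDeriv_mem Q hQ (A * K) (U - W)
    (by
      simp [A, K, hp0]) (fun n hn => by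
      obtain ⟨m, rfl⟩ : ∃ m, n = m + 1 := ⟨n - 1, by omega⟩
      rw [hAK]
      exact Q.neg_mem (hH _ hn)) hG
  refine ⟨fun n => coeff n U, hU0, fun n hn => ⟨hU1 n hn, ?_⟩, fun n => ?_⟩
  · have := Q.neg_mem (hV1 n hn)
    rw [map_sub, neg_sub] at this
    have hW : coeff n W = F ^ n := by simp only [W, coeff_mk]; rw [if_neg (by omega)]
    rwa [hW] at this
  · have h : coeff n (U * A) = n * p n := by
      rw [hU, coeff_X_mul_derivative]; simp [A]
    rw [← h, coeff_mul, Finset.Nat.sum_antidiagonal_eq_sum_range_succ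
      (fun i j => coeff i U * coeff j A)]
    simp [A]

/-! ### Spitzer's identity for random walks -/

lemma ChangePoint.walk_succ (z : ℕ → ℝ) (n : ℕ) :
    ChangePoint.walk z (n + 1) = ChangePoint.walk z n + z (n + 1) := by
  simp [ChangePoint.walk, Finset.sum_Icc_succ_top]

@[fun_prop]
lemma ChangePoint.measurable_walk (n : ℕ) : Measurable fun z : ℕ → ℝ => ChangePoint.walk z n := by
  unfold ChangePoint.walk
  fun_prop

lemma ChangePoint.walk_congr {z z' : ℕ → ℝ} {n : ℕ} (h : ∀ i, 1 ≤ i → i ≤ n → z i = z' i) :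
    ChangePoint.walk z n = ChangePoint.walk z' n :=
  Finset.sum_congr rfl fun i hi => h i (Finset.mem_Icc.1 hi).1 (Finset.mem_Icc.1 hi).2

open ChangePoint

/-- Replacing one coordinate of an i.i.d. sequence by an independent copy does not change the law
of the sequence. -/
lemma measurePreserving_update (ν : Measure ℝ) [IsProbabilityMeasure ν] (i : ℕ) :
    MeasurePreserving (fun q : ℝ × (ℕ → ℝ) => Function.update q.2 i q.1)
      (ν.prod (Measure.infinitePi fun _ : ℕ => ν)) (Measure.infinitePi fun _ : ℕ => ν) := by
  have hm : Measurable (fun q : ℝ × (ℕ → ℝ) => Function.update q.2 i q.1) := by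
    refine measurable_pi_lambda _ fun j => ?_
    by_cases h : j = i
    · subst h; simpa using measurable_fst
    · simp only [Function.update_of_ne h]
      fun_prop
  refine ⟨hm, Measure.eq_infinitePi _ fun s t ht => ?_⟩
  rw [Measure.map_apply hm (MeasurableSet.pi s.countable_toSet fun i _ => ht i)]
  have : (fun q : ℝ × (ℕ → ℝ) => Function.update q.2 i q.1) ⁻¹' (Set.pi s t) =
      (if i ∈ s then t i else Set.univ) ×ˢ Set.pi (s.erase i : Finset ℕ) t := by
    ext ⟨a, z⟩
    simp only [Set.mem_preimage, Set.mem_pi, Set.mem_prod, Finset.mem_coe, Finset.mem_erase]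
    constructor
    · intro h
      refine ⟨?_, fun j hj => by simpa [hj.1] using h j hj.2⟩
      split_ifs with hi
      · simpa using h i hi
      · trivial
    · rintro ⟨h1, h2⟩ j hj
      by_cases hji : j = i
      · subst hji; simpa [hj] using h1
      · simpa [hji] using h2 j ⟨hji, hj⟩
  rw [this, Measure.prod_prod, Measure.infinitePi_pi _ fun j _ => ht j]
  by_cases hi : i ∈ s
  · rw [if_pos hi, Finset.mul_prod_erase s (fun j => ν (t j)) hi]
  · rw [if_neg hi, measure_univ, one_mul, Finset.erase_eq_of_notMem hi]

section Spitzer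

open AddMonoidAlgebra

/-- The integral of `g` with respect to the finitely supported signed measure `a`. -/
noncomputable def pairing (g : ℝ → ℝ) : AddMonoidAlgebra ℝ ℝ →ₗ[ℝ] ℝ :=
  (Finsupp.linearCombination ℝ g) ∘ₗ (coeffLinearEquiv ℝ).toLinearMap

lemma pairing_single (g : ℝ → ℝ) (v c : ℝ) : pairing g (single v c) = c * g v := by
  simp [pairing]

lemma pairing_eq_sum (g : ℝ → ℝ) (a : AddMonoidAlgebra ℝ ℝ) :
    pairing g a = a.coeff.sum fun v c => c * g v := by
  simp [pairing, Finsupp.linearCombination_apply]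

/-- The total mass is a ring homomorphism. -/
lemma pairing_one_mul (a b : AddMonoidAlgebra ℝ ℝ) :
    pairing (fun _ => 1) (a * b) = pairing (fun _ => 1) a * pairing (fun _ => 1) b := by
  induction a using AddMonoidAlgebra.induction_linear with
  | zero => simp
  | add a a' h h' => rw [add_mul, map_add, map_add, h, h', add_mul]
  | single v c =>
    induction b using AddMonoidAlgebra.induction_linear with
    | zero => simp
    | add a a' h h' => rw [mul_add, map_add, map_add, h, h', mul_add]
    | single v' c' => rw [single_mul_single]; simp [pairing_single]

open Classical in
/-- The restriction of a finitely supported signed measure to `D`. -/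
noncomputable def restrictTo (D : Set ℝ) (a : AddMonoidAlgebra ℝ ℝ) : AddMonoidAlgebra ℝ ℝ :=
  ofCoeff (a.coeff.filter (· ∈ D))

open Classical in
lemma pairing_restrictTo (D : Set ℝ) (g : ℝ → ℝ) (a : AddMonoidAlgebra ℝ ℝ) :
    pairing g (restrictTo D a) = pairing (D.indicator g) a := by
  rw [pairing_eq_sum, pairing_eq_sum, restrictTo, coeff_ofCoeff, Finsupp.sum, Finsupp.sum,
    Finsupp.support_filter, Finset.sum_filter]
  refine Finset.sum_congr rfl fun v _ => ?_
  by_cases h : v ∈ D <;> simp [h]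

/-- The finitely supported signed measures on `D`. -/
def measuresOn (D : Set ℝ) : AddSubgroup (AddMonoidAlgebra ℝ ℝ) where
  carrier := {a | ∀ v, v ∉ D → a.coeff v = 0}
  add_mem' {a b} ha hb v hv := by simp [ha v hv, hb v hv]
  zero_mem' v _ := by simp
  neg_mem' {a} ha v hv := by simp [ha v hv]

lemma measuresOn_mul {D : Set ℝ} (hD : ∀ x ∈ D, ∀ y ∈ D, x + y ∈ D) :
    ∀ a ∈ measuresOn D, ∀ b ∈ measuresOn D, a * b ∈ measuresOn D := by
  classical
  intro a ha b hb v hv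
  by_contra hne
  have := support_coeff_mul_subset a b (Finsupp.mem_support_iff.2 hne)
  obtain ⟨x, hx, y, hy, rfl⟩ := Finset.mem_add.1 this
  refine hv (hD x ?_ y ?_)
  · by_contra h; exact (Finsupp.mem_support_iff.1 hx) (ha x h)
  · by_contra h; exact (Finsupp.mem_support_iff.1 hy) (hb y h)

lemma restrictTo_mem (D : Set ℝ) (a : AddMonoidAlgebra ℝ ℝ) : restrictTo D a ∈ measuresOn D := by
  intro v hv
  simp [restrictTo, hv]

lemma restrictTo_add_compl (D : Set ℝ) (a : AddMonoidAlgebra ℝ ℝ) :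
    restrictTo D a + restrictTo Dᶜ a = a := by
  classical
  ext v
  by_cases h : v ∈ D <;> simp [restrictTo]

lemma restrictTo_univ (a : AddMonoidAlgebra ℝ ℝ) : restrictTo Set.univ a = a := by
  ext v
  simp [restrictTo]

lemma restrictTo_eq {D : Set ℝ} {a b : AddMonoidAlgebra ℝ ℝ} (hb : b ∈ measuresOn D)
    (hab : a - b ∈ measuresOn Dᶜ) : restrictTo D a = b := by
  classical
  ext v
  by_cases h : v ∈ D
  · have := hab v (by simpa using h)
    simp only [coeff_sub, Finsupp.coe_sub, Pi.sub_apply, sub_eq_zero] at this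
    simp [restrictTo, h, this]
  · simp [restrictTo, h, hb v h]

variable (ν : Measure ℝ) (f : SimpleFunc ℝ ℝ)

/-- The law of `f` under `ν`. -/
noncomputable def simpleLaw : AddMonoidAlgebra ℝ ℝ :=
  ∑ j ∈ f.range, single j (ν.real (f ⁻¹' {j}))

lemma pairing_mul_simpleLaw (g : ℝ → ℝ) (a : AddMonoidAlgebra ℝ ℝ) :
    pairing g (a * simpleLaw ν f) =
      pairing (fun x => ∑ j ∈ f.range, ν.real (f ⁻¹' {j}) * g (x + j)) a := by
  induction a using AddMonoidAlgebra.induction_linear with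
  | zero => simp
  | add a a' h h' => rw [add_mul, map_add, map_add, h, h']
  | single v c =>
    simp only [simpleLaw, Finset.mul_sum, single_mul_single, map_sum, pairing_single]
    exact Finset.sum_congr rfl fun j _ => by ring

lemma integral_comp_simple [IsProbabilityMeasure ν] (k : ℝ → ℝ) :
    ∫ a, k (f a) ∂ν = ∑ j ∈ f.range, ν.real (f ⁻¹' {j}) * k j := by
  have : (fun a => k (f a)) =
      fun a => ∑ j ∈ f.range, (f ⁻¹' {j}).indicator (fun _ => k j) a := by
    ext a
    rw [Finset.sum_eq_single (f a)]
    · simp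
    · intro b _ hb
      rw [Set.indicator_of_notMem]
      simpa using hb.symm
    · intro h; exact absurd (f.mem_range_self a) h
  rw [this, integral_finsetSum]
  · refine Finset.sum_congr rfl fun j _ => ?_
    rw [integral_indicator_const _ (f.measurableSet_fiber j), smul_eq_mul]
  · intro j _
    exact (integrable_const _).indicator (f.measurableSet_fiber j)

/-- The law of the walk with steps `f` at time `n` on the event that it stays in `D`. -/
noncomputable def stayLaw (D : Set ℝ) : ℕ → AddMonoidAlgebra ℝ ℝ
  | 0 => 1
  | n + 1 => restrictTo D (stayLaw D n * simpleLaw ν f)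

/-- The event that the walk with steps `f` stays in `D` up to time `n`. -/
def staySet (D : Set ℝ) (n : ℕ) : Set (ℕ → ℝ) :=
  {z | ∀ i ∈ Finset.Icc 1 n, walk (fun u => f (z u)) i ∈ D}

lemma measurable_simple_walk (n : ℕ) :
    Measurable fun z : ℕ → ℝ => walk (fun u => f (z u)) n :=
  (measurable_walk n).comp (measurable_pi_lambda _ fun u => f.measurable.comp (measurable_pi_apply u))

lemma measurableSet_staySet {D : Set ℝ} (hD : MeasurableSet D) (n : ℕ) :
    MeasurableSet (staySet f D n) := by
  have : staySet f D n =
      ⋂ i ∈ Finset.Icc 1 n, (fun z : ℕ → ℝ => walk (fun u => f (z u)) i) ⁻¹' D := by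
    ext z; simp [staySet]
  rw [this]
  exact Finset.measurableSet_biInter _ fun i _ => measurable_simple_walk f i hD

lemma pairing_stayLaw [IsProbabilityMeasure ν] {D : Set ℝ} (hD : MeasurableSet D) (n : ℕ) (g : ℝ → ℝ) (hg : Measurable g)
    (C : ℝ) (hC : ∀ x, |g x| ≤ C) :
    pairing g (stayLaw ν f D n) = ∫ z, (staySet f D n).indicator
      (fun z => g (walk (fun u => f (z u)) n)) z ∂(Measure.infinitePi fun _ : ℕ => ν) := by
  induction n generalizing g C with
  | zero =>
    have : staySet f D 0 = Set.univ := by ext z; simp [staySet]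
    simp [stayLaw, this, walk, one_def, pairing_single]
  | succ n ih =>
    set μ := Measure.infinitePi fun _ : ℕ => ν
    have hC0 : 0 ≤ C := (abs_nonneg _).trans (hC 0)
    have hDg : ∀ x, |D.indicator g x| ≤ C := fun x => by
      by_cases h : x ∈ D <;> simp [h, hC, hC0]
    have hDgm : Measurable (D.indicator g) := hg.indicator hD
    rw [stayLaw, pairing_restrictTo, pairing_mul_simpleLaw]
    rw [ih _ (by fun_prop) (∑ j ∈ f.range, ν.real (f ⁻¹' {j}) * C) (fun x => by
      refine (Finset.abs_sum_le_sum_abs _ _).trans (Finset.sum_le_sum fun j _ => ?_)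
      rw [abs_mul, abs_of_nonneg measureReal_nonneg]
      exact mul_le_mul_of_nonneg_left (hDg _) measureReal_nonneg)]
    have hmeas : Measurable ((staySet f D (n + 1)).indicator
        (fun z => g (walk (fun u => f (z u)) (n + 1)))) :=
      (hg.comp (measurable_simple_walk f _)).indicator (measurableSet_staySet f hD _)
    have hmp := measurePreserving_update ν (n + 1)
    -- resample the last step
    have hpt : ∀ (a : ℝ) (z : ℕ → ℝ), (staySet f D (n + 1)).indicator
        (fun z => g (walk (fun u => f (z u)) (n + 1))) (Function.update z (n + 1) a) =
        (staySet f D n).indicator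
          (fun z => D.indicator g (walk (fun u => f (z u)) n + f a)) z := by
      intro a z
      have hw : ∀ i, i ≤ n → walk (fun u => f (Function.update z (n + 1) a u)) i =
          walk (fun u => f (z u)) i := fun i hi => walk_congr fun j _ hj => by
        rw [Function.update_of_ne (by omega)]
      have hw1 : walk (fun u => f (Function.update z (n + 1) a u)) (n + 1) =
          walk (fun u => f (z u)) n + f a := by
        rw [walk_succ, hw n le_rfl, Function.update_self]
      have hiff : Function.update z (n + 1) a ∈ staySet f D (n + 1) ↔
          z ∈ staySet f D n ∧ walk (fun u => f (z u)) n + f a ∈ D := by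
        simp only [staySet, Set.mem_ofPred_eq, Finset.mem_Icc]
        constructor
        · intro h
          refine ⟨fun i hi => hw i hi.2 ▸ h i ⟨hi.1, by omega⟩, hw1 ▸ h (n + 1) (by simp)⟩
        · rintro ⟨h1, h2⟩ i hi
          rcases Nat.lt_or_ge n i with h | h
          · obtain rfl : i = n + 1 := by omega
            rwa [hw1]
          · rw [hw i h]; exact h1 i ⟨hi.1, h⟩
      by_cases h1 : z ∈ staySet f D n <;>
        by_cases h2 : walk (fun u => f (z u)) n + f a ∈ D <;>
        simp [Set.indicator, hiff, h1, h2, hw1]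
    have hint := integral_map (μ := ν.prod μ) hmp.measurable.aemeasurable
      hmeas.aestronglyMeasurable
    rw [hmp.map_eq] at hint
    rw [hint, integral_prod_symm]
    · simp only [hpt]
      refine integral_congr_ae (Eventually.of_forall fun z => ?_)
      by_cases h1 : z ∈ staySet f D n
      · simp only [Set.indicator_of_mem h1]
        rw [integral_comp_simple ν f (fun j => D.indicator g (walk (fun u => f (z u)) n + j))]
      · simp [Set.indicator_of_notMem h1]
    · refine Integrable.of_bound (hmeas.comp hmp.measurable).aestronglyMeasurable C
        (Eventually.of_forall fun q => ?_)
      rw [Real.norm_eq_abs]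
      by_cases h : Function.update q.2 (n + 1) q.1 ∈ staySet f D (n + 1) <;> simp [h, hC, hC0]

lemma stayLaw_univ (n : ℕ) : stayLaw ν f Set.univ n = simpleLaw ν f ^ n := by
  induction n with
  | zero => rfl
  | succ n ih => rw [stayLaw, restrictTo_univ, ih, pow_succ]

/-- The Sparre Andersen recursion for the probabilities that a walk stays negative. -/
lemma simple_recursion [IsProbabilityMeasure ν] (n : ℕ) :
    n * (Measure.infinitePi fun _ : ℕ => ν).real (staySet f (Set.Iio 0) n) =
      ∑ i ∈ Finset.range (n + 1), (if i = 0 then 0 else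
        (Measure.infinitePi fun _ : ℕ => ν).real {z | walk (fun u => f (z u)) i < 0}) *
        (Measure.infinitePi fun _ : ℕ => ν).real (staySet f (Set.Iio 0) (n - i)) := by
  set μ := Measure.infinitePi fun _ : ℕ => ν
  obtain ⟨U, hU0, hU, hrec⟩ := exists_split_pow (measuresOn (Set.Iio 0)) (measuresOn (Set.Iio 0)ᶜ)
    (measuresOn_mul fun x hx y hy => by simp only [Set.mem_Iio] at *; linarith)
    (measuresOn_mul fun x hx y hy => by
      simp only [Set.mem_compl_iff, Set.mem_Iio, not_lt] at *; linarith)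
    (simpleLaw ν f) (stayLaw ν f (Set.Iio 0))
    (fun n => restrictTo (Set.Iio 0)ᶜ (stayLaw ν f (Set.Iio 0) (n - 1) * simpleLaw ν f)) rfl
    (fun n hn => by
      obtain ⟨m, rfl⟩ : ∃ m, n = m + 1 := ⟨n - 1, by omega⟩
      exact restrictTo_mem _ _)
    (fun n _ => restrictTo_mem _ _)
    (fun n => (restrictTo_add_compl _ _).symm)
  have hmass : ∀ m, pairing (fun _ => 1) (stayLaw ν f (Set.Iio 0) m) =
      μ.real (staySet f (Set.Iio 0) m) := by
    intro m
    rw [pairing_stayLaw ν f measurableSet_Iio m _ measurable_const 1 (by simp)]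
    rw [integral_indicator_const _ (measurableSet_staySet f measurableSet_Iio m)]
    simp [μ]
  -- `U i` is the restriction to the negative half-line of the law of the walk at time `i`
  have hneg : ∀ i, i ≠ 0 → pairing (fun _ => 1) (U i) =
      μ.real {z | walk (fun u => f (z u)) i < 0} := by
    intro i hi
    obtain ⟨h1, h2⟩ := hU i (by omega)
    rw [← restrictTo_eq h1 h2, pairing_restrictTo, ← stayLaw_univ,
      pairing_stayLaw ν f MeasurableSet.univ i _ (measurable_const.indicator measurableSet_Iio) 1
      (fun x => by by_cases h : x < 0 <;> simp [h])]
    have : staySet f Set.univ i = Set.univ := by ext z; simp [staySet]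
    rw [this, Set.indicator_univ]
    have h2 : (fun z : ℕ → ℝ => (Set.Iio (0 : ℝ)).indicator (fun _ => (1 : ℝ))
        (walk (fun u => f (z u)) i)) =
        {z : ℕ → ℝ | walk (fun u => f (z u)) i < 0}.indicator fun _ => 1 := by
      ext z; simp [Set.indicator]
    rw [h2, integral_indicator_const _ (measurableSet_lt (measurable_simple_walk f i) measurable_const)]
    simp [μ]
  have := congrArg (pairing fun _ => 1) (hrec n)
  rw [← nsmul_eq_mul, map_nsmul, hmass, map_sum, nsmul_eq_mul] at this
  rw [this]
  refine Finset.sum_congr rfl fun i _ => ?_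
  rw [pairing_one_mul, hmass]
  split_ifs with hi
  · simp [hi, hU0]
  · rw [hneg i hi]

end Spitzer

/-! ### The probability that a Gaussian walk with negative drift stays negative -/

lemma hasDerivAt_tsum_mul_pow {p : ℕ → ℝ} (hp : ∀ n, |p n| ≤ 1) {s : ℝ} (hs : |s| < 1) :
    HasDerivAt (fun s : ℝ => ∑' n, p n * s ^ n) (∑' n, p n * (n * s ^ (n - 1))) s := by
  obtain ⟨r, hr1, hr2⟩ := exists_between hs
  have hr0 : 0 < r := (abs_nonneg s).trans_lt hr1
  have hsum : Summable fun n : ℕ => (n : ℝ) * r ^ (n - 1) := by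
    have h := summable_pow_mul_geometric_of_norm_lt_one 1 (R := ℝ) (r := r)
      (by rwa [Real.norm_eq_abs, abs_of_pos hr0])
    refine (h.mul_left r⁻¹).congr fun n => ?_
    rcases n with _ | n
    · simp
    · rw [Nat.add_sub_cancel, pow_succ r n]; field_simp
  refine hasDerivAt_tsum_of_isPreconnected (g := fun n s => p n * s ^ n)
    (g' := fun n s => p n * (n * s ^ (n - 1))) hsum (t := Set.Ioo (-r) r) (y₀ := 0) isOpen_Ioo
    isPreconnected_Ioo (fun n y _ => ?_) (fun n y hy => ?_) ⟨by linarith, hr0⟩ ?_ ?_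
  · simpa using (hasDerivAt_pow n y).const_mul (p n)
  · rw [Real.norm_eq_abs, abs_mul, abs_mul, abs_pow, Nat.abs_cast]
    have hy' : |y| ≤ r := (abs_lt.2 hy).le
    calc |p n| * (n * |y| ^ (n - 1)) ≤ 1 * (n * r ^ (n - 1)) := by
          gcongr
          exact hp n
      _ = _ := one_mul _
  · refine summable_of_ne_finset_zero (s := {0}) fun n hn => ?_
    simp at hn; simp [hn]
  · exact abs_lt.1 hr1

/-- The limit in Spitzer's identity. With `P(s) = ∑ p n * s ^ n`, the recursion says that
`s P'(s) / P(s) = s / (1 - s) - ∑ b i * s ^ i`, so that `(1 - s) P(s) exp (∑ i ≤ M, b i * s ^ i / i)`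
decreases from its value `1` at `s = 0`. -/
lemma le_exp_of_recursion {p b : ℕ → ℝ} (hp0 : p 0 = 1) (hp_nonneg : ∀ n, 0 ≤ p n)
    (hp1 : ∀ n, p n ≤ 1) (hb : ∀ n, 0 ≤ b n) (hb1 : ∀ n, b n ≤ 1)
    (hrec : ∀ n : ℕ, n * p n =
      ∑ i ∈ Finset.range (n + 1), (if i = 0 then 0 else 1 - b i) * p (n - i))
    {l : ℝ} (hl : ∀ n, l ≤ p n) (M : ℕ) :
    l ≤ Real.exp (-∑ i ∈ Finset.range M, ((i : ℝ) + 1)⁻¹ * b (i + 1)) := by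
  let P : ℝ → ℝ := fun s => ∑' n, p n * s ^ n
  let P' : ℝ → ℝ := fun s => ∑' n, p n * (n * s ^ (n - 1))
  let E : ℝ → ℝ := fun s => ∑ i ∈ Finset.range M, ((i : ℝ) + 1)⁻¹ * b (i + 1) * s ^ (i + 1)
  let E' : ℝ → ℝ := fun s => ∑ i ∈ Finset.range M, b (i + 1) * s ^ i
  have habs : ∀ n, |p n| ≤ 1 := fun n => by rw [abs_of_nonneg (hp_nonneg n)]; exact hp1 n
  have hgeom : ∀ {s : ℝ}, 0 ≤ s → s < 1 → Summable fun n : ℕ => s ^ n := fun h0 h1 =>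
    summable_geometric_of_lt_one h0 h1
  have hPsum : ∀ {s : ℝ}, 0 ≤ s → s < 1 → Summable fun n => p n * s ^ n := fun {s} h0 h1 =>
    Summable.of_nonneg_of_le (fun n => mul_nonneg (hp_nonneg n) (pow_nonneg h0 n))
      (fun n => mul_le_of_le_one_left (pow_nonneg h0 n) (hp1 n)) (hgeom h0 h1)
  have hE : ∀ s, HasDerivAt E (E' s) s := by
    intro s
    refine (HasDerivAt.fun_sum fun i _ => ((hasDerivAt_pow (i + 1) s).const_mul
      (((i : ℝ) + 1)⁻¹ * b (i + 1)))).congr_deriv ?_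
    refine Finset.sum_congr rfl fun i _ => ?_
    have : (i : ℝ) + 1 ≠ 0 := by positivity
    push_cast
    field_simp
  have hP : ∀ {s : ℝ}, 0 ≤ s → s < 1 → HasDerivAt P (P' s) s := fun {s} h0 h1 =>
    hasDerivAt_tsum_mul_pow habs (by rwa [abs_of_nonneg h0])
  have hP_nonneg : ∀ {s : ℝ}, 0 ≤ s → 0 ≤ P s := fun h0 =>
    tsum_nonneg fun n => mul_nonneg (hp_nonneg n) (pow_nonneg h0 n)
  -- the differential inequality for `P`
  have hineq : ∀ {s : ℝ}, 0 < s → s < 1 → (1 - s) * P' s + (1 - s) * E' s * P s ≤ P s := by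
    intro s h0 h1
    let a : ℕ → ℝ := fun i => (if i = 0 then 0 else 1 - b i) * s ^ i
    have ha0 : ∀ i, 0 ≤ a i := fun i => by
      simp only [a]; split_ifs with h
      · simp
      · exact mul_nonneg (by linarith [hb1 i]) (pow_nonneg h0.le i)
    have hale : ∀ i, a i ≤ s ^ i := fun i => by
      simp only [a]; split_ifs with h
      · simpa using pow_nonneg h0.le i
      · exact mul_le_of_le_one_left (pow_nonneg h0.le i) (by linarith [hb i])
    have hasum : Summable a := Summable.of_nonneg_of_le ha0 hale (hgeom h0.le h1)
    have hcauchy : s * P' s = (∑' i, a i) * P s := by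
      rw [tsum_mul_tsum_eq_tsum_sum_range_of_summable_norm hasum.norm (hPsum h0.le h1).norm,
        ← tsum_mul_left]
      refine tsum_congr fun n => ?_
      have h2 : s * (p n * (n * s ^ (n - 1))) = (n * p n) * s ^ n := by
        rcases n with _ | n
        · simp
        · rw [Nat.add_sub_cancel]; ring
      rw [h2, hrec, Finset.sum_mul]
      refine Finset.sum_congr rfl fun i hi => ?_
      have : s ^ n = s ^ i * s ^ (n - i) := by
        rw [← pow_add]; congr 1; have := Finset.mem_range.1 hi; omega
      simp only [a]; rw [this]; ring
    have hA : (∑' i, a i) + s * E' s ≤ s * (1 - s)⁻¹ := by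
      have h3 : s * E' s = ∑' i, (if i ∈ Finset.Ico 1 (M + 1) then b i * s ^ i else 0) := by
        rw [tsum_eq_sum (s := Finset.Ico 1 (M + 1)) (fun i hi => if_neg hi)]
        rw [Finset.sum_congr rfl fun i hi => if_pos hi, Finset.sum_Ico_eq_sum_range,
          Finset.mul_sum]
        refine Finset.sum_congr (by simp) fun i _ => ?_
        rw [add_comm 1 i]; ring
      have hsm : Summable fun i => (if i ∈ Finset.Ico 1 (M + 1) then b i * s ^ i else 0) :=
        summable_of_ne_finset_zero (s := Finset.Ico 1 (M + 1)) fun i hi => if_neg hi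
      have h4 : s * (1 - s)⁻¹ = ∑' n : ℕ, (if n = 0 then 0 else s ^ n) := by
        have := hgeom h0.le h1
        rw [← tsum_geometric_of_lt_one h0.le h1, ← tsum_mul_left]
        have h5 : Summable fun n : ℕ => (if n = 0 then 0 else s ^ n) :=
          Summable.of_nonneg_of_le (fun n => by split_ifs <;> positivity)
            (fun n => by split_ifs <;> simp [*]) this
        rw [h5.tsum_eq_zero_add]
        simp only [if_pos, zero_add, Nat.add_eq_zero_iff, one_ne_zero, and_false, if_false]
        exact tsum_congr fun n => by ring
      rw [h3, ← hasum.tsum_add hsm, h4]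
      refine Summable.tsum_le_tsum (fun i => ?_) (hasum.add hsm)
        (Summable.of_nonneg_of_le (fun n => by split_ifs <;> positivity)
            (fun n => by split_ifs <;> simp [*]) (hgeom h0.le h1))
      by_cases hi : i = 0
      · simp [a, hi]
      · simp only [a, hi, if_false]
        have hpow := pow_nonneg h0.le i
        split_ifs
        · linarith
        · nlinarith [hb i]
    have h1s : 0 < 1 - s := by linarith
    have hPn := hP_nonneg h0.le
    have h6 : s * P' s + s * E' s * P s ≤ s * (1 - s)⁻¹ * P s := by
      rw [hcauchy, ← add_mul]
      exact mul_le_mul_of_nonneg_right hA hPn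
    have h7 : P' s + E' s * P s ≤ (1 - s)⁻¹ * P s := by
      refine le_of_mul_le_mul_left ?_ h0
      linarith
    calc (1 - s) * P' s + (1 - s) * E' s * P s = (1 - s) * (P' s + E' s * P s) := by ring
      _ ≤ (1 - s) * ((1 - s)⁻¹ * P s) := mul_le_mul_of_nonneg_left h7 h1s.le
      _ = P s := by field_simp
  let G : ℝ → ℝ := fun s => (1 - s) * P s * Real.exp (E s)
  have hG : ∀ {s : ℝ}, 0 ≤ s → s < 1 → HasDerivAt G
      ((-1 * P s + (1 - s) * P' s) * Real.exp (E s) +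
        (1 - s) * P s * (Real.exp (E s) * E' s)) s := fun {s} h0 h1 =>
    (((hasDerivAt_id s).const_sub 1).mul (hP h0 h1)).mul (hE s).exp
  have hanti : AntitoneOn G (Set.Ico 0 1) := by
    refine antitoneOn_of_deriv_nonpos (convex_Ico 0 1)
      (fun s hs => (hG hs.1 hs.2).continuousAt.continuousWithinAt)
      (fun s hs => ?_) fun s hs => ?_
    · rw [interior_Ico] at hs
      exact (hG hs.1.le hs.2).differentiableAt.differentiableWithinAt
    · rw [interior_Ico] at hs
      rw [(hG hs.1.le hs.2).deriv]
      have := mul_le_mul_of_nonneg_right (hineq hs.1 hs.2) (Real.exp_pos (E s)).le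
      linarith
  have hG0 : G 0 = 1 := by
    have hP0 : P 0 = 1 := by
      simp only [P]
      rw [tsum_eq_single 0 (fun n hn => by simp [hn])]
      simp [hp0]
    have hE0 : E 0 = 0 := by simp [E]
    simp [G, hP0, hE0]
  have hmain : ∀ s ∈ Set.Ioo (0 : ℝ) 1, l * Real.exp (E s) ≤ 1 := by
    intro s hs
    have h1s : 0 < 1 - s := by linarith [hs.2]
    have hlP : l ≤ (1 - s) * P s := by
      have : l * (1 - s)⁻¹ ≤ P s := by
        rw [← tsum_geometric_of_lt_one hs.1.le hs.2, ← tsum_mul_left]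
        exact Summable.tsum_le_tsum
          (fun n => mul_le_mul_of_nonneg_right (hl n) (pow_nonneg hs.1.le n))
          ((hgeom hs.1.le hs.2).mul_left l) (hPsum hs.1.le hs.2)
      calc l = (1 - s) * (l * (1 - s)⁻¹) := by field_simp
        _ ≤ _ := mul_le_mul_of_nonneg_left this h1s.le
    calc l * Real.exp (E s) ≤ G s := mul_le_mul_of_nonneg_right hlP (Real.exp_pos _).le
      _ ≤ G 0 := hanti ⟨le_rfl, one_pos⟩ ⟨hs.1.le, hs.2⟩ hs.1.le
      _ = 1 := hG0
  have hlim : Tendsto (fun s => l * Real.exp (E s)) (𝓝[<] 1) (𝓝 (l * Real.exp (E 1))) :=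
    (((hE 1).continuousAt.tendsto.rexp).const_mul l).mono_left nhdsWithin_le_nhds
  have h1 : l * Real.exp (E 1) ≤ 1 :=
    le_of_tendsto hlim (by
      filter_upwards [Ioo_mem_nhdsLT (zero_lt_one' ℝ)] with s hs using hmain s hs)
  have hE1 : E 1 = ∑ i ∈ Finset.range M, ((i : ℝ) + 1)⁻¹ * b (i + 1) := by simp [E]
  rw [← hE1, Real.exp_neg, ← one_div, le_div_iff₀ (Real.exp_pos _)]
  exact h1

/-- The law of a sequence of independent standard normal variables. -/
noncomputable abbrev gaussSeq : Measure (ℕ → ℝ) := Measure.infinitePi fun _ : ℕ => gaussianReal 0 1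

lemma map_walk (n : ℕ) : gaussSeq.map (fun z => walk z n) = gaussianReal 0 n := by
  induction n with
  | zero => simp [walk]
  | succ n ih =>
    have hmp : MeasurePreserving _ ((gaussianReal 0 1).prod gaussSeq) gaussSeq :=
      measurePreserving_update (gaussianReal 0 1) (n + 1)
    rw [← hmp.map_eq, Measure.map_map (measurable_walk _) hmp.measurable]
    have : (fun z => walk z (n + 1)) ∘
        (fun q : ℝ × (ℕ → ℝ) => Function.update q.2 (n + 1) q.1) =
        (fun r : ℝ × ℝ => r.1 + r.2) ∘ Prod.map id fun z => walk z n := by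
      ext q
      simp only [Function.comp, walk_succ, Function.update_self, Prod.map, id]
      rw [add_comm, walk_congr fun j _ hj => Function.update_of_ne (by omega) _ _]
    rw [this, ← Measure.map_map (by fun_prop) (by fun_prop),
      ← Measure.map_prod_map _ _ measurable_id (measurable_walk n), ih, Measure.map_id]
    have := gaussianReal_conv_gaussianReal (m₁ := 0) (m₂ := 0) (v₁ := 1) (v₂ := n)
    rw [Measure.conv] at this
    rw [this]
    simp [add_comm]

lemma gaussSeq_walk_eq {n : ℕ} (hn : n ≠ 0) (c : ℝ) : gaussSeq {z | walk z n = c} = 0 := by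
  have : {z : ℕ → ℝ | walk z n = c} = (fun z => walk z n) ⁻¹' {c} := rfl
  rw [this, ← Measure.map_apply (measurable_walk n) (measurableSet_singleton c), map_walk]
  have := nullSingletonClass_gaussianReal (μ := 0) (v := (n : NNReal)) (by simpa using hn)
  exact measure_singleton c

/-- The probability that the walk with steps `x z - x² / 2` stays non-positive up to time `n`. -/
noncomputable def negProb (x : ℝ) (n : ℕ) : ℝ≥0∞ :=
  gaussSeq {z | ∀ i ∈ Finset.Icc 1 n, x * walk z i - i * x ^ 2 / 2 ≤ 0}

lemma gaussSeq_drift_nonneg {x : ℝ} (hx : x ≠ 0) (n : ℕ) :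
    gaussSeq.real {z | 0 ≤ x * walk z (n + 1) - (n + 1 : ℕ) * x ^ 2 / 2} =
      cdf (gaussianReal 0 1) (-(Real.sqrt ((n : ℝ) + 1) / 2 * |x|)) := by
  have hx' : 0 < |x| := abs_pos.2 hx
  have hn : (0 : ℝ) < n + 1 := by positivity
  set r := Real.sqrt ((n : ℝ) + 1)
  have hr : 0 < r := Real.sqrt_pos.2 hn
  have hr2 : r ^ 2 = n + 1 := Real.sq_sqrt hn.le
  set c : ℝ := -(x / (|x| * r))
  have hc : c ^ 2 * (n + 1) = 1 := by
    simp only [c, neg_sq, div_pow, mul_pow, sq_abs, hr2]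
    field_simp
  have hmap : (gaussianReal 0 ((n + 1 : ℕ) : NNReal)).map (c * ·) = gaussianReal 0 1 := by
    rw [gaussianReal_map_const_mul]
    congr 1
    · simp
    · ext; push_cast; exact hc
  rw [cdf_eq_real, ← hmap, ← map_walk, Measure.map_map (by fun_prop) (measurable_walk _),
    map_measureReal_apply (by fun_prop) measurableSet_Iic]
  congr 1
  ext z
  simp only [Set.mem_ofPred_eq, Set.mem_preimage, Function.comp, Set.mem_Iic]
  set w := walk z (n + 1)
  have h1 : c * w = -(x * w / (|x| * r)) := by simp only [c]; ring
  have h2 : r / 2 * |x| = ((n + 1 : ℕ) * x ^ 2 / 2) / (|x| * r) := by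
    rw [eq_div_iff (by positivity)]
    push_cast
    rw [← hr2, ← sq_abs x]; ring
  rw [h1, neg_le_neg_iff, h2, div_le_div_iff_of_pos_right (by positivity)]
  constructor <;> intro h <;> linarith

lemma walk_affine (x : ℝ) (z : ℕ → ℝ) (n : ℕ) :
    walk (fun u => x * z u - x ^ 2 / 2) n = x * walk z n - n * x ^ 2 / 2 := by
  simp only [walk, Finset.sum_sub_distrib, ← Finset.mul_sum, Finset.sum_const, Nat.card_Icc,
    nsmul_eq_mul]
  push_cast
  simp
  ring

lemma tendsto_walk {z : ℕ → ℝ} {y : ℕ → ℕ → ℝ} (h : ∀ u, Tendsto (fun m => y m u) atTop (𝓝 (z u)))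
    (n : ℕ) : Tendsto (fun m => walk (y m) n) atTop (𝓝 (walk z n)) :=
  tendsto_finsetSum _ fun u _ => h u

lemma ae_drift_ne {x : ℝ} (hx : x ≠ 0) :
    ∀ᵐ z ∂gaussSeq, ∀ i : ℕ, i ≠ 0 → x * walk z i - i * x ^ 2 / 2 ≠ 0 := by
  rw [ae_all_iff]
  intro i
  by_cases hi : i = 0
  · simp [hi]
  · have h0 := gaussSeq_walk_eq hi (i * x / 2)
    filter_upwards [measure_eq_zero_iff_ae_notMem.1 h0] with z hz _ h
    refine hz (show walk z i = i * x / 2 from ?_)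
    have : x * (walk z i - i * x / 2) = 0 := by linarith
    rcases mul_eq_zero.1 this with h | h
    · exact absurd h hx
    · linarith

/-- The Sparre Andersen recursion for Gaussian walks with drift, by approximation of the step by
simple functions of a normal variable. The walk almost surely does not visit `0`, so that the events
that it is negative and that it is non-positive agree in the limit. -/
lemma negProb_recursion {x : ℝ} (hx : x ≠ 0) (n : ℕ) :
    n * (negProb x n).toReal = ∑ i ∈ Finset.range (n + 1),
      (if i = 0 then 0 else 1 - gaussSeq.real {z | 0 ≤ x * walk z i - i * x ^ 2 / 2}) *
        (negProb x (n - i)).toReal := by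
  have hsm : StronglyMeasurable (fun a : ℝ => x * a - x ^ 2 / 2) := by
    apply Measurable.stronglyMeasurable; fun_prop
  have hlim : ∀ (z : ℕ → ℝ) (i : ℕ), Tendsto (fun m => walk (fun u => hsm.approx m (z u)) i) atTop
      (𝓝 (x * walk z i - i * x ^ 2 / 2)) := by
    intro z i
    rw [← walk_affine]
    exact tendsto_walk (fun u => hsm.tendsto_approx (z u)) i
  have hstep : ∀ (z : ℕ → ℝ) (i : ℕ), x * walk z i - i * x ^ 2 / 2 ≠ 0 →
      ∀ᶠ m in atTop, (walk (fun u => hsm.approx m (z u)) i < 0 ↔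
        x * walk z i - i * x ^ 2 / 2 ≤ 0) := by
    intro z i h
    rcases lt_or_gt_of_ne h with h | h
    · filter_upwards [(hlim z i).eventually_lt_const h] with m hm
      exact ⟨fun _ => h.le, fun _ => hm⟩
    · filter_upwards [(hlim z i).eventually_const_lt h] with m hm
      exact ⟨fun h' => absurd h' (by linarith), fun h' => absurd h' (by linarith)⟩
  have hp : ∀ k, Tendsto (fun m => gaussSeq.real (staySet (hsm.approx m) (Set.Iio 0) k)) atTop
      (𝓝 (negProb x k).toReal) := by
    intro k
    refine (ENNReal.tendsto_toReal (measure_ne_top _ _)).comp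
      (tendsto_measure_of_ae_tendsto_indicator_of_isFiniteMeasure _ ?_
        (fun m => measurableSet_staySet _ measurableSet_Iio k) ?_)
    · simp only [Finset.mem_Icc]
      measurability
    · filter_upwards [ae_drift_ne hx] with z hz
      have : ∀ᶠ m in atTop, ∀ i ∈ Finset.Icc 1 k, (walk (fun u => hsm.approx m (z u)) i < 0 ↔
          x * walk z i - i * x ^ 2 / 2 ≤ 0) :=
        (Filter.eventually_all_finset _).2 fun i hi =>
          hstep z i (hz i (by have := (Finset.mem_Icc.1 hi).1; omega))
      filter_upwards [this] with m hm
      exact forall₂_congr hm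
  have ha : ∀ i, i ≠ 0 → Tendsto (fun m => gaussSeq.real
      {z | walk (fun u => hsm.approx m (z u)) i < 0}) atTop
      (𝓝 (1 - gaussSeq.real {z | 0 ≤ x * walk z i - i * x ^ 2 / 2})) := by
    intro i hi
    have hms : MeasurableSet {z : ℕ → ℝ | 0 ≤ x * walk z i - i * x ^ 2 / 2} :=
      measurableSet_le measurable_const (by fun_prop)
    rw [← probReal_compl_eq_one_sub hms]
    refine (ENNReal.tendsto_toReal (measure_ne_top _ _)).comp
      (tendsto_measure_of_ae_tendsto_indicator_of_isFiniteMeasure _ hms.compl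
        (fun m => measurableSet_lt (measurable_simple_walk _ i) measurable_const) ?_)
    filter_upwards [ae_drift_ne hx] with z hz
    filter_upwards [hstep z i (hz i hi)] with m hm
    simp only [Set.mem_ofPred_eq, Set.mem_compl_iff, not_le]
    rw [hm]
    exact ⟨fun h => lt_of_le_of_ne h (hz i hi), le_of_lt⟩
  refine tendsto_nhds_unique ((hp n).const_mul (n : ℝ)) ?_
  simp only [gaussSeq, simple_recursion]
  refine tendsto_finsetSum _ fun i _ => ?_
  split_ifs with hi
  · simp
  · exact (ha i hi).mul (hp _)

lemma negProb_le_one (x : ℝ) (n : ℕ) : negProb x n ≤ 1 := prob_le_one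

lemma negProb_anti (x : ℝ) : Antitone (negProb x) := fun _ _ hmn =>
  measure_mono fun _ hz i hi => hz i (Finset.mem_Icc.2
    ⟨(Finset.mem_Icc.1 hi).1, (Finset.mem_Icc.1 hi).2.trans hmn⟩)

/-- The walk with negative drift stays non-positive forever with probability
`exp (-∑ i⁻¹ Φ(-√i |x| / 2))` at most. -/
lemma iInf_negProb_le {x : ℝ} (hx : x ≠ 0) :
    ⨅ n, negProb x n ≤ ENNReal.ofReal (Real.exp (-∑' i : ℕ,
      ((i : ℝ) + 1)⁻¹ * cdf (gaussianReal 0 1) (-(Real.sqrt ((i : ℝ) + 1) / 2 * |x|)))) := by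
  have hfin : ∀ n, negProb x n ≠ ∞ := fun n => measure_ne_top _ _
  have hIfin : ⨅ n, negProb x n ≠ ∞ := ne_top_of_le_ne_top (hfin 0) (iInf_le _ 0)
  rw [← ENNReal.ofReal_toReal hIfin]
  refine ENNReal.ofReal_le_ofReal ?_
  have hM := fun M : ℕ => le_exp_of_recursion (p := fun n => (negProb x n).toReal)
    (b := fun i => gaussSeq.real {z | 0 ≤ x * walk z i - i * x ^ 2 / 2})
    (by simp [negProb]) (fun n => ENNReal.toReal_nonneg)
    (fun n => ENNReal.toReal_le_of_le_ofReal zero_le_one (by simpa using negProb_le_one x n))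
    (fun n => measureReal_nonneg) (fun n => measureReal_le_one) (negProb_recursion hx)
    (l := (⨅ n, negProb x n).toReal) (fun n => ENNReal.toReal_mono (hfin n) (iInf_le _ n)) M
  simp only [gaussSeq_drift_nonneg hx] at hM
  by_cases hs : Summable fun i : ℕ =>
      ((i : ℝ) + 1)⁻¹ * cdf (gaussianReal 0 1) (-(Real.sqrt ((i : ℝ) + 1) / 2 * |x|))
  · exact ge_of_tendsto' (hs.hasSum.tendsto_sum_nat.neg.rexp) hM
  · -- The series does converge; otherwise its sum would be `0` and the bound trivial.
    rw [tsum_eq_zero_of_not_summable hs]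
    simpa using hM 0

/-! ### Medians on finite windows -/

/-- The median of the weights `r 0, …, r n`: the number of the `v < n` for which
`r 0 + … + r v` is less than half of the total, since these `v` are the ones below the median. -/
noncomputable def natMed (r : ℕ → ℝ) (n : ℕ) : ℕ :=
  ∑ v ∈ Finset.range n,
    if ∑ i ∈ Finset.range (v + 1), r i < (∑ i ∈ Finset.range (n + 1), r i) / 2 then 1 else 0

lemma natMed_le (r : ℕ → ℝ) (n : ℕ) : natMed r n ≤ n := by
  calc natMed r n ≤ ∑ v ∈ Finset.range n, 1 := Finset.sum_le_sum fun v _ => by split_ifs <;> simp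
    _ = n := by simp

lemma lt_natMed_iff {r : ℕ → ℝ} (hr : ∀ i, 0 ≤ r i) {n v : ℕ} (hv : v < n) :
    v < natMed r n ↔
      ∑ i ∈ Finset.range (v + 1), r i < (∑ i ∈ Finset.range (n + 1), r i) / 2 := by
  set c := (∑ i ∈ Finset.range (n + 1), r i) / 2
  have hmono : ∀ a b, a ≤ b → ∑ i ∈ Finset.range (a + 1), r i ≤ ∑ i ∈ Finset.range (b + 1), r i :=
    fun a b hab => Finset.sum_le_sum_of_subset_of_nonneg
      (Finset.range_subset_range.2 (by omega)) fun i _ _ => hr i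
  have hcard : natMed r n =
      ((Finset.range n).filter fun v => ∑ i ∈ Finset.range (v + 1), r i < c).card := by
    rw [natMed, Finset.card_filter]
  constructor
  · intro h
    by_contra hc
    have hsub : ((Finset.range n).filter fun v => ∑ i ∈ Finset.range (v + 1), r i < c) ⊆
        Finset.range v := by
      intro a ha
      rw [Finset.mem_filter] at ha
      rw [Finset.mem_range]
      by_contra hav
      exact hc ((hmono v a (by omega)).trans_lt ha.2)
    have := Finset.card_le_card hsub
    rw [← hcard, Finset.card_range] at this
    omega
  · intro h
    have hsub : Finset.range (v + 1) ⊆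
        ((Finset.range n).filter fun v => ∑ i ∈ Finset.range (v + 1), r i < c) := by
      intro a ha
      rw [Finset.mem_range] at ha
      rw [Finset.mem_filter, Finset.mem_range]
      exact ⟨by omega, (hmono a v (by omega)).trans_lt h⟩
    have := Finset.card_le_card hsub
    rw [← hcard, Finset.card_range] at this
    omega

lemma natAbs_sub_eq_sum {n i u : ℕ} (hi : i ≤ n) (hu : u ≤ n) :
    ((((i : ℤ) - u).natAbs : ℕ) : ℝ) = ∑ v ∈ Finset.range n,
      if v < u then (if i < v + 1 then 1 else 0) else (if i < v + 1 then 0 else 1) := by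
  have h : ∀ a b : ℕ, b ≤ n → ∑ v ∈ Finset.range n, (if v ∈ Finset.Ico a b then (1 : ℝ) else 0) =
      ((b - a : ℕ) : ℝ) := by
    intro a b hb
    rw [← Finset.sum_filter, Finset.filter_mem_eq_inter, Finset.inter_eq_right.2, Finset.sum_const,
      Nat.card_Ico, nsmul_eq_mul, mul_one]
    intro v hv
    have := Finset.mem_Ico.1 hv
    exact Finset.mem_range.2 (by omega)
  rcases le_total i u with hiu | hiu
  · rw [show ((i : ℤ) - u).natAbs = u - i by omega, ← h i u hu]
    refine Finset.sum_congr rfl fun v _ => ?_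
    simp only [Finset.mem_Ico]
    split_ifs <;> first | rfl | omega
  · rw [show ((i : ℤ) - u).natAbs = i - u by omega, ← h u i hi]
    refine Finset.sum_congr rfl fun v _ => ?_
    simp only [Finset.mem_Ico]
    split_ifs <;> first | rfl | omega

/-- The expected distance from `u` is a sum over the cut points `v`, of the mass on one side of `v`
or the other according to the position of `u`. -/
lemma sum_mul_natAbs_sub (r : ℕ → ℝ) {n u : ℕ} (hu : u ≤ n) :
    ∑ i ∈ Finset.range (n + 1), r i * ((((i : ℤ) - u).natAbs : ℕ) : ℝ) =
      ∑ v ∈ Finset.range n, if v < u then ∑ i ∈ Finset.range (v + 1), r i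
        else (∑ i ∈ Finset.range (n + 1), r i) - ∑ i ∈ Finset.range (v + 1), r i := by
  have h1 : ∀ i ∈ Finset.range (n + 1), r i * ((((i : ℤ) - u).natAbs : ℕ) : ℝ) =
      ∑ v ∈ Finset.range n, r i *
        (if v < u then (if i < v + 1 then 1 else 0) else (if i < v + 1 then 0 else 1)) := by
    intro i hi
    rw [natAbs_sub_eq_sum (by have := Finset.mem_range.1 hi; omega) hu, Finset.mul_sum]
  rw [Finset.sum_congr rfl h1, Finset.sum_comm]
  refine Finset.sum_congr rfl fun v hv => ?_
  have hv' := Finset.mem_range.1 hv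
  have h2 : ∑ i ∈ Finset.range (v + 1), r i =
      ∑ i ∈ Finset.range (n + 1), r i * (if i < v + 1 then 1 else 0) := by
    simp only [mul_ite, mul_one, mul_zero]
    rw [← Finset.sum_filter]
    congr 1
    ext i
    simp only [Finset.mem_filter, Finset.mem_range]
    omega
  split_ifs
  · exact h2.symm
  · rw [h2, ← Finset.sum_sub_distrib]
    exact Finset.sum_congr rfl fun i _ => by split_ifs <;> ring

/-- The median minimizes the expected distance. -/
lemma natMed_optimal {r : ℕ → ℝ} (hr : ∀ i, 0 ≤ r i) {n u : ℕ} (hu : u ≤ n) :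
    ∑ i ∈ Finset.range (n + 1), r i * ((((i : ℤ) - natMed r n).natAbs : ℕ) : ℝ) ≤
      ∑ i ∈ Finset.range (n + 1), r i * ((((i : ℤ) - u).natAbs : ℕ) : ℝ) := by
  rw [sum_mul_natAbs_sub r hu, sum_mul_natAbs_sub r (natMed_le r n)]
  refine Finset.sum_le_sum fun v hv => ?_
  have := lt_natMed_iff hr (Finset.mem_range.1 hv)
  split_ifs with h1 h2 h2
  · exact le_rfl
  · have := this.1 h1; linarith
  · have := not_lt.1 (mt this.2 h1); linarith
  · exact le_rfl

lemma natMed_congr_mul {r r' : ℕ → ℝ} {n : ℕ} {c : ℝ} (hc : 0 < c)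
    (h : ∀ i ≤ n, r' i = c * r i) : natMed r' n = natMed r n := by
  have hsum : ∀ v ≤ n, ∑ i ∈ Finset.range (v + 1), r' i = c * ∑ i ∈ Finset.range (v + 1), r i := by
    intro v hv
    rw [Finset.mul_sum]
    exact Finset.sum_congr rfl fun i hi => h i (by have := Finset.mem_range.1 hi; omega)
  refine Finset.sum_congr rfl fun v hv => ?_
  rw [hsum v (Finset.mem_range.1 hv).le, hsum n le_rfl, mul_div_assoc]
  simp only [mul_lt_mul_iff_right₀ hc]

/-- The median of the restriction of `p` to the integers from `-l` to `n - l`. -/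
noncomputable def windowMed (p : ℤ → ℝ) (l n : ℕ) : ℤ := natMed (fun i => p (i - l)) n - l

lemma measurable_natMed {α : Type*} [MeasurableSpace α] {r : α → ℕ → ℝ}
    (hr : ∀ i, Measurable fun a => r a i) (n : ℕ) : Measurable fun a => natMed (r a) n := by
  unfold natMed
  refine Finset.measurable_sum _ fun v _ => Measurable.ite (measurableSet_lt ?_ ?_)
    measurable_const measurable_const <;> fun_prop

/-! ### Shifting a change-point in Gaussian noise -/

lemma gaussianReal_add_eq_withDensity (m δ : ℝ) {v : NNReal} (hv : v ≠ 0) :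
    gaussianReal (m + δ) v = (gaussianReal m v).withDensity
      fun y => ENNReal.ofReal (Real.exp ((δ * (y - m) - δ ^ 2 / 2) / v)) := by
  have hv' : (v : ℝ) ≠ 0 := by exact_mod_cast hv
  rw [gaussianReal_of_var_ne_zero _ hv, gaussianReal_of_var_ne_zero _ hv,
    ← withDensity_mul _ (measurable_gaussianPDF _ _) (by fun_prop)]
  congr 1
  ext y
  simp only [Pi.mul_apply, gaussianPDF]
  rw [← ENNReal.ofReal_mul (gaussianPDFReal_nonneg _ _ _)]
  congr 1
  simp only [gaussianPDFReal]
  rw [mul_assoc, mul_assoc, ← Real.exp_add]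
  congr 2
  field_simp
  ring

lemma pi_withDensity {ι : Type*} [Fintype ι] (μ : ι → Measure ℝ) [∀ i, IsProbabilityMeasure (μ i)]
    (f : ι → ℝ → ℝ≥0∞) (hf : ∀ i, Measurable (f i))
    [∀ i, IsProbabilityMeasure ((μ i).withDensity (f i))] :
    Measure.pi (fun i => (μ i).withDensity (f i)) =
      (Measure.pi μ).withDensity fun y => ∏ i, f i (y i) := by
  refine Measure.pi_eq fun s hs => ?_
  rw [withDensity_apply _ (MeasurableSet.univ_pi hs),
    ← lintegral_indicator (MeasurableSet.univ_pi hs)]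
  have h : ∀ y : ι → ℝ, (Set.univ.pi s).indicator (fun y => ∏ i, f i (y i)) y =
      ∏ i, (s i).indicator (f i) (y i) := by
    intro y
    by_cases hy : y ∈ Set.univ.pi s
    · rw [Set.indicator_of_mem hy]
      exact Finset.prod_congr rfl fun i _ => (Set.indicator_of_mem (hy i trivial) _).symm
    · rw [Set.indicator_of_notMem hy]
      simp only [Set.mem_univ_pi, not_forall] at hy
      obtain ⟨i, hi⟩ := hy
      exact (Finset.prod_eq_zero (Finset.mem_univ i) (Set.indicator_of_notMem hi _)).symm
  simp only [h]
  rw [lintegral_prod_eq_prod_lintegral_of_indepFun Finset.univ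
    (fun i (y : ι → ℝ) => (s i).indicator (f i) (y i))
    (iIndepFun_pi (X := fun i => (s i).indicator (f i))
      fun i => ((hf i).indicator (hs i)).aemeasurable)
    (fun i => ((hf i).indicator (hs i)).comp (measurable_pi_apply i))]
  refine Finset.prod_congr rfl fun i _ => ?_
  rw [(measurePreserving_eval μ i).lintegral_comp ((hf i).indicator (hs i)),
    lintegral_indicator (hs i), withDensity_apply _ (hs i)]

/-- The law of the observations for a mean vector that equals `b` up to time `t` and `b + δ`
afterwards. -/
noncomputable def shiftLaw (T : ℕ) (b : ℕ → ℝ) (δ σ : ℝ) (t : ℕ) :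
    Measure (Finset.Icc 1 T → ℝ) :=
  Measure.pi fun u => gaussianReal (b u + if t < u then δ else 0) (σ ^ 2).toNNReal

instance (T : ℕ) (b : ℕ → ℝ) (δ σ : ℝ) (t : ℕ) : IsProbabilityMeasure (shiftLaw T b δ σ t) := by
  unfold shiftLaw; infer_instance

/-- The extension of a vector by `0`. -/
def extendZero {T : ℕ} (y : Finset.Icc 1 T → ℝ) (u : ℕ) : ℝ :=
  if h : u ∈ Finset.Icc 1 T then y ⟨u, h⟩ else 0

@[fun_prop]
lemma measurable_extendZero {T : ℕ} (u : ℕ) :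
    Measurable fun y : Finset.Icc 1 T → ℝ => extendZero y u := by
  unfold extendZero
  split_ifs <;> fun_prop

/-- The density of `shiftLaw T b δ σ t` with respect to `shiftLaw T b 0 σ 0`. -/
noncomputable def shiftDensity (T : ℕ) (b : ℕ → ℝ) (δ σ : ℝ) (t : ℕ)
    (y : Finset.Icc 1 T → ℝ) : ℝ :=
  Real.exp (∑ u ∈ Finset.Ioc t T, (δ * (extendZero y u - b u) - δ ^ 2 / 2) / σ ^ 2)

@[fun_prop]
lemma measurable_shiftDensity (T : ℕ) (b : ℕ → ℝ) (δ σ : ℝ) (t : ℕ) :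
    Measurable (shiftDensity T b δ σ t) := by
  unfold shiftDensity; fun_prop

lemma shiftLaw_eq_withDensity (T : ℕ) (b : ℕ → ℝ) (δ : ℝ) {σ : ℝ} (hσ : 0 < σ) (t : ℕ) :
    shiftLaw T b δ σ t = (shiftLaw T b 0 σ 0).withDensity
      fun y => ENNReal.ofReal (shiftDensity T b δ σ t y) := by
  have hv : (σ ^ 2).toNNReal ≠ 0 := by
    rw [Ne, Real.toNNReal_eq_zero, not_le]; positivity
  have hv' : ((σ ^ 2).toNNReal : ℝ) = σ ^ 2 := Real.coe_toNNReal _ (by positivity)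
  let f : Finset.Icc 1 T → ℝ → ℝ≥0∞ := fun u y => ENNReal.ofReal
    (Real.exp (if t < u then (δ * (y - b u) - δ ^ 2 / 2) / σ ^ 2 else 0))
  have hf : ∀ u, Measurable (f u) := fun u => by
    simp only [f]; split_ifs <;> fun_prop
  have h1 : ∀ u : Finset.Icc 1 T, gaussianReal (b u + if t < u then δ else 0) (σ ^ 2).toNNReal =
      (gaussianReal (b u) (σ ^ 2).toNNReal).withDensity (f u) := by
    intro u
    simp only [f]
    split_ifs
    · rw [gaussianReal_add_eq_withDensity _ _ hv, hv']
    · simp only [add_zero, Real.exp_zero, ENNReal.ofReal_one]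
      exact withDensity_one.symm
  have h2 : shiftLaw T b 0 σ 0 =
      Measure.pi fun u : Finset.Icc 1 T => gaussianReal (b u) (σ ^ 2).toNNReal := by
    simp [shiftLaw]
  have : ∀ u : Finset.Icc 1 T, IsProbabilityMeasure
      ((gaussianReal (b u) (σ ^ 2).toNNReal).withDensity (f u)) := fun u => by
    rw [← h1]; infer_instance
  rw [h2, shiftLaw]
  simp only [h1]
  rw [pi_withDensity _ _ hf]
  congr 1
  ext y
  simp only [f]
  rw [← ENNReal.ofReal_prod_of_nonneg fun _ _ => (Real.exp_pos _).le, ← Real.exp_sum, shiftDensity]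
  congr 2
  have h3 : ∀ u : Finset.Icc 1 T, (if t < (u : ℕ) then (δ * (y u - b u) - δ ^ 2 / 2) / σ ^ 2 else 0)
      = (fun u : ℕ => if t < u then (δ * (extendZero y u - b u) - δ ^ 2 / 2) / σ ^ 2 else 0) u := by
    intro u
    simp [extendZero, u.2]
  simp only [h3]
  rw [Finset.sum_coe_sort (Finset.Icc 1 T)
    (fun u : ℕ => if t < u then (δ * (extendZero y u - b u) - δ ^ 2 / 2) / σ ^ 2 else 0),
    ← Finset.sum_filter]
  congr 1
  ext u
  simp only [Finset.mem_filter, Finset.mem_Icc, Finset.mem_Ioc]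
  omega

/-- The observations built from two independent sequences of standard normal variables, which
are the noise to the right and to the left of the change-point `t`. -/
def twoSided (T : ℕ) (b : ℕ → ℝ) (δ σ : ℝ) (t : ℕ) (z : (ℕ → ℝ) × (ℕ → ℝ)) :
    Finset.Icc 1 T → ℝ :=
  fun u => if t < u then b u + δ - σ * z.1 (u - t) else b u + σ * z.2 (t + 1 - u)

lemma measurable_twoSided (T : ℕ) (b : ℕ → ℝ) (δ σ : ℝ) (t : ℕ) :
    Measurable (twoSided T b δ σ t) := by
  refine measurable_pi_lambda _ fun u => ?_
  unfold twoSided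
  split_ifs <;> fun_prop

lemma gaussianReal_affine (m c : ℝ) {σ : ℝ} (hc : c ^ 2 = σ ^ 2) {s : Set ℝ}
    (hs : MeasurableSet s) :
    gaussianReal 0 1 {a | m + c * a ∈ s} = gaussianReal m (σ ^ 2).toNNReal s := by
  have h : (gaussianReal 0 1).map (fun a => m + c * a) = gaussianReal m (σ ^ 2).toNNReal := by
    have : (fun a => m + c * a) = (fun a => m + a) ∘ (fun a => c * a) := rfl
    rw [this, ← Measure.map_map (by fun_prop) (by fun_prop), gaussianReal_map_const_mul,
      gaussianReal_map_const_add]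
    congr 1
    · simp
    · rw [mul_one]; ext; simp [hc, sq_nonneg]
  rw [← h, Measure.map_apply (by fun_prop) hs]
  rfl

lemma measurePreserving_twoSided (T : ℕ) (b : ℕ → ℝ) (δ σ : ℝ) {t : ℕ} (htT : t ≤ T) :
    MeasurePreserving (twoSided T b δ σ t) (gaussSeq.prod gaussSeq) (shiftLaw T b δ σ t) := by
  refine ⟨measurable_twoSided T b δ σ t, (Measure.pi_eq fun s hs => ?_).symm⟩
  rw [Measure.map_apply (measurable_twoSided T b δ σ t) (MeasurableSet.univ_pi hs)]
  let s' : ℕ → Set ℝ := fun u => if h : u ∈ Finset.Icc 1 T then s ⟨u, h⟩ else Set.univ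
  have hs' : ∀ u, MeasurableSet (s' u) := fun u => by
    simp only [s']; split_ifs
    · exact hs _
    · exact MeasurableSet.univ
  have hset : twoSided T b δ σ t ⁻¹' (Set.univ.pi s) =
      (Set.pi (Finset.Icc 1 (T - t) : Finset ℕ)
        fun i => {a | b (t + i) + δ + (-σ) * a ∈ s' (t + i)}) ×ˢ
      (Set.pi (Finset.Icc 1 t : Finset ℕ)
        fun i => {a | b (t + 1 - i) + σ * a ∈ s' (t + 1 - i)}) := by
    ext ⟨zp, zm⟩
    simp only [Set.mem_preimage, Set.mem_prod, Set.mem_pi, Finset.coe_Icc,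
      Set.mem_Icc, Set.mem_ofPred_eq]
    constructor
    · intro h
      refine ⟨fun i hi => ?_, fun i hi => ?_⟩
      · have hm : t + i ∈ Finset.Icc 1 T := Finset.mem_Icc.2 ⟨by omega, by omega⟩
        have := h ⟨t + i, hm⟩ trivial
        simp only [twoSided, if_pos (show t < t + i by omega), Nat.add_sub_cancel_left] at this
        simp only [s', dif_pos hm]
        rwa [neg_mul, ← sub_eq_add_neg]
      · have hm : t + 1 - i ∈ Finset.Icc 1 T := Finset.mem_Icc.2 ⟨by omega, by omega⟩
        have := h ⟨t + 1 - i, hm⟩ trivial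
        simp only [twoSided, if_neg (show ¬ t < t + 1 - i by omega),
          show t + 1 - (t + 1 - i) = i by omega] at this
        simpa only [s', dif_pos hm] using this
    · rintro ⟨h1, h2⟩ ⟨u, hu⟩ -
      have hu' := Finset.mem_Icc.1 hu
      simp only [twoSided]
      split_ifs with htu
      · have := h1 (u - t) ⟨by omega, by omega⟩
        rw [show t + (u - t) = u by omega] at this
        simp only [s', dif_pos hu] at this
        rwa [neg_mul, ← sub_eq_add_neg] at this
      · have := h2 (t + 1 - u) ⟨by omega, by omega⟩
        rw [show t + 1 - (t + 1 - u) = u by omega] at this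
        simpa only [s', dif_pos hu] using this
  let G : ℕ → ℝ≥0∞ := fun u =>
    gaussianReal (b u + if t < u then δ else 0) (σ ^ 2).toNNReal (s' u)
  have hG : ∀ u : Finset.Icc 1 T,
      gaussianReal (b u + if t < u then δ else 0) (σ ^ 2).toNNReal (s u) = G u := by
    intro u; simp only [G, s', dif_pos u.2]
  rw [hset, Measure.prod_prod, Measure.infinitePi_pi _ fun i _ => ?_,
    Measure.infinitePi_pi _ fun i _ => ?_]
  rotate_left
  · exact (by fun_prop : Measurable fun a : ℝ => b (t + 1 - i) + σ * a) (hs' _)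
  · exact (by fun_prop : Measurable fun a : ℝ => b (t + i) + δ + (-σ) * a) (hs' _)
  simp only [hG]
  rw [Finset.prod_coe_sort (Finset.Icc 1 T) G]
  have e1 : ∏ i ∈ Finset.Icc 1 (T - t),
      gaussianReal 0 1 {a | b (t + i) + δ + (-σ) * a ∈ s' (t + i)} = ∏ u ∈ Finset.Ioc t T, G u := by
    refine Finset.prod_bij (fun i _ => t + i) (fun i hi => ?_) (fun i _ j _ h => by omega)
      (fun u hu => ⟨u - t, ?_, ?_⟩) (fun i hi => ?_)
    · simp only [Finset.mem_Icc, Finset.mem_Ioc] at *; omega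
    · simp only [Finset.mem_Icc, Finset.mem_Ioc] at *; omega
    · simp only [Finset.mem_Ioc] at hu; omega
    · have := (Finset.mem_Icc.1 hi).1
      rw [gaussianReal_affine _ _ (neg_sq σ) (hs' _)]
      simp only [G, if_pos (show t < t + i by omega)]
  have e2 : ∏ i ∈ Finset.Icc 1 t,
      gaussianReal 0 1 {a | b (t + 1 - i) + σ * a ∈ s' (t + 1 - i)} = ∏ u ∈ Finset.Icc 1 t, G u := by
    refine Finset.prod_bij (fun i _ => t + 1 - i) (fun i hi => ?_) (fun i hi j hj h => ?_)
      (fun u hu => ⟨t + 1 - u, ?_, ?_⟩) (fun i hi => ?_)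
    · simp only [Finset.mem_Icc] at *; omega
    · simp only [Finset.mem_Icc] at *; omega
    · simp only [Finset.mem_Icc] at *; omega
    · simp only [Finset.mem_Icc] at hu; omega
    · have := (Finset.mem_Icc.1 hi).1
      rw [gaussianReal_affine _ _ rfl (hs' _)]
      simp only [G, if_neg (show ¬ t < t + 1 - i by omega), add_zero]
  rw [e1, e2, ← Finset.prod_union]
  · congr 1
    ext u
    simp only [Finset.mem_union, Finset.mem_Icc, Finset.mem_Ioc]
    omega
  · rw [Finset.disjoint_left]
    intro u hu hu'
    simp only [Finset.mem_Icc, Finset.mem_Ioc] at hu hu'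
    omega

/-- Under the law with change-point `t`, the densities for the change-points `s` are proportional
to the two-sided likelihood ratio process, centred at `t`. -/
lemma shiftDensity_twoSided {T : ℕ} (b : ℕ → ℝ) (δ : ℝ) {σ : ℝ} (hσ : 0 < σ) {s t : ℕ} (hs1 : 1 ≤ s)
    (hsT : s ≤ T) (ht1 : 1 ≤ t) (htT : t ≤ T) (z : (ℕ → ℝ) × (ℕ → ℝ)) :
    shiftDensity T b δ σ s (twoSided T b δ σ t z) =
      shiftDensity T b δ σ t (twoSided T b δ σ t z) *
        likelihoodRatio (δ / σ) z.1 z.2 ((s : ℤ) - t) := by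
  set y := twoSided T b δ σ t z
  have hσ' : σ ≠ 0 := hσ.ne'
  let c : ℕ → ℝ := fun u => (δ * (extendZero y u - b u) - δ ^ 2 / 2) / σ ^ 2
  have hsplit : ∀ {a a' : ℕ}, a ≤ a' → a' ≤ T →
      ∑ u ∈ Finset.Ioc a T, c u = ∑ u ∈ Finset.Ioc a a', c u + ∑ u ∈ Finset.Ioc a' T, c u :=
    fun h1 h2 => (Finset.sum_Ioc_consecutive c h1 h2).symm
  simp only [shiftDensity]
  rcases lt_trichotomy t s with h | h | h
  · have hlr : likelihoodRatio (δ / σ) z.1 z.2 ((s : ℤ) - t) =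
        Real.exp (-∑ u ∈ Finset.Ioc t s, c u) := by
      rw [likelihoodRatio, if_pos (by omega), show ((s : ℤ) - t).natAbs = s - t by omega,
        ← walk_affine, walk]
      congr 1
      rw [← Finset.sum_neg_distrib]
      refine Finset.sum_bij (fun i _ => t + i) (fun i hi => ?_) (fun i _ j _ h => by omega)
        (fun u hu => ⟨u - t, ?_, ?_⟩) (fun i hi => ?_)
      · simp only [Finset.mem_Icc, Finset.mem_Ioc] at *; omega
      · simp only [Finset.mem_Icc, Finset.mem_Ioc] at *; omega
      · simp only [Finset.mem_Ioc] at hu; omega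
      · have hi' := Finset.mem_Icc.1 hi
        have hm : t + i ∈ Finset.Icc 1 T := Finset.mem_Icc.2 ⟨by omega, by omega⟩
        simp only [c, extendZero, dif_pos hm, y, twoSided, if_pos (show t < t + i by omega),
          Nat.add_sub_cancel_left]
        field_simp
        ring
    rw [hlr, ← Real.exp_add]
    congr 1
    have := hsplit h.le hsT
    simp only [c] at this ⊢
    rw [this]; ring
  · subst h
    simp [likelihoodRatio]
  · have hlr : likelihoodRatio (δ / σ) z.1 z.2 ((s : ℤ) - t) =
        Real.exp (∑ u ∈ Finset.Ioc s t, c u) := by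
      rw [likelihoodRatio, if_neg (by omega), if_pos (by omega),
        show ((s : ℤ) - t).natAbs = t - s by omega, ← walk_affine, walk]
      congr 1
      refine Finset.sum_bij (fun i _ => t + 1 - i) (fun i hi => ?_) (fun i hi j hj h => ?_)
        (fun u hu => ⟨t + 1 - u, ?_, ?_⟩) (fun i hi => ?_)
      · simp only [Finset.mem_Icc, Finset.mem_Ioc] at *; omega
      · simp only [Finset.mem_Icc] at *; omega
      · simp only [Finset.mem_Icc, Finset.mem_Ioc] at *; omega
      · simp only [Finset.mem_Ioc] at hu; omega
      · have hi' := Finset.mem_Icc.1 hi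
        have hm : t + 1 - i ∈ Finset.Icc 1 T := Finset.mem_Icc.2 ⟨by omega, by omega⟩
        simp only [c, extendZero, dif_pos hm, y, twoSided, if_neg (show ¬ t < t + 1 - i by omega),
          show t + 1 - (t + 1 - i) = i by omega]
        field_simp
        ring
    rw [hlr, ← Real.exp_add]
    congr 1
    have := hsplit h.le htT
    simp only [c] at this ⊢
    rw [this]; ring

lemma likelihoodRatio_pos (x : ℝ) (zp zm : ℕ → ℝ) (i : ℤ) : 0 < likelihoodRatio x zp zm i := by
  unfold likelihoodRatio
  split_ifs <;> positivity

lemma measurable_likelihoodRatio (i : ℤ) :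
    Measurable fun w : ℝ × (ℕ → ℝ) × (ℕ → ℝ) => likelihoodRatio w.1 w.2.1 w.2.2 i := by
  unfold likelihoodRatio
  split_ifs
  · exact (((by fun_prop : Measurable fun w : ℝ × (ℕ → ℝ) × (ℕ → ℝ) => w.1).mul
      ((measurable_walk _).comp (by fun_prop))).sub (by fun_prop)).exp
  · exact (((by fun_prop : Measurable fun w : ℝ × (ℕ → ℝ) × (ℕ → ℝ) => w.1).mul
      ((measurable_walk _).comp (by fun_prop))).sub (by fun_prop)).exp
  · exact measurable_const

lemma measurable_windowMed (l n : ℕ) : Measurable fun w : ℝ × (ℕ → ℝ) × (ℕ → ℝ) =>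
    ((windowMed (likelihoodRatio w.1 w.2.1 w.2.2) l n).natAbs : ℝ≥0∞) := by
  have h := measurable_natMed (r := fun (w : ℝ × (ℕ → ℝ) × (ℕ → ℝ)) i =>
    likelihoodRatio w.1 w.2.1 w.2.2 ((i : ℤ) - l)) (fun i => measurable_likelihoodRatio _) n
  exact (measurable_from_top (f := fun m : ℕ => (((m : ℤ) - l).natAbs : ℝ≥0∞))).comp h

lemma lintegral_shiftLaw {T : ℕ} (b : ℕ → ℝ) (δ : ℝ) {σ : ℝ} (hσ : 0 < σ) (t : ℕ)
    {ψ : (Finset.Icc 1 T → ℝ) → ℝ≥0∞} (hψ : Measurable ψ) :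
    ∫⁻ y, ψ y ∂(shiftLaw T b δ σ t) =
      ∫⁻ y, ENNReal.ofReal (shiftDensity T b δ σ t y) * ψ y ∂(shiftLaw T b 0 σ 0) := by
  rw [shiftLaw_eq_withDensity T b δ hσ t, lintegral_withDensity_eq_lintegral_mul _ (by fun_prop) hψ]
  rfl

lemma sum_lintegral_shiftLaw {T : ℕ} (b : ℕ → ℝ) (δ : ℝ) {σ : ℝ} (hσ : 0 < σ) (s : Finset ℕ)
    (τ : ℕ → ℕ) {ψ : ℕ → (Finset.Icc 1 T → ℝ) → ℝ≥0∞} (hψ : ∀ i, Measurable (ψ i)) :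
    ∑ i ∈ s, ∫⁻ y, ψ i y ∂(shiftLaw T b δ σ (τ i)) =
      ∫⁻ y, ∑ i ∈ s, ENNReal.ofReal (shiftDensity T b δ σ (τ i) y) * ψ i y
        ∂(shiftLaw T b 0 σ 0) := by
  rw [lintegral_finsetSum]
  · exact Finset.sum_congr rfl fun i _ => lintegral_shiftLaw b δ hσ _ (hψ i)
  · exact fun i _ => (measurable_shiftDensity T b δ σ (τ i)).ennreal_ofReal.mul (hψ i)

/-- Among the change-points of a window, the true one is located exactly with a total probability
that is largest for the maximizer of the likelihood. The true change-point is the maximizer only if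
the walks on its two sides stay non-positive within the window. -/
lemma sum_lintegral_shiftLaw_le {T : ℕ} (b : ℕ → ℝ) (δ : ℝ) {σ : ℝ} (hσ : 0 < σ) {w n : ℕ}
    (hw : 1 ≤ w) (hwT : w + n ≤ T) (ψ : ℕ → (Finset.Icc 1 T → ℝ) → ℝ≥0∞)
    (hψ : ∀ i, Measurable (ψ i)) (hψ1 : ∀ y, ∑ i ∈ Finset.range (n + 1), ψ i y ≤ 1) :
    ∑ i ∈ Finset.range (n + 1), ∫⁻ y, ψ i y ∂(shiftLaw T b δ σ (w + i)) ≤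
      ∑ i ∈ Finset.range (n + 1), negProb (δ / σ) (n - i) * negProb (δ / σ) i := by
  set f : ℕ → (Finset.Icc 1 T → ℝ) → ℝ := fun i => shiftDensity T b δ σ (w + i)
  have hf : ∀ i, Measurable (f i) := fun i => measurable_shiftDensity _ _ _ _ _
  -- the event that `w + i` maximizes the likelihood; ties are counted for all the maximizers
  let B : ℕ → Set (Finset.Icc 1 T → ℝ) := fun i => {y | ∀ j ∈ Finset.range (n + 1), f j y ≤ f i y}
  have hB : ∀ i, MeasurableSet (B i) := fun i => by
    have : B i = ⋂ j ∈ Finset.range (n + 1), {y | f j y ≤ f i y} := by ext; simp [B]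
    rw [this]
    exact Finset.measurableSet_biInter _ fun j _ => measurableSet_le (hf j) (hf i)
  have hBm : ∀ i, Measurable ((B i).indicator (1 : (Finset.Icc 1 T → ℝ) → ℝ≥0∞)) := fun i =>
    measurable_one.indicator (hB i)
  calc ∑ i ∈ Finset.range (n + 1), ∫⁻ y, ψ i y ∂(shiftLaw T b δ σ (w + i))
      = ∫⁻ y, ∑ i ∈ Finset.range (n + 1), ENNReal.ofReal (f i y) * ψ i y ∂(shiftLaw T b 0 σ 0) :=
        sum_lintegral_shiftLaw b δ hσ _ (fun i => w + i) hψ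
    _ ≤ ∫⁻ y, ∑ i ∈ Finset.range (n + 1), ENNReal.ofReal (f i y) * (B i).indicator 1 y
          ∂(shiftLaw T b 0 σ 0) := by
        refine lintegral_mono fun y => ?_
        obtain ⟨m, hm, hmax⟩ := Finset.exists_max_image (Finset.range (n + 1)) (fun i => f i y)
          ⟨0, by simp⟩
        calc ∑ i ∈ Finset.range (n + 1), ENNReal.ofReal (f i y) * ψ i y
            ≤ ∑ i ∈ Finset.range (n + 1), ENNReal.ofReal (f m y) * ψ i y :=
              Finset.sum_le_sum fun i hi =>
                mul_le_mul_left (ENNReal.ofReal_le_ofReal (hmax i hi)) _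
          _ = ENNReal.ofReal (f m y) * ∑ i ∈ Finset.range (n + 1), ψ i y := (Finset.mul_sum ..).symm
          _ ≤ ENNReal.ofReal (f m y) * 1 := mul_le_mul_right (hψ1 y) _
          _ = ENNReal.ofReal (f m y) * (B m).indicator 1 y := by
              rw [Set.indicator_of_mem (show y ∈ B m from hmax)]; rfl
          _ ≤ _ := Finset.single_le_sum
              (f := fun i => ENNReal.ofReal (f i y) * (B i).indicator 1 y)
              (fun i _ => zero_le) hm
    _ = ∑ i ∈ Finset.range (n + 1), shiftLaw T b δ σ (w + i) (B i) := by
        refine (sum_lintegral_shiftLaw b δ hσ _ (fun i => w + i) hBm).symm.trans ?_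
        exact Finset.sum_congr rfl fun i _ => lintegral_indicator_one (hB i)
    _ ≤ _ := by
        refine Finset.sum_le_sum fun i hi => ?_
        have hi' := Finset.mem_range.1 hi
        rw [← (measurePreserving_twoSided T b δ σ (show w + i ≤ T by omega)).measure_preimage
          (hB i).nullMeasurableSet, negProb, negProb, ← Measure.prod_prod]
        refine measure_mono fun z hz => ?_
        have hlr : ∀ j ≤ n, likelihoodRatio (δ / σ) z.1 z.2 ((j : ℤ) - i) ≤ 1 := by
          intro j hj
          have h1 : f j (twoSided T b δ σ (w + i) z) ≤ f i (twoSided T b δ σ (w + i) z) :=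
            hz j (Finset.mem_range.2 (by omega))
          simp only [f] at h1
          rw [shiftDensity_twoSided b δ hσ (by omega) (by omega) (by omega) (by omega)] at h1
          have hpos : 0 < shiftDensity T b δ σ (w + i) (twoSided T b δ σ (w + i) z) :=
            Real.exp_pos _
          have := le_of_mul_le_mul_left (h1.trans_eq (mul_one _).symm) hpos
          rwa [show ((w + j : ℕ) : ℤ) - (w + i : ℕ) = j - i by push_cast; ring] at this
        refine ⟨fun m hm => ?_, fun m hm => ?_⟩ <;> have hm' := Finset.mem_Icc.1 hm
        · have := hlr (i + m) (by omega)
          rw [likelihoodRatio, if_pos (by omega),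
            show (((i + m : ℕ) : ℤ) - i).natAbs = m by omega] at this
          simpa using this
        · have := hlr (i - m) (by omega)
          rw [likelihoodRatio, if_neg (by omega), if_pos (by omega),
            show (((i - m : ℕ) : ℤ) - i).natAbs = m by omega] at this
          simpa using this

/-- The total mean distance of an estimate from the change-points of a window is smallest for the
median of the likelihood. -/
lemma le_sum_lintegral_shiftLaw {T : ℕ} (b : ℕ → ℝ) (δ : ℝ) {σ : ℝ} (hσ : 0 < σ) {w n : ℕ}
    (hw : 1 ≤ w) (hwT : w + n ≤ T) (ψ : ℕ → (Finset.Icc 1 T → ℝ) → ℝ≥0∞)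
    (hψ : ∀ i, Measurable (ψ i))
    (hψ1 : ∀ y, ∃ u ≤ n, ∀ i ≤ n, ((((i : ℤ) - u).natAbs : ℕ) : ℝ≥0∞) ≤ ψ i y) :
    ∑ i ∈ Finset.range (n + 1), ∫⁻ z, ((windowMed (likelihoodRatio (δ / σ) z.1 z.2) i n).natAbs : ℝ≥0∞)
        ∂(gaussSeq.prod gaussSeq) ≤
      ∑ i ∈ Finset.range (n + 1), ∫⁻ y, ψ i y ∂(shiftLaw T b δ σ (w + i)) := by
  set f : (Finset.Icc 1 T → ℝ) → ℕ → ℝ := fun y i => shiftDensity T b δ σ (w + i) y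
  have hf : ∀ i, Measurable fun y => f y i := fun i => measurable_shiftDensity _ _ _ _ _
  have hf0 : ∀ y i, 0 ≤ f y i := fun y i => (Real.exp_pos _).le
  have hloss : ∀ i : ℕ, Measurable fun y => ((((i : ℤ) - natMed (f y) n).natAbs : ℕ) : ℝ≥0∞) :=
    fun i => (measurable_from_top (f := fun m : ℕ => ((((i : ℤ) - m).natAbs : ℕ) : ℝ≥0∞))).comp
      (measurable_natMed hf n)
  have hcast : ∀ (y : Finset.Icc 1 T → ℝ) (u : ℕ), ∑ i ∈ Finset.range (n + 1),
      ENNReal.ofReal (f y i) * ((((i : ℤ) - u).natAbs : ℕ) : ℝ≥0∞) =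
      ENNReal.ofReal (∑ i ∈ Finset.range (n + 1), f y i * ((((i : ℤ) - u).natAbs : ℕ) : ℝ)) := by
    intro y u
    rw [ENNReal.ofReal_sum_of_nonneg fun i _ => mul_nonneg (hf0 y i) (Nat.cast_nonneg _)]
    refine Finset.sum_congr rfl fun i _ => ?_
    rw [ENNReal.ofReal_mul (hf0 y i), ENNReal.ofReal_natCast]
  calc _ = ∑ i ∈ Finset.range (n + 1), ∫⁻ y, ((((i : ℤ) - natMed (f y) n).natAbs : ℕ) : ℝ≥0∞)
        ∂(shiftLaw T b δ σ (w + i)) := by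
        refine Finset.sum_congr rfl fun i hi => ?_
        have hi' := Finset.mem_range.1 hi
        rw [← (measurePreserving_twoSided T b δ σ (show w + i ≤ T by omega)).lintegral_comp (hloss i)]
        refine lintegral_congr fun z => ?_
        have hmed : natMed (f (twoSided T b δ σ (w + i) z)) n =
            natMed (fun j : ℕ => likelihoodRatio (δ / σ) z.1 z.2 ((j : ℤ) - i)) n := by
          refine natMed_congr_mul (Real.exp_pos _ :
            0 < shiftDensity T b δ σ (w + i) (twoSided T b δ σ (w + i) z)) fun j hj => ?_
          simp only [f]
          rw [shiftDensity_twoSided b δ hσ (by omega) (by omega) (by omega) (by omega),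
            show ((w + j : ℕ) : ℤ) - (w + i : ℕ) = j - i by push_cast; ring]
          rfl
        rw [hmed, windowMed]
        congr 1
        omega
    _ = ∫⁻ y, ∑ i ∈ Finset.range (n + 1),
          ENNReal.ofReal (f y i) * ((((i : ℤ) - natMed (f y) n).natAbs : ℕ) : ℝ≥0∞)
          ∂(shiftLaw T b 0 σ 0) :=
        sum_lintegral_shiftLaw b δ hσ _ (fun i => w + i) hloss
    _ ≤ ∫⁻ y, ∑ i ∈ Finset.range (n + 1), ENNReal.ofReal (f y i) * ψ i y
          ∂(shiftLaw T b 0 σ 0) := by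
        refine lintegral_mono fun y => ?_
        obtain ⟨u, hu, hle⟩ := hψ1 y
        calc _ ≤ ∑ i ∈ Finset.range (n + 1),
              ENNReal.ofReal (f y i) * ((((i : ℤ) - u).natAbs : ℕ) : ℝ≥0∞) := by
              rw [hcast, hcast]
              exact ENNReal.ofReal_le_ofReal (natMed_optimal (hf0 y) hu)
          _ ≤ _ := Finset.sum_le_sum fun i hi =>
              mul_le_mul_right (hle i (by have := Finset.mem_range.1 hi; omega)) _
    _ = _ :=
        (sum_lintegral_shiftLaw b δ hσ _ (fun i => w + i) hψ).symm

/-! ### Convergence of the medians on growing windows -/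

lemma sum_shifted_range (p : ℤ → ℝ) (l k : ℕ) :
    ∑ i ∈ Finset.range k, p ((i : ℤ) - l) = ∑ j ∈ Finset.Ico (-(l : ℤ)) (k - l), p j := by
  refine Finset.sum_bij (fun i _ => (i : ℤ) - l) (fun i hi => ?_) (fun i _ j _ h => by omega)
    (fun j hj => ⟨(j + l).toNat, ?_, ?_⟩) (fun i _ => rfl)
  · simp only [Finset.mem_range, Finset.mem_Ico] at *; omega
  · simp only [Finset.mem_range, Finset.mem_Ico] at *; omega
  · simp only [Finset.mem_Ico] at hj; omega

lemma exists_lt_sum_Ico {g : ℤ → ℝ} (hs : Summable g) {c : ℝ}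
    (hc : c < ∑' i, g i) : ∃ N : ℕ, ∀ l m : ℤ, (N : ℤ) ≤ l → (N : ℤ) ≤ m →
      c < ∑ i ∈ Finset.Ico (-l) m, g i := by
  have h : ∀ᶠ s : Finset ℤ in atTop, c < ∑ i ∈ s, g i := by
    simpa using hs.hasSum.eventually_const_lt hc
  rw [eventually_atTop] at h
  obtain ⟨s, hs'⟩ := h
  refine ⟨∑ i ∈ s, (i.natAbs + 1), fun l m hl hm => hs' _ fun i hi => ?_⟩
  have := Finset.single_le_sum (f := fun i : ℤ => i.natAbs + 1) (fun _ _ => Nat.zero_le _) hi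
  rw [Finset.mem_Ico]
  omega

/-- The medians on the windows converge to the median on the integers, unless the latter is
ambiguous. -/
lemma exists_windowMed_eq {p : ℤ → ℝ} (hp : ∀ i, 0 ≤ p i) {u : ℤ} (hu : IsMed p u)
    (hne : (∑' i : Set.Iic u, p i) ≠ (∑' i, p i) / 2) :
    ∃ N : ℕ, ∀ l m : ℕ, N ≤ l → N ≤ m → windowMed p l (l + m) = u := by
  obtain ⟨hsum, h1, h2⟩ := hu
  rw [tsum_subtype (Set.Iio u) p] at h1
  rw [tsum_subtype (Set.Iic u) p] at h2 hne
  have h2' := lt_of_le_of_ne h2 hne.symm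
  set S := ∑' i, p i
  have hind : ∀ s : Set ℤ, Summable (s.indicator p) ∧ ∀ i, 0 ≤ s.indicator p i := fun s =>
    ⟨hsum.indicator s, fun i => Set.indicator_nonneg (fun i _ => hp i) i⟩
  obtain ⟨N1, hN1⟩ := exists_lt_sum_Ico hsum
    (show 2 * ∑' i, (Set.Iio u).indicator p i < S by linarith)
  obtain ⟨N2, hN2⟩ := exists_lt_sum_Ico (hind (Set.Iic u)).1 h2'
  refine ⟨N1 + N2 + u.natAbs + 1, fun l m hl hm => ?_⟩
  obtain ⟨a, ha⟩ : ∃ a : ℕ, (a : ℤ) = u + l := ⟨(u + l).toNat, by omega⟩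
  set r : ℕ → ℝ := fun i => p ((i : ℤ) - l)
  have hr : ∀ i, 0 ≤ r i := fun i => hp _
  have hS : ∑ i ∈ Finset.range (l + m + 1), r i =
      ∑ j ∈ Finset.Ico (-(l : ℤ)) (m + 1), p j := by
    rw [sum_shifted_range]; congr 2; push_cast; ring
  have hS1 : ∑ i ∈ Finset.range (l + m + 1), r i ≤ S := by
    rw [hS]; exact hsum.sum_le_tsum _ fun i _ => hp i
  have hS2 := hN1 l (m + 1) (by omega) (by omega)
  rw [← hS] at hS2
  have hlow : ∑ i ∈ Finset.range a, r i ≤ ∑' i, (Set.Iio u).indicator p i := by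
    rw [sum_shifted_range, show (a : ℤ) - l = u by omega]
    refine le_trans (le_of_eq ?_) ((hind (Set.Iio u)).1.sum_le_tsum (Finset.Ico (-(l : ℤ)) u)
      fun i _ => (hind _).2 i)
    refine Finset.sum_congr rfl fun i hi => ?_
    rw [Set.indicator_of_mem]
    exact (Finset.mem_Ico.1 hi).2
  have hupp : S / 2 < ∑ i ∈ Finset.range (a + 1), r i := by
    rw [sum_shifted_range]
    refine (hN2 l (m + 1) (by omega) (by omega)).trans_eq ?_
    have hsub : Finset.Ico (-(l : ℤ)) ((a + 1 : ℕ) - l) ⊆ Finset.Ico (-(l : ℤ)) (m + 1) :=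
      Finset.Ico_subset_Ico le_rfl (by omega)
    rw [← Finset.sum_subset hsub fun i hi hi' => ?_]
    · refine Finset.sum_congr rfl fun i hi => ?_
      have := Finset.mem_Ico.1 hi
      rw [Set.indicator_of_mem]
      simp only [Set.mem_Iic]; omega
    · have := Finset.mem_Ico.1 hi
      rw [Finset.mem_Ico] at hi'
      rw [Set.indicator_of_notMem]
      simp only [Set.mem_Iic]; omega
  have e1 : ¬ a < natMed r (l + m) := by
    rw [lt_natMed_iff hr (by omega)]; linarith
  have e2 : a - 1 < natMed r (l + m) := by
    rw [lt_natMed_iff hr (by omega), show a - 1 + 1 = a by omega]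
    linarith
  have e3 : natMed r (l + m) = a := by omega
  rw [windowMed, e3]
  omega

/-! ### The median of the likelihood ratio process is almost surely unambiguous -/

lemma gaussSeq_null_of_subsingleton {A : Set (ℕ → ℝ)} (hA : MeasurableSet A) (i : ℕ)
    (h : ∀ z a a', Function.update z i a ∈ A → Function.update z i a' ∈ A → a = a') :
    gaussSeq A = 0 := by
  have hmp : MeasurePreserving _ ((gaussianReal 0 1).prod gaussSeq) gaussSeq :=
    measurePreserving_update (gaussianReal 0 1) i
  rw [← hmp.measure_preimage hA.nullMeasurableSet,
    Measure.prod_apply_symm (hmp.measurable hA), lintegral_eq_zero_iff'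
      (measurable_measure_prodMk_right (hmp.measurable hA)).aemeasurable]
  refine Eventually.of_forall fun z => ?_
  have := nullSingletonClass_gaussianReal (μ := 0) (v := 1) one_ne_zero
  exact Set.Subsingleton.measure_zero (fun a ha a' ha' => h z a a' ha ha') _

/-- The event that the sum up to `u` and the sum after `u` of the likelihood ratio process are
equal and finite. -/
def tieSet (x : ℝ) (u : ℤ) : Set ((ℕ → ℝ) × (ℕ → ℝ)) :=
  {z | (∑' i : ℤ, if i ≤ u then ENNReal.ofReal (likelihoodRatio x z.1 z.2 i) else 0) =
      (∑' i : ℤ, if u < i then ENNReal.ofReal (likelihoodRatio x z.1 z.2 i) else 0) ∧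
    (∑' i : ℤ, if i ≤ u then ENNReal.ofReal (likelihoodRatio x z.1 z.2 i) else 0) ≠ ∞}

lemma measurableSet_mem_tieSet (u : ℤ) :
    MeasurableSet {w : ℝ × (ℕ → ℝ) × (ℕ → ℝ) | w.2 ∈ tieSet w.1 u} := by
  have hm : ∀ i, Measurable fun w : ℝ × (ℕ → ℝ) × (ℕ → ℝ) =>
      ENNReal.ofReal (likelihoodRatio w.1 w.2.1 w.2.2 i) := fun i =>
    (measurable_likelihoodRatio i).ennreal_ofReal
  have h1 : Measurable fun w : ℝ × (ℕ → ℝ) × (ℕ → ℝ) =>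
      ∑' i : ℤ, if i ≤ u then ENNReal.ofReal (likelihoodRatio w.1 w.2.1 w.2.2 i) else 0 :=
    Measurable.tsum fun i => by split_ifs; exacts [hm i, measurable_const]
  have h2 : Measurable fun w : ℝ × (ℕ → ℝ) × (ℕ → ℝ) =>
      ∑' i : ℤ, if u < i then ENNReal.ofReal (likelihoodRatio w.1 w.2.1 w.2.2 i) else 0 :=
    Measurable.tsum fun i => by split_ifs; exacts [hm i, measurable_const]
  exact (measurableSet_eq_fun h1 h2).inter (h1 (measurableSet_singleton ∞).compl)

lemma measurableSet_tieSet (x : ℝ) (u : ℤ) : MeasurableSet (tieSet x u) :=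
  measurable_prodMk_left (measurableSet_mem_tieSet u)

lemma walk_update_one (z : ℕ → ℝ) (a a' : ℝ) {n : ℕ} (hn : 1 ≤ n) :
    walk (Function.update z 1 a') n = walk (Function.update z 1 a) n + (a' - a) := by
  have hmem : 1 ∈ Finset.Icc 1 n := Finset.mem_Icc.2 ⟨le_rfl, hn⟩
  rw [walk, walk, ← Finset.add_sum_erase _ _ hmem, ← Finset.add_sum_erase _ _ hmem]
  have : ∀ c : ℝ, ∑ u ∈ (Finset.Icc 1 n).erase 1, Function.update z 1 c u =
      ∑ u ∈ (Finset.Icc 1 n).erase 1, z u := fun c =>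
    Finset.sum_congr rfl fun u hu => Function.update_of_ne (Finset.ne_of_mem_erase hu) _ _
  rw [this, this, Function.update_self, Function.update_self]
  ring

/-- If a part of the weights on one side of a cut is multiplied by `ρ`, together with all the
weights on the other side, and the two sides are balanced before and after, then `ρ = 1`. -/
lemma eq_one_of_balanced {L B C ρ : ℝ≥0∞} (hL : L ≠ 0) (hfin : L + B ≠ ∞) (hρ : ρ ≠ ∞)
    (h1 : L + B = C) (h2 : L + ρ * B = ρ * C) : ρ = 1 := by
  have hLfin : L ≠ ∞ := fun h => hfin (by simp [h])
  have hBfin : B ≠ ∞ := fun h => hfin (by simp [h])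
  rw [← h1, mul_add, ENNReal.add_left_inj (ENNReal.mul_ne_top hρ hBfin)] at h2
  have : 1 * L = ρ * L := by rw [one_mul]; exact h2
  exact ((ENNReal.mul_left_inj hL hLfin).1 this).symm

lemma tsum_split {P : ℤ → ℝ≥0∞} (q q' : ℤ → Prop) [DecidablePred q] [DecidablePred q'] :
    (∑' i, if q i then P i else 0) =
      (∑' i, if q i ∧ q' i then P i else 0) + ∑' i, if q i ∧ ¬ q' i then P i else 0 := by
  rw [← ENNReal.tsum_add]
  refine tsum_congr fun i => ?_
  by_cases h : q i <;> by_cases h' : q' i <;> simp [h, h']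

lemma tsum_ite_scale {P P' : ℤ → ℝ≥0∞} {ρ : ℝ≥0∞} {q : ℤ → Prop} [DecidablePred q]
    (h : ∀ i, q i → P' i = ρ * P i) :
    (∑' i, if q i then P' i else 0) = ρ * ∑' i, if q i then P i else 0 := by
  rw [← ENNReal.tsum_mul_left]
  refine tsum_congr fun i => ?_
  by_cases hi : q i <;> simp [hi, h]

lemma tsum_ite_ne_zero {P : ℤ → ℝ≥0∞} {q : ℤ → Prop} [DecidablePred q] (h0 : P 0 ≠ 0) (hq : q 0) :
    (∑' i, if q i then P i else 0) ≠ 0 := by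
  rw [Ne, ENNReal.tsum_eq_zero]
  intro h
  have := h 0
  rw [if_pos hq] at this
  exact h0 this

/-- Changing the first noise variable on the side of the origin where the cut point lies multiplies
all the weights on that side, so that at most one of its values leads to a tie. -/
lemma tieSet_null {x : ℝ} (hx : x ≠ 0) (u : ℤ) : (gaussSeq.prod gaussSeq) (tieSet x u) = 0 := by
  have hexp : ∀ a a' : ℝ, ENNReal.ofReal (Real.exp (x * (a' - a))) = 1 → a = a' := by
    intro a a' h
    rw [ENNReal.ofReal_eq_one, Real.exp_eq_one_iff] at h
    rcases mul_eq_zero.1 h with h | h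
    · exact absurd h hx
    · linarith
  have hfin : ∀ c : ℝ, ENNReal.ofReal c ≠ ∞ := fun c => ENNReal.ofReal_ne_top
  have hpos0 : ∀ (z : (ℕ → ℝ) × (ℕ → ℝ)), ENNReal.ofReal (likelihoodRatio x z.1 z.2 0) ≠ 0 :=
    fun z => by simp [likelihoodRatio_pos]
  -- for `u ≥ 0` resample the first variable on the positive side, otherwise on the negative side:
  -- the weight at the origin does not change, while all the weights on the other side of the cut do
  rcases le_or_gt 0 u with hu | hu
  · rw [Measure.prod_apply_symm (measurableSet_tieSet x u), lintegral_eq_zero_iff'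
      (measurable_measure_prodMk_right (measurableSet_tieSet x u)).aemeasurable]
    refine Eventually.of_forall fun zm => ?_
    refine gaussSeq_null_of_subsingleton
      (measurable_prodMk_right (measurableSet_tieSet x u)) 1 fun z a a' h h' => hexp a a' ?_
    set P : ℤ → ℝ≥0∞ := fun i =>
      ENNReal.ofReal (likelihoodRatio x (Function.update z 1 a) zm i)
    set P' : ℤ → ℝ≥0∞ := fun i =>
      ENNReal.ofReal (likelihoodRatio x (Function.update z 1 a') zm i)
    set ρ := ENNReal.ofReal (Real.exp (x * (a' - a)))
    have hP0 : ∀ i, i ≤ 0 → P' i = 1 * P i := fun i hi => by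
      simp only [P, P', likelihoodRatio, if_neg (not_lt.2 hi), one_mul]
    have hP1 : ∀ i, 0 < i → P' i = ρ * P i := fun i hi => by
      simp only [P, P', ρ, likelihoodRatio, if_pos hi]
      rw [← ENNReal.ofReal_mul (Real.exp_pos _).le, ← Real.exp_add,
        walk_update_one z a a' (show 1 ≤ i.natAbs by omega)]
      congr 2; ring
    have h1 : (∑' i, if i ≤ u then P i else 0) = ∑' i, if u < i then P i else 0 := h.1
    have h2 : (∑' i, if i ≤ u then P i else 0) ≠ ∞ := h.2
    have h3 : (∑' i, if i ≤ u then P' i else 0) = ∑' i, if u < i then P' i else 0 := h'.1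
    rw [tsum_split _ (fun i : ℤ => i ≤ 0)] at h1 h2 h3
    rw [tsum_ite_scale (ρ := 1) (P := P) fun i hi => hP0 i hi.2, one_mul,
      tsum_ite_scale (ρ := ρ) (P := P) fun i hi => hP1 i (by omega),
      tsum_ite_scale (ρ := ρ) (P := P) fun i hi => hP1 i (by omega)] at h3
    exact eq_one_of_balanced (tsum_ite_ne_zero (hpos0 (_, _)) ⟨hu, le_rfl⟩) h2 (hfin _) h1 h3
  · rw [Measure.prod_apply (measurableSet_tieSet x u), lintegral_eq_zero_iff'
      (measurable_measure_prodMk_left (measurableSet_tieSet x u)).aemeasurable]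
    refine Eventually.of_forall fun zp => ?_
    refine gaussSeq_null_of_subsingleton
      (measurable_prodMk_left (measurableSet_tieSet x u)) 1 fun z a a' h h' => hexp a a' ?_
    set P : ℤ → ℝ≥0∞ := fun i =>
      ENNReal.ofReal (likelihoodRatio x zp (Function.update z 1 a) i)
    set P' : ℤ → ℝ≥0∞ := fun i =>
      ENNReal.ofReal (likelihoodRatio x zp (Function.update z 1 a') i)
    set ρ := ENNReal.ofReal (Real.exp (x * (a' - a)))
    have hP0 : ∀ i, 0 ≤ i → P' i = 1 * P i := fun i hi => by
      simp only [P, P', likelihoodRatio, if_neg (not_lt.2 hi), one_mul]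
    have hP1 : ∀ i, i < 0 → P' i = ρ * P i := fun i hi => by
      simp only [P, P', ρ, likelihoodRatio, if_neg (not_lt.2 hi.le), if_pos hi]
      rw [← ENNReal.ofReal_mul (Real.exp_pos _).le, ← Real.exp_add,
        walk_update_one z a a' (show 1 ≤ i.natAbs by omega)]
      congr 2; ring
    have h1 : (∑' i, if i ≤ u then P i else 0) = ∑' i, if u < i then P i else 0 := h.1
    have h2 : (∑' i, if i ≤ u then P i else 0) ≠ ∞ := h.2
    have h3 : (∑' i, if i ≤ u then P' i else 0) = ∑' i, if u < i then P' i else 0 := h'.1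
    rw [h1] at h2
    rw [tsum_split (fun i : ℤ => u < i) (fun i : ℤ => 0 ≤ i)] at h1 h2 h3
    rw [tsum_ite_scale (ρ := 1) (q := fun i => u < i ∧ 0 ≤ i) (P := P) fun i hi => hP0 i hi.2,
      one_mul, tsum_ite_scale (ρ := ρ) (P := P) fun i hi => hP1 i (by omega),
      tsum_ite_scale (ρ := ρ) (P := P) fun i hi => hP1 i (by omega)] at h3
    exact eq_one_of_balanced (tsum_ite_ne_zero (hpos0 (_, _)) ⟨hu, le_rfl⟩) h2 (hfin _) h1.symm h3.symm

lemma mem_tieSet {x : ℝ} {z : (ℕ → ℝ) × (ℕ → ℝ)} {u : ℤ}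
    (hs : Summable (likelihoodRatio x z.1 z.2))
    (h : (∑' i : Set.Iic u, likelihoodRatio x z.1 z.2 i) =
      (∑' i, likelihoodRatio x z.1 z.2 i) / 2) : z ∈ tieSet x u := by
  set p := likelihoodRatio x z.1 z.2
  have hp : ∀ i, 0 ≤ p i := fun i => (likelihoodRatio_pos x z.1 z.2 i).le
  have hconv : ∀ (s : Set ℤ) (q : ℤ → Prop) [DecidablePred q], (∀ i, q i ↔ i ∈ s) →
      (∑' i : ℤ, if q i then ENNReal.ofReal (p i) else 0) =
        ENNReal.ofReal (∑' i, s.indicator p i) := by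
    intro s q _ hq
    rw [ENNReal.ofReal_tsum_of_nonneg (fun i => Set.indicator_nonneg (fun i _ => hp i) i)
      (hs.indicator s)]
    refine tsum_congr fun i => ?_
    by_cases hi : i ∈ s <;> simp [hi, hq]
  rw [tsum_subtype (Set.Iic u) p] at h
  have hadd : (∑' i, (Set.Iic u).indicator p i) + ∑' i, (Set.Ioi u).indicator p i = ∑' i, p i := by
    rw [← (hs.indicator _).tsum_add (hs.indicator _)]
    refine tsum_congr fun i => ?_
    rw [← Set.compl_Iic]
    exact congrFun (Set.indicator_self_add_compl (Set.Iic u) p) i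
  have e1 := hconv (Set.Iic u) (fun i => i ≤ u) fun i => Iff.rfl
  have e2 := hconv (Set.Ioi u) (fun i => u < i) fun i => Iff.rfl
  refine ⟨?_, ?_⟩
  · refine e1.trans (Eq.trans ?_ e2.symm)
    congr 1; linarith
  · exact fun h' => ENNReal.ofReal_ne_top (e1.symm.trans h')

/-- The infimum of the distances from the origin of the medians on the windows that contain
`[-j, j]`. -/
noncomputable def lowMed (j : ℕ) (w : ℝ × (ℕ → ℝ) × (ℕ → ℝ)) : ℝ≥0∞ :=
  ⨅ (l : ℕ) (m : ℕ), ((windowMed (likelihoodRatio w.1 w.2.1 w.2.2) (j + l)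
    ((j + l) + (j + m))).natAbs : ℝ≥0∞)

lemma measurable_lowMed (j : ℕ) : Measurable (lowMed j) :=
  Measurable.iInf fun _ => Measurable.iInf fun _ => measurable_windowMed _ _

lemma lowMed_le {j l m : ℕ} (hl : j ≤ l) (hm : j ≤ m) (w : ℝ × (ℕ → ℝ) × (ℕ → ℝ)) :
    lowMed j w ≤ ((windowMed (likelihoodRatio w.1 w.2.1 w.2.2) l (l + m)).natAbs : ℝ≥0∞) := by
  refine (iInf₂_le (l - j) (m - j)).trans_eq ?_
  rw [show j + (l - j) = l by omega, show j + (m - j) = m by omega]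

lemma lowMed_mono : Monotone lowMed := fun j j' h w => by
  refine le_iInf₂ fun l m => ?_
  exact lowMed_le (by omega) (by omega) w

lemma natAbs_med_le_iSup (w : ℝ × (ℕ → ℝ) × (ℕ → ℝ)) (hw : ∀ u, w.2 ∉ tieSet w.1 u) :
    ((med (likelihoodRatio w.1 w.2.1 w.2.2)).natAbs : ℝ≥0∞) ≤ ⨆ j, lowMed j w := by
  rw [med]
  split_ifs with hex
  · have hmed := hex.choose_spec
    obtain ⟨N, hN⟩ := exists_windowMed_eq (fun i => (likelihoodRatio_pos w.1 w.2.1 w.2.2 i).le) hmed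
      fun heq => hw _ (mem_tieSet hmed.1 heq)
    refine le_iSup_of_le N (le_iInf₂ fun l m => ?_)
    rw [hN (N + l) (N + m) (by omega) (by omega)]
  · simp

lemma limitLaw_apply_fst (G : Measure ℝ) [IsProbabilityMeasure G] (c : ℝ) :
    limitLaw G {w | c ≤ |w.1|} = G {x | c ≤ |x|} := by
  have : {w : ℝ × (ℕ → ℝ) × (ℕ → ℝ) | c ≤ |w.1|} = {x | c ≤ |x|} ×ˢ Set.univ := by
    ext w; simp
  rw [this, limitLaw, Measure.prod_prod, measure_univ, mul_one]

/-- The integral over `|x| ≥ c` of the mean of `lowMed j`. -/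
noncomputable def lowMedMean (G : Measure ℝ) (c : ℝ) (j : ℕ) : ℝ≥0∞ :=
  ∫⁻ x in {x | c ≤ |x|}, ∫⁻ z, lowMed j (x, z) ∂(gaussSeq.prod gaussSeq) ∂G

lemma gammaLower_le (G : Measure ℝ) [IsProbabilityMeasure G] {c : ℝ} (hc : 0 < c) :
    gammaLower G c ≤ (G {x | c ≤ |x|})⁻¹ * ⨆ j, lowMedMean G c j := by
  have hms : MeasurableSet {x : ℝ | c ≤ |x|} := measurableSet_le measurable_const (by fun_prop)
  have hms' : MeasurableSet {w : ℝ × (ℕ → ℝ) × (ℕ → ℝ) | c ≤ |w.1|} :=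
    measurableSet_le measurable_const (by fun_prop)
  rw [gammaLower, ProbabilityTheory.cond, lintegral_smul_measure, limitLaw_apply_fst, smul_eq_mul]
  refine mul_le_mul_right ?_ _
  have hrestrict : (limitLaw G).restrict {w | c ≤ |w.1|} =
      (G.restrict {x | c ≤ |x|}).prod (gaussSeq.prod gaussSeq) := by
    have : {w : ℝ × (ℕ → ℝ) × (ℕ → ℝ) | c ≤ |w.1|} = {x | c ≤ |x|} ×ˢ Set.univ := by
      ext w; simp
    rw [this, limitLaw, ← Measure.prod_restrict, Measure.restrict_univ]
  have hae : ∀ᵐ w ∂((limitLaw G).restrict {w | c ≤ |w.1|}),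
      ((med (likelihoodRatio w.1 w.2.1 w.2.2)).natAbs : ℝ≥0∞) ≤ ⨆ j, lowMed j w := by
    have hnull : ∀ u : ℤ, ∀ᵐ w ∂((limitLaw G).restrict {w | c ≤ |w.1|}), w.2 ∉ tieSet w.1 u := by
      intro u
      have h0 : ((G.restrict {x | c ≤ |x|}).prod (gaussSeq.prod gaussSeq))
          {w | w.2 ∈ tieSet w.1 u} = 0 := by
        refine (Measure.measure_prod_null (measurableSet_mem_tieSet u)).2 ?_
        filter_upwards [ae_restrict_mem hms] with x hx
        exact tieSet_null (abs_pos.1 (hc.trans_le hx)) u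
      rw [hrestrict, ae_iff]
      simpa only [not_not] using h0
    filter_upwards [ae_all_iff.2 hnull] with w hw using natAbs_med_le_iSup w hw
  refine (lintegral_mono_ae hae).trans ?_
  rw [lintegral_iSup (fun j => measurable_lowMed j) lowMed_mono]
  refine iSup_mono fun j => ?_
  rw [hrestrict, lintegral_prod _ (measurable_lowMed j).aemeasurable]
  rfl

/-! ### The risks on finite windows -/

/-- The bound for the expected number of change-points of a window of length `n + 1` that are
located exactly. -/
noncomputable def exactRisk (n : ℕ) (x : ℝ) : ℝ≥0∞ :=
  ∑ i ∈ Finset.range (n + 1), negProb x (n - i) * negProb x i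

/-- The bound for the total mean estimation error over the change-points of a window of length
`n + 1`. -/
noncomputable def medianRisk (n : ℕ) (x : ℝ) : ℝ≥0∞ :=
  ∑ i ∈ Finset.range (n + 1), ∫⁻ z, ((windowMed (likelihoodRatio x z.1 z.2) i n).natAbs : ℝ≥0∞)
    ∂(gaussSeq.prod gaussSeq)

lemma measurable_negProb (n : ℕ) : Measurable fun x => negProb x n := by
  have hms : MeasurableSet {w : ℝ × (ℕ → ℝ) |
      ∀ i ∈ Finset.Icc 1 n, w.1 * walk w.2 i - i * w.1 ^ 2 / 2 ≤ 0} := by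
    have : {w : ℝ × (ℕ → ℝ) | ∀ i ∈ Finset.Icc 1 n, w.1 * walk w.2 i - i * w.1 ^ 2 / 2 ≤ 0} =
        ⋂ i ∈ Finset.Icc 1 n, {w : ℝ × (ℕ → ℝ) | w.1 * walk w.2 i - i * w.1 ^ 2 / 2 ≤ 0} := by
      ext; simp
    rw [this]
    refine Finset.measurableSet_biInter _ fun i _ => measurableSet_le ?_ measurable_const
    exact (measurable_fst.mul ((measurable_walk i).comp measurable_snd)).sub (by fun_prop)
  exact measurable_measure_prodMk_left hms

lemma measurable_exactRisk (n : ℕ) : Measurable (exactRisk n) :=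
  Finset.measurable_sum _ fun _ _ => (measurable_negProb _).mul (measurable_negProb _)

lemma measurable_medianRisk (n : ℕ) : Measurable (medianRisk n) :=
  Finset.measurable_sum _ fun _ _ => (measurable_windowMed _ _).lintegral_prod_right'

lemma exactRisk_le (n j : ℕ) (x : ℝ) :
    exactRisk n x ≤ (n + 1 : ℕ) * negProb x j ^ 2 + (2 * j : ℕ) := by
  have h : ∀ i ∈ Finset.range (n + 1), negProb x (n - i) * negProb x i ≤
      negProb x j ^ 2 + if i ∈ Finset.range j ∪ Finset.Ioc (n - j) n then 1 else 0 := by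
    intro i hi
    split_ifs with h
    · exact le_add_left (mul_le_one' (negProb_le_one _ _) (negProb_le_one _ _))
    · rw [add_zero, sq]
      simp only [Finset.mem_range, Finset.mem_union, Finset.mem_Ioc] at h hi
      exact mul_le_mul' (negProb_anti x (by omega)) (negProb_anti x (by omega))
  refine (Finset.sum_le_sum h).trans ?_
  rw [Finset.sum_add_distrib, Finset.sum_const, Finset.card_range, nsmul_eq_mul]
  refine add_le_add le_rfl ?_
  rw [← Finset.sum_filter, Finset.sum_const, nsmul_eq_mul, mul_one]
  norm_cast
  calc _ ≤ (Finset.range j ∪ Finset.Ioc (n - j) n).card :=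
        Finset.card_le_card fun i hi => (Finset.mem_filter.1 hi).2
    _ ≤ (Finset.range j).card + (Finset.Ioc (n - j) n).card := Finset.card_union_le _ _
    _ ≤ 2 * j := by simp only [Finset.card_range, Nat.card_Ioc]; omega

lemma le_medianRisk (n j : ℕ) (x : ℝ) :
    (n + 1 - 2 * j : ℕ) * ∫⁻ z, lowMed j (x, z) ∂(gaussSeq.prod gaussSeq) ≤ medianRisk n x := by
  have hsub : Finset.Ico j (n + 1 - j) ⊆ Finset.range (n + 1) := fun i hi => by
    simp only [Finset.mem_Ico, Finset.mem_range] at *; omega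
  calc _ = ∑ i ∈ Finset.Ico j (n + 1 - j), ∫⁻ z, lowMed j (x, z) ∂(gaussSeq.prod gaussSeq) := by
        rw [Finset.sum_const, Nat.card_Ico, nsmul_eq_mul]
        congr 2; omega
    _ ≤ ∑ i ∈ Finset.Ico j (n + 1 - j),
          ∫⁻ z, ((windowMed (likelihoodRatio x z.1 z.2) i n).natAbs : ℝ≥0∞)
            ∂(gaussSeq.prod gaussSeq) := by
        refine Finset.sum_le_sum fun i hi => lintegral_mono fun z => ?_
        simp only [Finset.mem_Ico] at hi
        have := lowMed_le (j := j) (l := i) (m := n - i) hi.1 (by omega) (x, z)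
        rwa [show i + (n - i) = n by omega] at this
    _ ≤ _ := Finset.sum_le_sum_of_subset hsub

lemma windowMed_natAbs_le (p : ℤ → ℝ) {l n : ℕ} (hl : l ≤ n) : (windowMed p l n).natAbs ≤ n := by
  have := natMed_le (fun i => p ((i : ℤ) - l)) n
  rw [windowMed]
  omega

lemma medianRisk_le (n : ℕ) (x : ℝ) : medianRisk n x ≤ ((n + 1) * n : ℕ) := by
  calc medianRisk n x ≤ ∑ i ∈ Finset.range (n + 1), (n : ℝ≥0∞) := by
        refine Finset.sum_le_sum fun i hi => ?_
        calc _ ≤ ∫⁻ _, (n : ℝ≥0∞) ∂(gaussSeq.prod gaussSeq) := by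
              refine lintegral_mono fun z => ?_
              exact Nat.cast_le.2 (windowMed_natAbs_le _ (by
                have := Finset.mem_range.1 hi; omega))
          _ = n := by simp
    _ = _ := by simp

/-- The limit of the bounds for exact location is at most `E (Δ² ν(Δ)) / 2`. -/
lemma iInf_lintegral_negProb_le (G : Measure ℝ) [IsProbabilityMeasure G] (hG : G {0} = 0) :
    ⨅ j, ∫⁻ x, negProb x j ^ 2 ∂G ≤ betaUpper G := by
  have hanti : Antitone fun (j : ℕ) (x : ℝ) => negProb x j ^ 2 := fun j j' h x =>
    pow_le_pow_left' (negProb_anti x h) 2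
  rw [← lintegral_iInf (fun j => (measurable_negProb j).pow_const 2) hanti, betaUpper,
    ← lintegral_const_mul' _ _ (by simp)]
  · have h0 : ∀ᵐ x ∂G, x ∉ ({0} : Set ℝ) := measure_eq_zero_iff_ae_notMem.1 hG
    refine lintegral_mono_ae ?_
    filter_upwards [h0] with x hx
    have hx0 : x ≠ 0 := hx
    have h1 := iInf_negProb_le hx0
    set s := ∑' i : ℕ,
      ((i : ℝ) + 1)⁻¹ * cdf (gaussianReal 0 1) (-(Real.sqrt ((i : ℝ) + 1) / 2 * |x|))
    have h2 : x ^ 2 * overshoot x = 2 * Real.exp (-s) ^ 2 := by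
      rw [overshoot, sq (Real.exp _), ← Real.exp_add, show -2 * s = -s + -s by ring]
      field_simp
    rw [h2, ENNReal.ofReal_mul (by norm_num), ← mul_assoc]
    rw [show (2 : ℝ≥0∞)⁻¹ * ENNReal.ofReal 2 = 1 by
      rw [ENNReal.ofReal_ofNat]; exact ENNReal.inv_mul_cancel (by norm_num) (by norm_num), one_mul,
      ENNReal.ofReal_pow (Real.exp_pos _).le]
    refine le_trans ?_ (pow_le_pow_left' h1 2)
    have htend : Tendsto (fun j => negProb x j ^ 2) atTop (𝓝 ((⨅ j, negProb x j) ^ 2)) :=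
      (ENNReal.continuous_pow 2).continuousAt.tendsto.comp
        (tendsto_atTop_iInf (negProb_anti x))
    exact ge_of_tendsto' htend fun j => iInf_le _ j
  · refine ne_top_of_le_ne_top ENNReal.one_ne_top (b := 1) ?_
    calc ∫⁻ x, negProb x 0 ^ 2 ∂G ≤ ∫⁻ _, 1 ∂G :=
          lintegral_mono fun x => pow_le_one' (negProb_le_one x 0) 2
      _ = 1 := by simp

/-! ### The law of the observations given the change-points -/

/-- The random set of change-points. -/
abbrev changePoints {Ω : Type*} (T : ℕ) (Y : ℕ → Ω → Bool) (ω : Ω) : Finset ℕ :=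
  points T (fun u => Y u ω)

/-- The mean at time `u` of a sequence with change-points `s`, as a function of the initial mean
and the successive jumps. -/
def meanVec (s : Finset ℕ) {n : ℕ} (hs : s.card = n) (a : ℝ × (Fin n → ℝ)) (u : ℕ) : ℝ :=
  a.1 + ∑ i, if s.orderEmbOfFin hs i < u then a.2 i else 0

@[fun_prop]
lemma measurable_meanVec (s : Finset ℕ) {n : ℕ} (hs : s.card = n) (u : ℕ) :
    Measurable fun a => meanVec s hs a u := by
  unfold meanVec
  refine measurable_fst.add (Finset.measurable_sum _ fun i _ => ?_)
  split_ifs <;> fun_prop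

lemma sum_orderEmbOfFin (s : Finset ℕ) {n : ℕ} (hs : s.card = n) (g : ℕ → ℝ) :
    ∑ i, g (s.orderEmbOfFin hs i) = ∑ t ∈ s, g t := by
  conv_rhs => rw [← Finset.map_orderEmbOfFin_univ s hs, Finset.sum_map]
  rfl

lemma mem_points {T : ℕ} {y : ℕ → Bool} {t : ℕ} :
    t ∈ points T y ↔ t ∈ Finset.Ico 1 T ∧ y t = true := by
  simp [points]

lemma changePoints_eq_iff {Ω : Type*} {T : ℕ} {Y : ℕ → Ω → Bool} {ω : Ω} {s : Finset ℕ}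
    (hs : s ⊆ Finset.Ico 1 T) :
    changePoints T Y ω = s ↔ ∀ t ∈ Finset.Ico 1 T, (Y t ω = true ↔ t ∈ s) := by
  constructor
  · rintro rfl t ht
    rw [mem_points]
    exact ⟨fun h => ⟨ht, h⟩, fun h => h.2⟩
  · intro h
    ext t
    rw [mem_points]
    exact ⟨fun h' => (h t h'.1).1 h'.2, fun h' => ⟨hs h', (h t (hs h')).2 h'⟩⟩

section Model

variable {Ω : Type*} [MeasurableSpace Ω] {P : Measure Ω} {T : ℕ}
  {q σ : ℝ} {F : Measure ℝ} {Y : ℕ → Ω → Bool} {Δ μ X : ℕ → Ω → ℝ}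

lemma measurableSet_changePoints (h : IsModel P T q σ F Y Δ μ X) (s : Finset ℕ) :
    MeasurableSet {ω | changePoints T Y ω = s} := by
  by_cases hs : s ⊆ Finset.Ico 1 T
  · have : {ω | changePoints T Y ω = s} =
        ⋂ t ∈ Finset.Ico 1 T, {ω | Y t ω = decide (t ∈ s)} := by
      ext ω
      rw [Set.mem_ofPred_eq, changePoints_eq_iff hs]
      simp only [Set.mem_iInter, Set.mem_ofPred_eq]
      refine forall₂_congr fun t _ => ?_
      by_cases hts : t ∈ s <;> simp [hts]
    rw [this]
    exact Finset.measurableSet_biInter _ fun t ht =>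
      h.measurable_Y t ht (measurableSet_singleton _)
  · convert MeasurableSet.empty
    ext ω
    simp only [Set.mem_ofPred_eq, Set.mem_empty_iff_false, iff_false]
    rintro rfl
    exact hs (Finset.filter_subset _ _)

/-- The probability that the change-points are a given set of `n` points, out of `N` possible
ones. -/
noncomputable def setWeight (q : ℝ) (N n : ℕ) : ℝ≥0∞ :=
  ENNReal.ofReal q ^ n * ENNReal.ofReal (1 - q) ^ (N - n)

lemma setWeight_succ (q : ℝ) {N n : ℕ} (hn : n < N) :
    setWeight q N (n + 1) * ENNReal.ofReal (1 - q) = ENNReal.ofReal q * setWeight q N n := by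
  rw [setWeight, setWeight, show N - n = (N - (n + 1)) + 1 by omega]
  ring

lemma setWeight_ne_zero {q : ℝ} (h0 : 0 < q) (h1 : q < 1) (N n : ℕ) : setWeight q N n ≠ 0 := by
  refine mul_ne_zero (pow_ne_zero _ ?_) (pow_ne_zero _ ?_) <;> simpa

lemma prob_changePoints [IsProbabilityMeasure P] (h : IsModel P T q σ F Y Δ μ X) (hq : 0 < q)
    {s : Finset ℕ} (hs : s ⊆ Finset.Ico 1 T) :
    P {ω | changePoints T Y ω = s} = setWeight q (T - 1) s.card := by
  have hset : {ω | changePoints T Y ω = s} =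
      ⋂ t : Finset.Ico 1 T, {ω | Y t ω = decide ((t : ℕ) ∈ s)} := by
    ext ω
    rw [Set.mem_ofPred_eq, changePoints_eq_iff hs]
    simp only [Set.mem_iInter, Set.mem_ofPred_eq, Subtype.forall]
    refine forall₂_congr fun t _ => ?_
    by_cases hts : t ∈ s <;> simp [hts]
  have hone : ∀ t ∈ Finset.Ico 1 T, P {ω | Y t ω = decide (t ∈ s)} =
      if t ∈ s then ENNReal.ofReal q else ENNReal.ofReal (1 - q) := by
    intro t ht
    split_ifs with hts
    · simpa [hts] using h.intensity t ht
    · have : {ω | Y t ω = decide (t ∈ s)} = {ω | Y t ω = true}ᶜ := by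
        ext ω; simp [hts]
      have hms : MeasurableSet {ω | Y t ω = true} :=
        h.measurable_Y t ht (measurableSet_singleton true)
      rw [this, prob_compl_eq_one_sub hms, h.intensity t ht, ENNReal.ofReal_sub _ hq.le,
        ENNReal.ofReal_one]
  have hprod := h.indep_Y.meas_iInter (s := fun t : Finset.Ico 1 T =>
    {ω | Y t ω = decide ((t : ℕ) ∈ s)})
    fun t => ⟨{decide ((t : ℕ) ∈ s)}, measurableSet_singleton _, rfl⟩
  rw [hset, hprod, Finset.prod_coe_sort (Finset.Ico 1 T) (fun t => P {ω | Y t ω = decide (t ∈ s)}),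
    Finset.prod_congr rfl hone, Finset.prod_ite, Finset.prod_const, Finset.prod_const, setWeight,
    Finset.filter_mem_eq_inter, Finset.inter_eq_right.2 hs, Finset.filter_notMem_eq_sdiff,
    Finset.card_sdiff_of_subset hs, Nat.card_Ico]

lemma measurable_startAndJumps (h : IsModel P T q σ F Y Δ μ X) (hT : 1 ≤ T) {s : Finset ℕ}
    (hs : s ⊆ Finset.Ico 1 T) {n : ℕ} (hn : s.card = n) :
    Measurable (startAndJumps μ Δ s hn) := by
  refine (h.measurable_mean 1 (Finset.mem_Icc.2 ⟨le_rfl, hT⟩)).prodMk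
    (measurable_pi_lambda _ fun i => ?_)
  exact h.measurable_jump _ (hs (Finset.orderEmbOfFin_mem s hn i))

lemma mean_eq_meanVec (h : IsModel P T q σ F Y Δ μ X) {s : Finset ℕ} {n : ℕ} (hn : s.card = n)
    {ω : Ω} (hω : changePoints T Y ω = s) {u : ℕ} (hu : u ∈ Finset.Icc 1 T) :
    μ u ω = meanVec s hn (startAndJumps μ Δ s hn ω) u := by
  have hsum : ∀ u, meanVec s hn (startAndJumps μ Δ s hn ω) u =
      μ 1 ω + ∑ t ∈ s, if t < u then Δ t ω else 0 := fun u => by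
    rw [← sum_orderEmbOfFin s hn fun t => if t < u then Δ t ω else 0]; rfl
  rw [hsum]
  obtain ⟨h1, hT⟩ := Finset.mem_Icc.1 hu
  clear hu hsum
  induction u, h1 using Nat.le_induction with
  | base =>
    rw [Finset.sum_eq_zero fun t ht => ?_, add_zero]
    rw [← hω, mem_points, Finset.mem_Ico] at ht
    rw [if_neg (by omega)]
  | succ u hu ih =>
    have hmem : u ∈ Finset.Ico 1 T := Finset.mem_Ico.2 ⟨hu, by omega⟩
    rw [h.mean_step u hmem, ih (by omega), add_assoc]
    congr 1
    have hsplit : ∀ t ∈ s, (if t < u + 1 then Δ t ω else 0) =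
        (if t < u then Δ t ω else 0) + if t = u then Δ t ω else 0 := by
      intro t _
      split_ifs <;> first | omega | simp
    rw [Finset.sum_congr rfl hsplit, Finset.sum_add_distrib, Finset.sum_ite_eq']
    congr 1
    by_cases hY : Y u ω = true
    · have : u ∈ s := by rw [← hω, mem_points]; exact ⟨hmem, hY⟩
      simp [hY, this]
    · have : u ∉ s := by rw [← hω, mem_points]; exact fun h => hY h.2
      simp [hY, this]

lemma map_jump (h : IsModel P T q σ F Y Δ μ X) (hT : 1 ≤ T) {s : Finset ℕ}
    (hs : s ⊆ Finset.Ico 1 T) {n : ℕ} (hn : s.card = n) (j : Fin n) :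
    ((P[|{ω | changePoints T Y ω = s}]).map (startAndJumps μ Δ s hn)).map (fun a => a.2 j) = F := by
  rw [Measure.map_map (by fun_prop) (measurable_startAndJumps h hT hs hn)]
  exact h.jump_law s hs _ (Finset.orderEmbOfFin_mem s hn j)

lemma setLIntegral_jump [IsProbabilityMeasure P] (h : IsModel P T q σ F Y Δ μ X) {s : Finset ℕ}
    (hs : s ⊆ Finset.Ico 1 T) {t : ℕ} (ht : t ∈ s)
    (hne : P {ω | changePoints T Y ω = s} ≠ 0) {g : ℝ → ℝ≥0∞} (hg : Measurable g) :
    ∫⁻ ω in {ω | changePoints T Y ω = s}, g (Δ t ω) ∂P =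
      P {ω | changePoints T Y ω = s} * ∫⁻ x, g x ∂F := by
  rw [← h.jump_law s hs t ht, lintegral_map hg (h.measurable_jump t (hs ht)),
    ProbabilityTheory.cond, lintegral_smul_measure, smul_eq_mul, ← mul_assoc,
    ENNReal.mul_inv_cancel hne (measure_ne_top _ _), one_mul]

/-- Since `F` has no atom at `0`, the jumps do not vanish. -/
lemma ae_jump_ne_zero [IsProbabilityMeasure P] (h : IsModel P T q σ F Y Δ μ X) (hF : F {0} = 0) :
    ∀ᵐ ω ∂P, ∀ t ∈ Finset.Ico 1 T, Y t ω = true → Δ t ω ≠ 0 := by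
  have key : ∀ s ∈ (Finset.Ico 1 T).powerset, ∀ t ∈ s,
      ∀ᵐ ω ∂P, changePoints T Y ω = s → Δ t ω ≠ 0 := by
    intro s hs t ht
    rw [Finset.mem_powerset] at hs
    refine (ae_restrict_iff' (measurableSet_changePoints h s)).1 ?_
    by_cases hne : P {ω | changePoints T Y ω = s} = 0
    · rw [Measure.restrict_eq_zero.2 hne]; simp
    · have := setLIntegral_jump h hs ht hne (g := Set.indicator {0} 1)
        (measurable_one.indicator (measurableSet_singleton 0))
      rw [lintegral_indicator_one (measurableSet_singleton 0), hF, mul_zero] at this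
      have h0 := (lintegral_eq_zero_iff ((measurable_one.indicator
        (measurableSet_singleton (0 : ℝ))).comp (h.measurable_jump t (hs ht)))).1 this
      filter_upwards [h0] with ω hω h0
      simp [h0] at hω
  have key' : ∀ᵐ ω ∂P, ∀ s ∈ (Finset.Ico 1 T).powerset, ∀ t ∈ s,
      changePoints T Y ω = s → Δ t ω ≠ 0 :=
    (Filter.eventually_all_finset _).2 fun s hs => (Filter.eventually_all_finset _).2 (key s hs)
  filter_upwards [key'] with ω hω t ht hY
  exact hω (changePoints T Y ω) (Finset.mem_powerset.2 (Finset.filter_subset _ _)) t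
    (mem_points.2 ⟨ht, hY⟩) rfl

/-- The mean vectors with change-points `s`. -/
def meansWith (T : ℕ) (s : Finset ℕ) : Set (Finset.Icc 1 T → ℝ) :=
  {m | ∀ t ∈ Finset.Ico 1 T, extendZero m (t + 1) ≠ extendZero m t ↔ t ∈ s}

lemma measurableSet_meansWith (T : ℕ) (s : Finset ℕ) : MeasurableSet (meansWith T s) := by
  have : meansWith T s = ⋂ t ∈ Finset.Ico 1 T,
      {m | extendZero m (t + 1) ≠ extendZero m t ↔ t ∈ s} := by
    ext m; simp [meansWith]
  rw [this]
  refine Finset.measurableSet_biInter _ fun t _ => ?_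
  have hms : MeasurableSet {m : Finset.Icc 1 T → ℝ | extendZero m (t + 1) = extendZero m t} :=
    measurableSet_eq_fun (by fun_prop) (by fun_prop)
  by_cases ht : t ∈ s
  · simp only [ht, iff_true]; exact hms.compl
  · simpa only [ht, iff_false, not_not, ne_eq] using hms

lemma extendZero_apply {u : ℕ} (hu : u ∈ Finset.Icc 1 T) (f : ℕ → ℝ) :
    extendZero (fun u : Finset.Icc 1 T => f u) u = f u := by
  rw [extendZero, dif_pos hu]

/-- The change-points are almost surely a function of the means, of which the noise is
independent. -/
lemma changePoints_ae_eq [IsProbabilityMeasure P] (h : IsModel P T q σ F Y Δ μ X) (hF : F {0} = 0)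
    {s : Finset ℕ} (hs : s ⊆ Finset.Ico 1 T) :
    {ω | changePoints T Y ω = s} =ᵐ[P]
      (fun ω (u : Finset.Icc 1 T) => μ u ω) ⁻¹' meansWith T s := by
  refine eventuallyEq_set.2 ?_
  filter_upwards [ae_jump_ne_zero h hF] with ω hω
  refine (changePoints_eq_iff hs).trans (forall₂_congr fun t ht => ?_)
  have ht' := Finset.mem_Ico.1 ht
  rw [extendZero_apply (Finset.mem_Icc.2 ⟨by omega, by omega⟩) (fun u => μ u ω),
    extendZero_apply (Finset.mem_Icc.2 ⟨by omega, by omega⟩) (fun u => μ u ω),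
    h.mean_step t ht]
  by_cases hY : Y t ω = true
  · simp [hY, hω t ht hY]
  · simp [hY]

lemma map_noise [IsProbabilityMeasure P] (h : IsModel P T q σ F Y Δ μ X) :
    P.map (fun ω (u : Finset.Icc 1 T) => X u ω - μ u ω) =
      Measure.pi fun _ : Finset.Icc 1 T => gaussianReal 0 (σ ^ 2).toNNReal := by
  refine ((iIndepFun_iff_map_fun_eq_pi_map (f := fun (u : Finset.Icc 1 T) ω => X u ω - μ u ω)
    fun u => ((h.measurable_obs u u.2).sub (h.measurable_mean u u.2)).aemeasurable).1
    h.indep_noise).trans ?_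
  congr 1
  ext1 u
  exact h.noise_law u u.2

lemma lintegral_pi_gaussian_add {ι : Type*} [Fintype ι] (m : ι → ℝ) (v : NNReal)
    {g : (ι → ℝ) → ℝ≥0∞} (hg : Measurable g) :
    ∫⁻ e, g (fun u => m u + e u) ∂(Measure.pi fun _ : ι => gaussianReal 0 v) =
      ∫⁻ y, g y ∂(Measure.pi fun u => gaussianReal (m u) v) := by
  have hmap : (Measure.pi fun _ : ι => gaussianReal 0 v).map (fun e u => m u + e u) =
      Measure.pi fun u => gaussianReal (m u) v := by
    have h1 : ∀ u, (gaussianReal 0 v).map (fun a => m u + a) = gaussianReal (m u) v := fun u => by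
      rw [gaussianReal_map_const_add, zero_add]
    have := fun u => (Measure.isProbabilityMeasure_map (μ := gaussianReal 0 v)
      (f := fun a => m u + a) (by fun_prop))
    rw [Measure.pi_map_pi (f := fun u a => m u + a) (fun u => by fun_prop)]
    simp only [h1]
  rw [← hmap, lintegral_map hg (by fun_prop)]

/-- Given the change-points, the observations are the means plus independent Gaussian noise. -/
lemma setLIntegral_startAndJumps_obs [IsProbabilityMeasure P] (h : IsModel P T q σ F Y Δ μ X)
    (hF : F {0} = 0) (hT : 1 ≤ T) {s : Finset ℕ} (hs : s ⊆ Finset.Ico 1 T) {n : ℕ}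
    (hn : s.card = n) (hne : P {ω | changePoints T Y ω = s} ≠ 0)
    {Ψ : ℝ × (Fin n → ℝ) → (Finset.Icc 1 T → ℝ) → ℝ≥0∞} (hΨ : Measurable (Function.uncurry Ψ)) :
    ∫⁻ ω in {ω | changePoints T Y ω = s},
        Ψ (startAndJumps μ Δ s hn ω) (fun u => X u ω) ∂P =
      P {ω | changePoints T Y ω = s} * ∫⁻ a, ∫⁻ y, Ψ a y
        ∂(Measure.pi fun u : Finset.Icc 1 T => gaussianReal (meanVec s hn a u) (σ ^ 2).toNNReal)
        ∂((P[|{ω | changePoints T Y ω = s}]).map (startAndJumps μ Δ s hn)) := by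
  set E := {ω | changePoints T Y ω = s}
  have hE : MeasurableSet E := measurableSet_changePoints h s
  set N := Measure.pi fun _ : Finset.Icc 1 T => gaussianReal 0 (σ ^ 2).toNNReal
  have hSJ := measurable_startAndJumps h hT hs hn
  let M : Ω → Finset.Icc 1 T → ℝ := fun ω u => μ u ω
  let ε : Ω → Finset.Icc 1 T → ℝ := fun ω u => X u ω - μ u ω
  have hM : Measurable M := measurable_pi_lambda _ fun u => h.measurable_mean u u.2
  have hε : Measurable ε := measurable_pi_lambda _ fun u =>
    (h.measurable_obs u u.2).sub (h.measurable_mean u u.2)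
  -- the initial mean and the jumps, recovered from the means
  let ρ : (Finset.Icc 1 T → ℝ) → ℝ × (Fin n → ℝ) := fun m => (extendZero m 1, fun i =>
    extendZero m (s.orderEmbOfFin hn i + 1) - extendZero m (s.orderEmbOfFin hn i))
  have hρ : Measurable ρ := by fun_prop
  have hρE : ∀ ω ∈ E, ρ (M ω) = startAndJumps μ Δ s hn ω := by
    intro ω hω
    have hval : ∀ u ∈ Finset.Icc 1 T, extendZero (M ω) u = μ u ω := fun u hu =>
      extendZero_apply hu (fun u => μ u ω)
    refine Prod.ext (hval 1 (Finset.mem_Icc.2 ⟨le_rfl, hT⟩)) (funext fun i => ?_)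
    have hmem := Finset.orderEmbOfFin_mem s hn i
    have hI := hs hmem
    have hI' := Finset.mem_Ico.1 hI
    simp only [ρ, startAndJumps]
    rw [hval _ (Finset.mem_Icc.2 ⟨by omega, by omega⟩), hval _ (Finset.mem_Icc.2 ⟨by omega, by omega⟩),
      h.mean_step _ hI, ((changePoints_eq_iff hs).1 hω _ hI).2 hmem]
    simp
  let K : (Finset.Icc 1 T → ℝ) × (Finset.Icc 1 T → ℝ) → ℝ≥0∞ := fun p =>
    (meansWith T s).indicator (fun m => Ψ (ρ m) (fun u => m u + p.2 u)) p.1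
  have hK0 : Measurable fun p : (Finset.Icc 1 T → ℝ) × (Finset.Icc 1 T → ℝ) =>
      Ψ (ρ p.1) (fun u => p.1 u + p.2 u) :=
    hΨ.comp ((hρ.comp measurable_fst).prodMk (by fun_prop))
  have hK : Measurable K := by
    have : K = (Prod.fst ⁻¹' meansWith T s).indicator
        fun p : (Finset.Icc 1 T → ℝ) × (Finset.Icc 1 T → ℝ) =>
          Ψ (ρ p.1) (fun u => p.1 u + p.2 u) := by
      ext p
      by_cases hp : p.1 ∈ meansWith T s <;> simp [K, hp]
    rw [this]
    exact hK0.indicator (measurable_fst (measurableSet_meansWith T s))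
  have hind : ∀ {g : (Finset.Icc 1 T → ℝ) → (Finset.Icc 1 T → ℝ) → ℝ≥0∞}
      {e : Ω → Finset.Icc 1 T → ℝ},
      ∫⁻ ω in E, g (M ω) (e ω) ∂P =
        ∫⁻ ω, (meansWith T s).indicator (fun m => g m (e ω)) (M ω) ∂P := by
    intro g e
    rw [setLIntegral_congr (changePoints_ae_eq h hF hs),
      ← lintegral_indicator (hM (measurableSet_meansWith T s))]
    rfl
  have hjoint : P.map (fun ω => (M ω, ε ω)) = (P.map M).prod N := by
    rw [(indepFun_iff_map_prod_eq_prod_map_map hM.aemeasurable hε.aemeasurable).1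
      h.indep_noise_mean, map_noise h]
  let G : ℝ × (Fin n → ℝ) → ℝ≥0∞ := fun a =>
    ∫⁻ e, Ψ a (fun u => meanVec s hn a u + e u) ∂N
  have hG : Measurable G := by
    have : Measurable fun p : (ℝ × (Fin n → ℝ)) × (Finset.Icc 1 T → ℝ) =>
        Ψ p.1 (fun u => meanVec s hn p.1 u + p.2 u) :=
      hΨ.comp (measurable_fst.prodMk (measurable_pi_lambda _ fun u =>
        ((measurable_meanVec s hn u).comp measurable_fst).add (by fun_prop)))
    exact this.lintegral_prod_right'
  calc ∫⁻ ω in E, Ψ (startAndJumps μ Δ s hn ω) (fun u => X u ω) ∂P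
      = ∫⁻ ω in E, Ψ (ρ (M ω)) (fun u => M ω u + ε ω u) ∂P := by
        refine setLIntegral_congr_fun hE fun ω hω => ?_
        simp only [hρE ω hω, M, ε, add_sub_cancel]
    _ = ∫⁻ ω, K (M ω, ε ω) ∂P := hind (g := fun m e => Ψ (ρ m) (fun u => m u + e u))
    _ = ∫⁻ p, K p ∂((P.map M).prod N) := by
        rw [← hjoint, lintegral_map hK (hM.prodMk hε)]
    _ = ∫⁻ ω, ∫⁻ e, K (M ω, e) ∂N ∂P := by
        rw [lintegral_prod _ hK.aemeasurable, lintegral_map hK.lintegral_prod_right' hM]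
    _ = ∫⁻ ω in E, ∫⁻ e, Ψ (ρ (M ω)) (fun u => M ω u + e u) ∂N ∂P := by
        refine Eq.trans (lintegral_congr fun ω => ?_)
          (hind (g := fun m _ => ∫⁻ e, Ψ (ρ m) (fun u => m u + e u) ∂N) (e := ε)).symm
        by_cases hω : M ω ∈ meansWith T s <;> simp [K, hω]
    _ = ∫⁻ ω in E, G (startAndJumps μ Δ s hn ω) ∂P := by
        refine setLIntegral_congr_fun hE fun ω hω => ?_
        simp only [hρE ω hω, G]
        refine lintegral_congr fun e => ?_
        congr 1
        ext u
        rw [← mean_eq_meanVec h hn hω u.2]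
    _ = P E * ∫⁻ a, G a ∂((P[|E]).map (startAndJumps μ Δ s hn)) := by
        rw [lintegral_map hG hSJ, ProbabilityTheory.cond, lintegral_smul_measure, smul_eq_mul,
          ← mul_assoc, ENNReal.mul_inv_cancel hne (measure_ne_top _ _), one_mul]
    _ = _ := by
        congr 1
        refine lintegral_congr fun a => ?_
        exact lintegral_pi_gaussian_add (fun u : Finset.Icc 1 T => meanVec s hn a u) _
          (hΨ.comp measurable_prodMk_left)

end Model

/-! ### Moving one change-point within a window -/

/-- If no point of `s'` lies in the window, then moving a point within the window does not change
its rank in the set, nor the other points. -/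
lemma exists_rank {s' : Finset ℕ} {w n m : ℕ} (hdisj : ∀ u ∈ s', u < w ∨ w + n < u)
    (hcard : ∀ i ≤ n, (insert (w + i) s').card = m) :
    ∃ (j : Fin m) (e : Fin m → ℕ), ∀ i (hi : i ≤ n),
      (insert (w + i) s').orderEmbOfFin (hcard i hi) j = w + i ∧
      ∀ j' ≠ j, (insert (w + i) s').orderEmbOfFin (hcard i hi) j' = e j' := by
  set e0 := (insert (w + 0) s').orderEmbOfFin (hcard 0 n.zero_le)
  obtain ⟨j, hj⟩ : ∃ j, e0 j = w := by
    have : w ∈ Set.range e0 := by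
      rw [Finset.range_orderEmbOfFin]; simp
    exact this
  have hmem : ∀ j' ≠ j, e0 j' ∈ s' := by
    intro j' hj'
    have h1 := Finset.orderEmbOfFin_mem (insert (w + 0) s') (hcard 0 n.zero_le) j'
    rw [Finset.mem_insert] at h1
    rcases h1 with h1 | h1
    · exact absurd (e0.injective ((show e0 j' = w from h1).trans hj.symm)) hj'
    · exact h1
  refine ⟨j, e0, fun i hi => ?_⟩
  let f : Fin m → ℕ := fun j' => if j' = j then w + i else e0 j'
  have hf : StrictMono f := by
    intro a b hab
    have hlt := e0.strictMono hab
    simp only [f]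
    split_ifs with ha hb hb
    · exact absurd (ha.trans hb.symm) hab.ne
    · have := hdisj _ (hmem b hb)
      rw [ha, hj] at hlt; omega
    · have := hdisj _ (hmem a ha)
      rw [hb, hj] at hlt; omega
    · exact hlt
  have huniq := Finset.orderEmbOfFin_unique (hcard i hi) (f := f) (fun j' => by
    simp only [f]
    split_ifs with h
    · exact Finset.mem_insert_self _ _
    · exact Finset.mem_insert_of_mem (hmem j' h)) hf
  refine ⟨?_, fun j' hj' => ?_⟩
  · rw [← huniq]; simp [f]
  · rw [← huniq]; simp [f, hj']

lemma meanVec_insert {s' : Finset ℕ} {t m : ℕ} (hcard : (insert t s').card = m) {j : Fin m}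
    {e : Fin m → ℕ} (hj : (insert t s').orderEmbOfFin hcard j = t)
    (he : ∀ j' ≠ j, (insert t s').orderEmbOfFin hcard j' = e j') (a : ℝ × (Fin m → ℝ)) (u : ℕ) :
    meanVec (insert t s') hcard a u =
      (a.1 + ∑ j' ∈ Finset.univ.erase j, if e j' < u then a.2 j' else 0) +
        if t < u then a.2 j else 0 := by
  rw [meanVec, ← Finset.sum_erase_add _ _ (Finset.mem_univ j), hj, add_assoc]
  congr 2
  exact Finset.sum_congr rfl fun j' hj' => by rw [he j' (Finset.ne_of_mem_erase hj')]

/-! ### Blocks far from the other change-points -/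

open Classical in
/-- The blocks `[m k, (m + 1) k)` before `T` that are more than four blocks away from all the
points of `s` and from the end points. -/
noncomputable def isolatedBlocks (T k : ℕ) (s : Finset ℕ) : Finset ℕ :=
  (Finset.range (T / k)).filter fun m : ℕ =>
    ∀ u ∈ (insert 0 (insert T s) : Finset ℕ), u / k + 4 < m ∨ m + 4 < u / k

lemma mem_isolatedBlocks {T k m : ℕ} {s : Finset ℕ} :
    m ∈ isolatedBlocks T k s ↔ m < T / k ∧
      ∀ u ∈ (insert 0 (insert T s) : Finset ℕ), u / k + 4 < m ∨ m + 4 < u / k := by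
  rw [isolatedBlocks, @Finset.mem_filter _ _ (_), Finset.mem_range]

/-- The points of the isolated blocks. -/
noncomputable def isolatedPoints (T k : ℕ) (s : Finset ℕ) : Finset ℕ :=
  (isolatedBlocks T k s ×ˢ Finset.range k).image fun p => p.1 * k + p.2

lemma lt_of_mem_isolatedBlocks {T k m : ℕ} {s : Finset ℕ} (hm : m ∈ isolatedBlocks T k s)
    {i : ℕ} (hi : i < k) {u : ℕ} (hu : u ∈ insert 0 (insert T s)) :
    u + 4 * k < m * k + i ∨ m * k + i + 4 * k < u := by
  have hk : 0 < k := by omega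
  rcases (mem_isolatedBlocks.1 hm).2 u hu with h | h
  · left
    have h1 : u < (u / k + 1) * k := by
      have := Nat.lt_div_mul_add (a := u) hk; rwa [← Nat.succ_mul] at this
    have h2 : (u / k + 5) * k ≤ m * k := Nat.mul_le_mul_right k h
    have h3 : (u / k + 5) * k = (u / k + 1) * k + 4 * k := by ring
    omega
  · right
    have h1 : u / k * k ≤ u := Nat.div_mul_le_self u k
    have h2 : (m + 5) * k ≤ u / k * k := Nat.mul_le_mul_right k h
    have h3 : (m + 5) * k = m * k + k + 4 * k := by ring
    omega

lemma mul_add_lt_of_mem_isolatedBlocks {T k m : ℕ} {s : Finset ℕ} (hm : m ∈ isolatedBlocks T k s)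
    {i : ℕ} (hi : i < k) : 1 ≤ m * k ∧ m * k + i < T := by
  have h0 := lt_of_mem_isolatedBlocks hm (show 0 < k by omega) (Finset.mem_insert_self 0 _)
  have h1 : m < T / k := (mem_isolatedBlocks.1 hm).1
  have h2 : (m + 1) * k ≤ T / k * k := Nat.mul_le_mul_right k h1
  have h3 := Nat.div_mul_le_self T k
  rw [Nat.succ_mul] at h2
  omega

lemma isolatedPoints_subset (T k : ℕ) (s : Finset ℕ) :
    isolatedPoints T k s ⊆ Finset.Ico 1 T \ s := by
  intro t ht
  obtain ⟨⟨m, i⟩, hp, rfl⟩ := Finset.mem_image.1 ht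
  obtain ⟨hm, hi⟩ := Finset.mem_product.1 hp
  have hi' := Finset.mem_range.1 hi
  have h1 := mul_add_lt_of_mem_isolatedBlocks hm hi'
  refine Finset.mem_sdiff.2 ⟨Finset.mem_Ico.2 ⟨by simp only at h1 ⊢; omega, h1.2⟩, fun hs => ?_⟩
  have := lt_of_mem_isolatedBlocks hm hi'
    (Finset.mem_insert_of_mem (Finset.mem_insert_of_mem hs))
  omega

lemma injOn_block {k : ℕ} (B : Finset ℕ) :
    Set.InjOn (fun p : ℕ × ℕ => p.1 * k + p.2) (B ×ˢ Finset.range k : Finset (ℕ × ℕ)) := by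
  rintro ⟨m, i⟩ hp ⟨m', i'⟩ hp' h
  simp only [Finset.coe_product, Set.mem_prod, Finset.mem_coe, Finset.mem_range] at hp hp' h
  have hk : 0 < k := by omega
  have e1 : (m * k + i) / k = m := by
    rw [Nat.mul_comm, Nat.mul_add_div hk, Nat.div_eq_of_lt hp.2, add_zero]
  have e2 : (m' * k + i') / k = m' := by
    rw [Nat.mul_comm, Nat.mul_add_div hk, Nat.div_eq_of_lt hp'.2, add_zero]
  have : m = m' := by rw [← e1, ← e2, h]
  subst this
  exact Prod.ext rfl (by simpa using h)

lemma sum_isolatedPoints {M : Type*} [AddCommMonoid M] (T k : ℕ) (s : Finset ℕ) (J : ℕ → M) :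
    ∑ t ∈ isolatedPoints T k s, J t =
      ∑ m ∈ isolatedBlocks T k s, ∑ i ∈ Finset.range k, J (m * k + i) := by
  rw [isolatedPoints, Finset.sum_image (injOn_block _), Finset.sum_product]

lemma card_isolatedPoints (T k : ℕ) (s : Finset ℕ) :
    (isolatedPoints T k s).card = (isolatedBlocks T k s).card * k := by
  rw [isolatedPoints, Finset.card_image_of_injOn (injOn_block _), Finset.card_product,
    Finset.card_range]

/-- Few points are outside the isolated blocks. -/
lemma card_sdiff_isolatedPoints (T : ℕ) {k : ℕ} (hk : 0 < k) (s : Finset ℕ) :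
    ((Finset.Ico 1 T \ s) \ isolatedPoints T k s).card ≤ (s.card + 2) * (9 * k) := by
  have hsub : (Finset.Ico 1 T \ s) \ isolatedPoints T k s ⊆
      (insert 0 (insert T s) : Finset ℕ).biUnion fun u =>
        Finset.Ico ((u / k - 4) * k) ((u / k + 5) * k) := by
    intro t ht
    rw [Finset.mem_sdiff, Finset.mem_sdiff, Finset.mem_Ico] at ht
    have hmod : t / k * k + t % k = t := Nat.div_add_mod' t k
    have hlt := Nat.mod_lt t hk
    have hfar : ∃ u ∈ (insert 0 (insert T s) : Finset ℕ), ¬ (u / k + 4 < t / k ∨ t / k + 4 < u / k) := by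
      by_contra! hcon
      by_cases hT : t / k < T / k
      · refine ht.2 (Finset.mem_image.2 ⟨(t / k, t % k), Finset.mem_product.2
          ⟨mem_isolatedBlocks.2 ⟨hT, hcon⟩, Finset.mem_range.2 hlt⟩, hmod⟩)
      · have h1 := Nat.div_le_div_right (c := k) ht.1.1.2.le
        have := hcon T (by simp)
        omega
    obtain ⟨u, hu, hnot⟩ := hfar
    refine Finset.mem_biUnion.2 ⟨u, hu, Finset.mem_Ico.2 ⟨?_, ?_⟩⟩
    · have : (u / k - 4) * k ≤ t / k * k :=
        Nat.mul_le_mul_right k (Nat.sub_le_iff_le_add.2 (by omega))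
      omega
    · have : (t / k + 1) * k ≤ (u / k + 5) * k := Nat.mul_le_mul_right k (by omega)
      rw [Nat.succ_mul] at this
      omega
  refine (Finset.card_le_card hsub).trans ((Finset.card_biUnion_le_card_mul _ _ (9 * k)
    fun u _ => ?_).trans (Nat.mul_le_mul_right _ ?_))
  · rw [Nat.card_Ico, ← Nat.sub_mul]
    exact Nat.mul_le_mul_right k (by omega)
  · exact (Finset.card_insert_le _ _).trans (Nat.succ_le_succ (Finset.card_insert_le _ _))

/-- A bound `k * r` for the sums over the isolated blocks of length `k` is a bound `r` per point, up
to the points outside these blocks. -/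
lemma sum_le_of_blocks (T : ℕ) {k : ℕ} (hk : 0 < k) (s : Finset ℕ) (J : ℕ → ℝ≥0∞) {v r : ℝ≥0∞}
    (hv : ∀ t ∈ Finset.Ico 1 T \ s, J t ≤ v)
    (hB : ∀ m ∈ isolatedBlocks T k s, ∑ i ∈ Finset.range k, J (m * k + i) ≤ k * r) :
    ∑ t ∈ Finset.Ico 1 T \ s, J t ≤
      (Finset.Ico 1 T \ s).card * r + ((s.card + 2) * (9 * k) : ℕ) * v := by
  have hsub := isolatedPoints_subset T k s
  rw [← Finset.sum_sdiff hsub, add_comm]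
  refine add_le_add ?_ ?_
  · rw [sum_isolatedPoints]
    calc _ ≤ ∑ m ∈ isolatedBlocks T k s, (k * r : ℝ≥0∞) := Finset.sum_le_sum hB
      _ = ((isolatedPoints T k s).card : ℝ≥0∞) * r := by
        rw [card_isolatedPoints, Finset.sum_const, nsmul_eq_mul]; push_cast; ring
      _ ≤ _ := mul_le_mul_left (Nat.cast_le.2 (Finset.card_le_card hsub)) _
  · calc _ ≤ ∑ t ∈ (Finset.Ico 1 T \ s) \ isolatedPoints T k s, v :=
          Finset.sum_le_sum fun t ht => hv t (Finset.sdiff_subset ht)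
      _ = (((Finset.Ico 1 T \ s) \ isolatedPoints T k s).card : ℝ≥0∞) * v := by
        rw [Finset.sum_const, nsmul_eq_mul]
      _ ≤ _ := mul_le_mul_left (Nat.cast_le.2 (card_sdiff_isolatedPoints T hk s)) _

lemma le_sum_of_blocks (T : ℕ) {k : ℕ} (hk : 0 < k) (s : Finset ℕ) (J : ℕ → ℝ≥0∞) {r : ℝ≥0∞}
    (hB : ∀ m ∈ isolatedBlocks T k s, k * r ≤ ∑ i ∈ Finset.range k, J (m * k + i)) :
    (Finset.Ico 1 T \ s).card * r ≤
      ∑ t ∈ Finset.Ico 1 T \ s, J t + ((s.card + 2) * (9 * k) : ℕ) * r := by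
  have hsub := isolatedPoints_subset T k s
  have hcard : (Finset.Ico 1 T \ s).card ≤
      (isolatedPoints T k s).card + (s.card + 2) * (9 * k) := by
    have h1 := Finset.card_sdiff_add_card_eq_card hsub
    have h2 := card_sdiff_isolatedPoints T hk s
    omega
  calc ((Finset.Ico 1 T \ s).card : ℝ≥0∞) * r
      ≤ (((isolatedPoints T k s).card + (s.card + 2) * (9 * k) : ℕ) : ℝ≥0∞) * r :=
        mul_le_mul_left (Nat.cast_le.2 hcard) _
    _ = ((isolatedPoints T k s).card : ℝ≥0∞) * r + ((s.card + 2) * (9 * k) : ℕ) * r := by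
        push_cast; ring
    _ ≤ _ := by
        refine add_le_add ?_ le_rfl
        calc ((isolatedPoints T k s).card : ℝ≥0∞) * r
            = ∑ m ∈ isolatedBlocks T k s, (k * r : ℝ≥0∞) := by
              rw [card_isolatedPoints, Finset.sum_const, nsmul_eq_mul]; push_cast; ring
          _ ≤ ∑ t ∈ isolatedPoints T k s, J t := by
              rw [sum_isolatedPoints]; exact Finset.sum_le_sum hB
          _ ≤ _ := Finset.sum_le_sum_of_subset hsub

/-! ### Change-points that are estimated once -/

/-- In an isolated block, the radius in the definition of `κ` is larger than twice the block
length. -/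
lemma lt_radius {T k m : ℕ} {s : Finset ℕ} (hm : m ∈ isolatedBlocks T k s) {i : ℕ} (hi : i < k) :
    (2 * k : ℝ) < 1 / 2 * min ((nextPoint T (insert (m * k + i) s) (m * k + i) : ℝ) - (m * k + i : ℕ))
      (((m * k + i : ℕ) : ℝ) - (prevPoint (insert (m * k + i) s) (m * k + i) : ℝ)) := by
  set t := m * k + i
  have hsep : ∀ u ∈ (insert 0 (insert T s) : Finset ℕ), u + 4 * k < t ∨ t + 4 * k < u := fun u hu =>
    lt_of_mem_isolatedBlocks hm hi hu
  have htT : t < T := (mul_add_lt_of_mem_isolatedBlocks hm hi).2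
  have hnext : t + 4 * k < nextPoint T (insert t s) t := by
    have hmem : nextPoint T (insert t s) t ∈ {u | t < u ∧ u ∈ insert T (insert t s)} :=
      Nat.sInf_mem ⟨T, htT, Finset.mem_insert_self _ _⟩
    obtain ⟨h1, h2⟩ := hmem
    have h3 : nextPoint T (insert t s) t ∈ insert 0 (insert T s) := by
      simp only [Finset.mem_insert] at h2 ⊢
      rcases h2 with h2 | h2 | h2
      · exact Or.inr (Or.inl h2)
      · omega
      · exact Or.inr (Or.inr h2)
    have := hsep _ h3
    omega
  have hprev : prevPoint (insert t s) t + 4 * k < t := by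
    have h0 := hsep 0 (Finset.mem_insert_self _ _)
    have : prevPoint (insert t s) t < t - 4 * k := by
      rw [prevPoint, Finset.sup_lt_iff (by rw [Nat.bot_eq_zero]; omega)]
      intro u hu
      rw [Finset.mem_filter, Finset.mem_insert] at hu
      have hus : u ∈ s := by
        rcases hu.1 with h | h
        · omega
        · exact h
      have := hsep u (Finset.mem_insert_of_mem (Finset.mem_insert_of_mem hus))
      simp only [id]; omega
    omega
  have h1 : (t : ℝ) + 4 * k < nextPoint T (insert t s) t := by exact_mod_cast hnext
  have h2 : (prevPoint (insert t s) t : ℝ) + 4 * k < t := by exact_mod_cast hprev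
  have h3 : (4 * k : ℝ) < min ((nextPoint T (insert t s) t : ℝ) - (t : ℝ))
      ((t : ℝ) - (prevPoint (insert t s) t : ℝ)) := lt_min (by linarith) (by linarith)
  linarith

/-- A change-point `t` with `κ(t) = 1` in an isolated block of length `k` has at most one estimate
at a distance of at most `2 k`. -/
lemma eq_of_kappa_eq_one {T k m : ℕ} {s shat : Finset ℕ} (hm : m ∈ isolatedBlocks T k s) {i : ℕ}
    (hi : i < k) (hκ : kappa T (insert (m * k + i) s) shat (m * k + i) = 1) {u v : ℕ}
    (hu : u ∈ shat) (hv : v ∈ shat)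
    (hu1 : u ≤ m * k + i + 2 * k) (hu2 : m * k + i ≤ u + 2 * k)
    (hv1 : v ≤ m * k + i + 2 * k) (hv2 : m * k + i ≤ v + 2 * k) : u = v := by
  have hr := lt_radius hm hi
  set t := m * k + i
  have hnear : ∀ u : ℕ, u ≤ t + 2 * k → t ≤ u + 2 * k → |(t : ℝ) - (u : ℝ)| ≤ 2 * k := by
    intro u h1 h2
    have h1' : (u : ℝ) ≤ t + 2 * k := by exact_mod_cast h1
    have h2' : (t : ℝ) ≤ u + 2 * k := by exact_mod_cast h2
    exact abs_le.2 ⟨by linarith, by linarith⟩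
  rw [kappa, Finset.card_eq_one] at hκ
  obtain ⟨a, ha⟩ := hκ
  have h1 : u ∈ ({a} : Finset ℕ) := by
    rw [← ha, Finset.mem_filter]; exact ⟨hu, (hnear u hu1 hu2).trans_lt hr⟩
  have h2 : v ∈ ({a} : Finset ℕ) := by
    rw [← ha, Finset.mem_filter]; exact ⟨hv, (hnear v hv1 hv2).trans_lt hr⟩
  rw [Finset.mem_singleton.1 h1, Finset.mem_singleton.1 h2]

lemma ind_of_true {p : Prop} (h : p) : ind p = 1 := if_pos h

lemma ind_of_false {p : Prop} (h : ¬ p) : ind p = 0 := if_neg h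

lemma ind_le_one (p : Prop) : ind p ≤ 1 := by
  unfold ind; split_ifs <;> simp

/-- At most one point of an isolated block is an estimate that is the only one near it. -/
lemma sum_ind_exact_le_one {T k m : ℕ} {s : Finset ℕ} (hm : m ∈ isolatedBlocks T k s)
    (shat : Finset ℕ) :
    ∑ i ∈ Finset.range k, ind (m * k + i ∈ shat ∧
      kappa T (insert (m * k + i) s) shat (m * k + i) = 1) ≤ 1 := by
  by_cases h : ∃ i ∈ Finset.range k, m * k + i ∈ shat ∧
      kappa T (insert (m * k + i) s) shat (m * k + i) = 1
  · obtain ⟨i, hi, h1, h2⟩ := h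
    have hi' := Finset.mem_range.1 hi
    rw [Finset.sum_eq_single_of_mem i hi fun i' hi' hne => ind_of_false fun h' => hne ?_]
    · exact ind_le_one _
    · have := Finset.mem_range.1 hi'
      have := eq_of_kappa_eq_one hm (Finset.mem_range.1 hi) h2 h1 h'.1 (by omega) (by omega)
        (by omega) (by omega)
      omega
  · rw [Finset.sum_eq_zero fun i hi => ind_of_false fun h' => h ⟨i, hi, h'⟩]
    exact zero_le_one

lemma ofReal_abs_sub (u t : ℕ) :
    ENNReal.ofReal |(u : ℝ) - (t : ℝ)| = ((((u : ℤ) - t).natAbs : ℕ) : ℝ≥0∞) := by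
  rw [← ENNReal.ofReal_natCast]
  congr 1
  rw [Nat.cast_natAbs]
  push_cast
  rfl

/-- The estimates determine a single point of an isolated block which is, for all `t` of the block
with `κ(t) = 1`, at least as close to `t` as the estimates are. -/
lemma exists_estimate_in_block {T n m : ℕ} {s : Finset ℕ} (hm : m ∈ isolatedBlocks T (n + 1) s)
    (shat : Finset ℕ) : ∃ u ≤ n, ∀ i ≤ n,
      kappa T (insert (m * (n + 1) + i) s) shat (m * (n + 1) + i) = 1 →
      ((((i : ℤ) - u).natAbs : ℕ) : ℝ≥0∞) ≤ distTo (m * (n + 1) + i) shat := by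
  set w := m * (n + 1)
  have huniq : ∀ i ≤ n, kappa T (insert (w + i) s) shat (w + i) = 1 → ∀ u ∈ shat, ∀ v ∈ shat,
      u ≤ w + i + 2 * (n + 1) → w + i ≤ u + 2 * (n + 1) → v ≤ w + i + 2 * (n + 1) →
      w + i ≤ v + 2 * (n + 1) → u = v := fun i hi hκ u hu v hv =>
    eq_of_kappa_eq_one hm (by omega) hκ hu hv
  -- The point is an estimate in the block if there is one. Otherwise it is the first point of the
  -- block if there is an estimate at most a block length before the block, which then excludes
  -- estimates just after the block, and else it is the last point of the block.
  by_cases hA : ∃ v ∈ shat, w ≤ v ∧ v ≤ w + n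
  · obtain ⟨v, hv, hv1, hv2⟩ := hA
    refine ⟨v - w, by omega, fun i hi hκ => le_iInf₂ fun u hu => ?_⟩
    rw [ofReal_abs_sub]
    refine Nat.cast_le.2 ?_
    have := huniq i hi hκ u hu v hv
    by_cases hnear : u ≤ w + i + 2 * (n + 1) ∧ w + i ≤ u + 2 * (n + 1)
    · have := this hnear.1 hnear.2 (by omega) (by omega)
      omega
    · omega
  · push Not at hA
    by_cases hB : ∃ v ∈ shat, w ≤ v + (n + 1) ∧ v < w
    · obtain ⟨v, hv, hv1, hv2⟩ := hB
      refine ⟨0, by omega, fun i hi hκ => le_iInf₂ fun u hu => ?_⟩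
      rw [ofReal_abs_sub]
      refine Nat.cast_le.2 ?_
      have h1 := huniq i hi hκ u hu v hv
      have h2 := hA u hu
      by_cases hnear : w ≤ u ∧ u ≤ w + i + 2 * (n + 1)
      · have := h1 hnear.2 (by omega) (by omega) (by omega)
        omega
      · omega
    · push Not at hB
      refine ⟨n, le_rfl, fun i hi hκ => le_iInf₂ fun u hu => ?_⟩
      rw [ofReal_abs_sub]
      refine Nat.cast_le.2 ?_
      have h1 := hB u hu
      have h2 := hA u hu
      omega

/-! ### Sums over the change-points -/

/-- The set of change-points that the algorithm estimates from the data `y`. -/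
abbrev estimateOf {T : ℕ} (A : Algorithm T) (y : Finset.Icc 1 T → ℝ) : Finset ℕ :=
  points T (A.Yhat y)

lemma measurable_comp_estimateOf {T : ℕ} (A : Algorithm T) {α : Type*} [MeasurableSpace α]
    {g : α → Finset.Icc 1 T → ℝ} (hg : Measurable g) {f : Finset ℕ → α → ℝ≥0∞}
    (hf : ∀ s, Measurable (f s)) : Measurable fun a => f (estimateOf A (g a)) a := by
  have hms : ∀ s ∈ (Finset.Ico 1 T).powerset, MeasurableSet {a | estimateOf A (g a) = s} := by
    intro s hs
    have : {a | estimateOf A (g a) = s} =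
        ⋂ t ∈ Finset.Ico 1 T, {a | A.Yhat (g a) t = decide (t ∈ s)} := by
      ext a
      refine (changePoints_eq_iff (Y := fun t a => A.Yhat (g a) t) (ω := a)
        (Finset.mem_powerset.1 hs)).trans ?_
      simp only [Set.mem_iInter, Set.mem_ofPred_eq]
      refine forall₂_congr fun t _ => ?_
      by_cases hts : t ∈ s <;> simp [hts]
    rw [this]
    exact Finset.measurableSet_biInter _ fun t ht =>
      ((A.measurable_Yhat t ht).comp hg) (measurableSet_singleton (decide (t ∈ s)))
  have : (fun a => f (estimateOf A (g a)) a) = fun a =>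
      ∑ s ∈ (Finset.Ico 1 T).powerset, {a | estimateOf A (g a) = s}.indicator (f s) a := by
    ext a
    rw [Finset.sum_eq_single_of_mem (estimateOf A (g a))
      (Finset.mem_powerset.2 (Finset.filter_subset _ _))]
    · exact (Set.indicator_of_mem (s := {b | estimateOf A (g b) = estimateOf A (g a)}) rfl _).symm
    · intro s _ hs
      exact Set.indicator_of_notMem (s := {b | estimateOf A (g b) = s}) (fun h => hs h.symm) _
  rw [this]
  exact Finset.measurable_sum _ fun s hs => (hf s).indicator (hms s hs)

/-- A pair of a set and a point of it is the same as a set together with a further point. -/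
lemma sum_powerset_sum_mem {M : Type*} [AddCommMonoid M] (I : Finset ℕ) (g : Finset ℕ → ℕ → M) :
    ∑ s ∈ I.powerset, ∑ t ∈ s, g s t = ∑ s ∈ I.powerset, ∑ t ∈ I \ s, g (insert t s) t := by
  rw [Finset.sum_sigma', Finset.sum_sigma']
  refine Finset.sum_bij' (fun p _ => ⟨p.1.erase p.2, p.2⟩) (fun p _ => ⟨insert p.2 p.1, p.2⟩)
    ?_ ?_ ?_ ?_ ?_
  · rintro ⟨s, t⟩ h
    simp only [Finset.mem_sigma, Finset.mem_powerset, Finset.mem_sdiff] at h ⊢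
    exact ⟨(Finset.erase_subset _ _).trans h.1, h.1 h.2, Finset.notMem_erase _ _⟩
  · rintro ⟨s, t⟩ h
    simp only [Finset.mem_sigma, Finset.mem_powerset, Finset.mem_sdiff] at h ⊢
    exact ⟨Finset.insert_subset h.2.1 h.1, Finset.mem_insert_self _ _⟩
  · rintro ⟨s, t⟩ h
    simp only [Finset.mem_sigma] at h
    simp only [Finset.insert_erase h.2]
  · rintro ⟨s, t⟩ h
    simp only [Finset.mem_sigma, Finset.mem_sdiff] at h
    simp only [Finset.erase_insert h.2.2]
  · rintro ⟨s, t⟩ h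
    simp only [Finset.mem_sigma] at h
    simp only [Finset.insert_erase h.2]

section Select

variable {Ω : Type*} [MeasurableSpace Ω] {P : Measure Ω} {T : ℕ}
  {q σ : ℝ} {F : Measure ℝ} {Y : ℕ → Ω → Bool} {Δ μ X : ℕ → Ω → ℝ}

/-- The mean loss at the change-point `t`, on the event that `s` is the set of change-points. The
loss is a function of the change-points, the selected change-point, the estimates and the jump. -/
noncomputable def lossAt (P : Measure Ω) (Y : ℕ → Ω → Bool) (Δ X : ℕ → Ω → ℝ)
    (A : Algorithm T) (φ : Finset ℕ → ℕ → Finset ℕ → ℝ → ℝ≥0∞) (s : Finset ℕ) (t : ℕ) : ℝ≥0∞ :=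
  ∫⁻ ω in {ω | changePoints T Y ω = s}, φ s t (A.estimate X ω) (Δ t ω) ∂P

/-- The probability that there are change-points. -/
noncomputable def probSome (P : Measure Ω) (T : ℕ) (Y : ℕ → Ω → Bool) : ℝ≥0∞ :=
  P {ω | 1 ≤ (changePoints T Y ω).card}

lemma measurable_loss (h : IsModel P T q σ F Y Δ μ X) (A : Algorithm T) {f : Finset ℕ → ℝ → ℝ≥0∞}
    (hf : ∀ shat, Measurable (f shat)) {t : ℕ} (ht : t ∈ Finset.Ico 1 T) :
    Measurable fun ω => f (A.estimate X ω) (Δ t ω) :=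
  measurable_comp_estimateOf A (g := fun ω u => X u ω)
    (f := fun shat ω => f shat (Δ t ω))
    (measurable_pi_lambda _ fun u => h.measurable_obs u u.2)
    fun shat => (hf shat).comp (h.measurable_jump t ht)

lemma setLIntegral_loss (h : IsModel P T q σ F Y Δ μ X) (A : Algorithm T)
    {φ : Finset ℕ → ℕ → Finset ℕ → ℝ → ℝ≥0∞} (hφ : ∀ s t shat, Measurable (φ s t shat)) :
    ∫⁻ ω in {ω | 1 ≤ (changePoints T Y ω).card}, (∑ t ∈ changePoints T Y ω,
        φ (changePoints T Y ω) t (A.estimate X ω) (Δ t ω)) / ((changePoints T Y ω).card : ℝ≥0∞) ∂P =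
      ∑ s ∈ (Finset.Ico 1 T).powerset, ∑ t ∈ s, lossAt P Y Δ X A φ s t / (s.card : ℝ≥0∞) := by
  have hset : {ω | 1 ≤ (changePoints T Y ω).card} =
      ⋃ s ∈ (Finset.Ico 1 T).powerset.filter fun s => 1 ≤ s.card, {ω | changePoints T Y ω = s} := by
    ext ω
    simp only [Set.mem_ofPred_eq, Set.mem_iUnion, exists_prop, exists_eq_right', Finset.mem_filter,
      Finset.mem_powerset]
    exact ⟨fun h => ⟨Finset.filter_subset _ _, h⟩, fun h => h.2⟩
  have hdisj : Set.PairwiseDisjoint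
      (((Finset.Ico 1 T).powerset.filter fun s => 1 ≤ s.card : Finset (Finset ℕ)) :
        Set (Finset ℕ)) (fun s => {ω | changePoints T Y ω = s}) := fun s _ s' _ hne =>
    Set.disjoint_left.2 fun ω h h' => hne ((show changePoints T Y ω = s from h).symm.trans h')
  rw [hset, lintegral_biUnion_finset hdisj (fun s _ => measurableSet_changePoints h s)]
  rw [Finset.sum_filter]
  refine Finset.sum_congr rfl fun s hs => ?_
  split_ifs with hcard
  · have hI : ∀ t ∈ s, t ∈ Finset.Ico 1 T := fun t ht => Finset.mem_powerset.1 hs ht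
    have hm : ∀ t ∈ s, Measurable fun ω => φ s t (A.estimate X ω) (Δ t ω) := fun t ht =>
      measurable_loss h A (hφ s t) (hI t ht)
    calc _ = ∫⁻ ω in {ω | changePoints T Y ω = s},
          (∑ t ∈ s, φ s t (A.estimate X ω) (Δ t ω)) * (s.card : ℝ≥0∞)⁻¹ ∂P := by
          refine setLIntegral_congr_fun (measurableSet_changePoints h s) fun ω hω => ?_
          have hω' : changePoints T Y ω = s := hω
          simp only [hω', div_eq_mul_inv]
      _ = _ := by
          rw [lintegral_mul_const _ (Finset.measurable_sum _ hm), lintegral_finsetSum' _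
            fun t ht => (hm t ht).aemeasurable, Finset.sum_mul]
          rfl
  · have : s = ∅ := Finset.card_eq_zero.1 (by omega)
    subst this
    simp

lemma probSome_eq (h : IsModel P T q σ F Y Δ μ X) (A : Algorithm T) : probSome P T Y =
    ∑ s ∈ (Finset.Ico 1 T).powerset, ∑ _t ∈ s, P {ω | changePoints T Y ω = s} / (s.card : ℝ≥0∞) := by
  have hms : MeasurableSet {ω | 1 ≤ (changePoints T Y ω).card} := by
    have : {ω | 1 ≤ (changePoints T Y ω).card} = {ω | changePoints T Y ω = ∅}ᶜ := by
      ext ω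
      simp only [Set.mem_ofPred_eq, Set.mem_compl_iff, Nat.one_le_iff_ne_zero, ne_eq,
        Finset.card_eq_zero]
    rw [this]
    exact (measurableSet_changePoints h ∅).compl
  have h1 := setLIntegral_loss h A (φ := fun _ _ _ _ => 1) fun _ _ _ => measurable_const
  simp only [lossAt, setLIntegral_one] at h1
  rw [← h1, probSome, ← setLIntegral_one]
  refine setLIntegral_congr_fun hms fun ω hω => ?_
  have hω' : 1 ≤ (changePoints T Y ω).card := hω
  simp only [Finset.sum_const, nsmul_eq_mul, mul_one]
  rw [ENNReal.div_self (by simpa using Nat.one_le_iff_ne_zero.1 hω') (ENNReal.natCast_ne_top _)]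

lemma selectE_eq (h : IsModel P T q σ F Y Δ μ X) (A : Algorithm T)
    {φ : Finset ℕ → ℕ → Finset ℕ → ℝ → ℝ≥0∞} (hφ : ∀ s t shat, Measurable (φ s t shat)) :
    selectE P (changePoints T Y)
        (fun ω t => φ (changePoints T Y ω) t (A.estimate X ω) (Δ t ω)) =
      (probSome P T Y)⁻¹ *
        ∑ s ∈ (Finset.Ico 1 T).powerset, ∑ t ∈ s, lossAt P Y Δ X A φ s t / (s.card : ℝ≥0∞) := by
  rw [selectE, ProbabilityTheory.cond, lintegral_smul_measure, setLIntegral_loss h A hφ]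
  rfl

/-! ### The mean loss over a block -/

lemma measurable_lintegral_shiftLaw {β : Type*} [MeasurableSpace β] {b : β → ℕ → ℝ}
    (hb : ∀ u, Measurable fun a => b a u) {d : β → ℝ} (hd : Measurable d) (t : ℕ)
    {Ψ : β → (Finset.Icc 1 T → ℝ) → ℝ≥0∞} (hΨ : Measurable (Function.uncurry Ψ)) :
    Measurable fun a => ∫⁻ y, Ψ a y ∂(shiftLaw T (b a) (d a) σ t) := by
  have : (fun a => ∫⁻ y, Ψ a y ∂(shiftLaw T (b a) (d a) σ t)) = fun a =>
      ∫⁻ e, Ψ a (fun u : Finset.Icc 1 T => (b a u + if t < (u : ℕ) then d a else 0) + e u)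
        ∂(Measure.pi fun _ : Finset.Icc 1 T => gaussianReal 0 (σ ^ 2).toNNReal) := by
    ext a
    exact (lintegral_pi_gaussian_add
      (fun u : Finset.Icc 1 T => b a u + if t < (u : ℕ) then d a else 0) _
      (hΨ.comp (measurable_prodMk_left (x := a)))).symm
  rw [this]
  suffices hshift : Measurable fun p : β × (Finset.Icc 1 T → ℝ) => fun u : Finset.Icc 1 T =>
      (b p.1 u + if t < (u : ℕ) then d p.1 else 0) + p.2 u from
    (hΨ.comp (measurable_fst.prodMk hshift)).lintegral_prod_right'
  refine measurable_pi_lambda _ fun u => ?_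
  have h1 : Measurable fun p : β × (Finset.Icc 1 T → ℝ) => b p.1 u := (hb u).comp measurable_fst
  have h2 : Measurable fun p : β × (Finset.Icc 1 T → ℝ) => d p.1 := hd.comp measurable_fst
  have h3 : Measurable fun p : β × (Finset.Icc 1 T → ℝ) => p.2 u :=
    (measurable_pi_apply u).comp measurable_snd
  split_ifs
  · exact (h1.add h2).add h3
  · exact (h1.add measurable_const).add h3

/-- Given all the change-points except one that is in a given isolated block, the observations
form a sequence with a single level shift, whose law `shiftLaw` is averaged over the levels and
the other jumps. -/
lemma exists_shift_model [IsProbabilityMeasure P] (h : IsModel P T q σ F Y Δ μ X) (hF : F {0} = 0)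
    (hq0 : 0 < q) (hq1 : q < 1) (A : Algorithm T) {s : Finset ℕ} (hs : s ⊆ Finset.Ico 1 T)
    {n m : ℕ} (hm : m ∈ isolatedBlocks T (n + 1) s) :
    ∃ (N : ℕ) (L : Measure (ℝ × (Fin N → ℝ))) (j : Fin N) (b : ℝ × (Fin N → ℝ) → ℕ → ℝ),
      L.map (fun a => a.2 j) = F ∧
      ∀ f : Finset ℕ → ℝ → ℝ≥0∞, (∀ shat, Measurable (f shat)) → ∀ i ≤ n,
        Measurable (fun a => ∫⁻ y, f (estimateOf A y) (a.2 j)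
          ∂(shiftLaw T (b a) (a.2 j) σ (m * (n + 1) + i))) ∧
        ∫⁻ ω in {ω | changePoints T Y ω = insert (m * (n + 1) + i) s},
            f (A.estimate X ω) (Δ (m * (n + 1) + i) ω) ∂P =
          setWeight q (T - 1) (s.card + 1) * ∫⁻ a, ∫⁻ y, f (estimateOf A y) (a.2 j)
            ∂(shiftLaw T (b a) (a.2 j) σ (m * (n + 1) + i)) ∂L := by
  set w := m * (n + 1)
  have hsep : ∀ i ≤ n, w + i ∈ Finset.Ico 1 T \ s := fun i hi => by
    refine isolatedPoints_subset T (n + 1) s (Finset.mem_image.2 ⟨(m, i), ?_, rfl⟩)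
    exact Finset.mem_product.2 ⟨hm, Finset.mem_range.2 (by omega)⟩
  have hsub : ∀ i ≤ n, insert (w + i) s ⊆ Finset.Ico 1 T := fun i hi =>
    Finset.insert_subset (Finset.mem_sdiff.1 (hsep i hi)).1 hs
  have hcard : ∀ i ≤ n, (insert (w + i) s).card = s.card + 1 := fun i hi =>
    Finset.card_insert_of_notMem (Finset.mem_sdiff.1 (hsep i hi)).2
  have hT : 1 ≤ T := by
    have := Finset.mem_Ico.1 (hsub 0 n.zero_le (Finset.mem_insert_self _ _)); omega
  have hprob : ∀ i ≤ n, P {ω | changePoints T Y ω = insert (w + i) s} =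
      setWeight q (T - 1) (s.card + 1) := fun i hi => by
    rw [prob_changePoints h hq0 (hsub i hi), hcard i hi]
  obtain ⟨j, e, hje⟩ := exists_rank (s' := s) (w := w) (n := n) (fun u hu => by
    have := lt_of_mem_isolatedBlocks hm (Nat.succ_pos n)
      (Finset.mem_insert_of_mem (Finset.mem_insert_of_mem hu))
    omega) hcard
  let b : ℝ × (Fin (s.card + 1) → ℝ) → ℕ → ℝ := fun a u =>
    a.1 + ∑ j' ∈ Finset.univ.erase j, if e j' < u then a.2 j' else 0
  have hb : ∀ u, Measurable fun a => b a u := fun u => by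
    refine measurable_fst.add (Finset.measurable_sum _ fun i _ => ?_)
    split_ifs <;> fun_prop
  have hd : Measurable fun a : ℝ × (Fin (s.card + 1) → ℝ) => a.2 j := by fun_prop
  refine ⟨s.card + 1, _, j, b, map_jump h hT (hsub 0 n.zero_le) (hcard 0 n.zero_le) j,
    fun f hf i hi => ?_⟩
  have hΨ : Measurable (Function.uncurry fun (a : ℝ × (Fin (s.card + 1) → ℝ))
      (y : Finset.Icc 1 T → ℝ) => f (estimateOf A y) (a.2 j)) :=
    measurable_comp_estimateOf A
      (f := fun shat (p : (ℝ × (Fin (s.card + 1) → ℝ)) × (Finset.Icc 1 T → ℝ)) => f shat (p.1.2 j))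
      measurable_snd fun shat => (hf shat).comp (by fun_prop)
  refine ⟨measurable_lintegral_shiftLaw hb hd _ hΨ, ?_⟩
  have hne : P {ω | changePoints T Y ω = insert (w + i) s} ≠ 0 := by
    rw [hprob i hi]; exact setWeight_ne_zero hq0 hq1 _ _
  have key := setLIntegral_startAndJumps_obs h hF hT (hsub i hi) (hcard i hi) hne hΨ
  rw [hprob i hi] at key
  have hlaw := h.level_law _ _ _ (hcard 0 n.zero_le) (hcard i hi) (hsub 0 n.zero_le) (hsub i hi)
  have hleft : ∀ ω, (startAndJumps μ Δ (insert (w + i) s) (hcard i hi) ω).2 j = Δ (w + i) ω :=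
    fun ω => by simp only [startAndJumps, (hje i hi).1]
  simp only [hleft] at key
  refine key.trans ?_
  rw [hlaw]
  congr 1
  refine lintegral_congr fun a => ?_
  rw [shiftLaw]
  simp only [meanVec_insert (hcard i hi) (hje i hi).1 (hje i hi).2, b]

lemma sum_lossAt_block_le [IsProbabilityMeasure P] (h : IsModel P T q σ F Y Δ μ X)
    (hF : F {0} = 0) (hσ : 0 < σ) (hq0 : 0 < q) (hq1 : q < 1) (A : Algorithm T) {s : Finset ℕ}
    (hs : s ⊆ Finset.Ico 1 T) {n m : ℕ} (hm : m ∈ isolatedBlocks T (n + 1) s)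
    {φ : Finset ℕ → ℕ → Finset ℕ → ℝ → ℝ≥0∞} (hφ : ∀ s t shat, Measurable (φ s t shat))
    (hφ1 : ∀ shat δ, ∑ i ∈ Finset.range (n + 1),
      φ (insert (m * (n + 1) + i) s) (m * (n + 1) + i) shat δ ≤ 1) :
    ∑ i ∈ Finset.range (n + 1),
        lossAt P Y Δ X A φ (insert (m * (n + 1) + i) s) (m * (n + 1) + i) ≤
      setWeight q (T - 1) (s.card + 1) * ∫⁻ x, exactRisk n (x / σ) ∂F := by
  obtain ⟨N, L, j, b, hL, hblock⟩ := exists_shift_model h hF hq0 hq1 A hs hm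
  have hi : ∀ i ∈ Finset.range (n + 1), i ≤ n := fun i hi => by
    have := Finset.mem_range.1 hi; omega
  have hwT := mul_add_lt_of_mem_isolatedBlocks hm (Nat.lt_succ_self n)
  calc _ = setWeight q (T - 1) (s.card + 1) * ∫⁻ a, ∑ i ∈ Finset.range (n + 1),
        ∫⁻ y, φ (insert (m * (n + 1) + i) s) (m * (n + 1) + i) (estimateOf A y) (a.2 j)
          ∂(shiftLaw T (b a) (a.2 j) σ (m * (n + 1) + i)) ∂L := by
        rw [lintegral_finsetSum' _ fun i hi' =>
          (hblock _ (hφ (insert (m * (n + 1) + i) s) (m * (n + 1) + i)) i (hi i hi')).1.aemeasurable,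
          Finset.mul_sum]
        exact Finset.sum_congr rfl fun i hi' => (hblock _ (hφ _ _) i (hi i hi')).2
    _ ≤ setWeight q (T - 1) (s.card + 1) * ∫⁻ a, exactRisk n (a.2 j / σ) ∂L := by
        gcongr with a
        exact sum_lintegral_shiftLaw_le (b a) (a.2 j) hσ hwT.1 hwT.2.le
          (fun i y => φ (insert (m * (n + 1) + i) s) (m * (n + 1) + i) (estimateOf A y) (a.2 j))
          (fun i => measurable_comp_estimateOf A measurable_id
            (f := fun shat _ => φ (insert (m * (n + 1) + i) s) (m * (n + 1) + i) shat (a.2 j))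
            fun _ => measurable_const)
          fun y => hφ1 _ _
    _ = _ := by
        have hE : Measurable fun x => exactRisk n (x / σ) :=
          (measurable_exactRisk n).comp (by fun_prop)
        rw [← hL, lintegral_map hE (by fun_prop)]

lemma le_sum_lossAt_block [IsProbabilityMeasure P] (h : IsModel P T q σ F Y Δ μ X)
    (hF : F {0} = 0) (hσ : 0 < σ) (hq0 : 0 < q) (hq1 : q < 1) (A : Algorithm T) {s : Finset ℕ}
    (hs : s ⊆ Finset.Ico 1 T) {n m : ℕ} (hm : m ∈ isolatedBlocks T (n + 1) s)
    {φ : Finset ℕ → ℕ → Finset ℕ → ℝ → ℝ≥0∞} (hφ : ∀ s t shat, Measurable (φ s t shat))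
    {D : Set ℝ} (hD : MeasurableSet D)
    (hφ1 : ∀ shat, ∀ δ ∈ D, ∃ u ≤ n, ∀ i ≤ n, ((((i : ℤ) - u).natAbs : ℕ) : ℝ≥0∞) ≤
      φ (insert (m * (n + 1) + i) s) (m * (n + 1) + i) shat δ) :
    setWeight q (T - 1) (s.card + 1) * ∫⁻ x in D, medianRisk n (x / σ) ∂F ≤
      ∑ i ∈ Finset.range (n + 1),
        lossAt P Y Δ X A φ (insert (m * (n + 1) + i) s) (m * (n + 1) + i) := by
  obtain ⟨N, L, j, b, hL, hblock⟩ := exists_shift_model h hF hq0 hq1 A hs hm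
  have hi : ∀ i ∈ Finset.range (n + 1), i ≤ n := fun i hi => by
    have := Finset.mem_range.1 hi; omega
  have hwT := mul_add_lt_of_mem_isolatedBlocks hm (Nat.lt_succ_self n)
  have hj : Measurable fun a : ℝ × (Fin N → ℝ) => a.2 j := by fun_prop
  calc setWeight q (T - 1) (s.card + 1) * ∫⁻ x in D, medianRisk n (x / σ) ∂F
      = setWeight q (T - 1) (s.card + 1) *
          ∫⁻ a in (fun a => a.2 j) ⁻¹' D, medianRisk n (a.2 j / σ) ∂L := by
        have hE : Measurable fun x => medianRisk n (x / σ) :=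
          (measurable_medianRisk n).comp (by fun_prop)
        rw [← hL, setLIntegral_map hD hE hj]
    _ ≤ setWeight q (T - 1) (s.card + 1) * ∫⁻ a in (fun a => a.2 j) ⁻¹' D,
          ∑ i ∈ Finset.range (n + 1), ∫⁻ y, φ (insert (m * (n + 1) + i) s) (m * (n + 1) + i)
            (estimateOf A y) (a.2 j) ∂(shiftLaw T (b a) (a.2 j) σ (m * (n + 1) + i)) ∂L := by
        refine mul_le_mul_right (setLIntegral_mono' (hj hD) fun a ha => ?_) _
        exact le_sum_lintegral_shiftLaw (b a) (a.2 j) hσ hwT.1 hwT.2.le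
          (fun i y => φ (insert (m * (n + 1) + i) s) (m * (n + 1) + i) (estimateOf A y) (a.2 j))
          (fun i => measurable_comp_estimateOf A measurable_id
            (f := fun shat _ => φ (insert (m * (n + 1) + i) s) (m * (n + 1) + i) shat (a.2 j))
            fun _ => measurable_const)
          fun y => hφ1 _ _ ha
    _ ≤ setWeight q (T - 1) (s.card + 1) * ∫⁻ a,
          ∑ i ∈ Finset.range (n + 1), ∫⁻ y, φ (insert (m * (n + 1) + i) s) (m * (n + 1) + i)
            (estimateOf A y) (a.2 j) ∂(shiftLaw T (b a) (a.2 j) σ (m * (n + 1) + i)) ∂L :=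
        mul_le_mul_right (setLIntegral_le_lintegral _ _) _
    _ = _ := by
        rw [lintegral_finsetSum' _ fun i hi' =>
          (hblock _ (hφ (insert (m * (n + 1) + i) s) (m * (n + 1) + i)) i (hi i hi')).1.aemeasurable,
          Finset.mul_sum]
        exact Finset.sum_congr rfl fun i hi' => (hblock _ (hφ _ _) i (hi i hi')).2.symm

end Select

/-! ### Bounds for sequences of fixed length -/

section Bounds

variable {Ω : Type*} [MeasurableSpace Ω] {P : Measure Ω} {T : ℕ}
  {q σ : ℝ} {F : Measure ℝ} {Y : ℕ → Ω → Bool} {Δ μ X : ℕ → Ω → ℝ}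

/-- The total loss over the sets of change-points, uniformly averaged over the change-points. -/
noncomputable def totalLoss (P : Measure Ω) (Y : ℕ → Ω → Bool) (Δ X : ℕ → Ω → ℝ)
    (A : Algorithm T) (φ : Finset ℕ → ℕ → Finset ℕ → ℝ → ℝ≥0∞) : ℝ≥0∞ :=
  ∑ s ∈ (Finset.Ico 1 T).powerset, ∑ t ∈ s, lossAt P Y Δ X A φ s t / (s.card : ℝ≥0∞)

/-- The sum, over the sets of change-points to which a point can be added, of the probabilities of
the set with a given point added. It bounds the contribution of the points near to other
change-points or to the end points. -/
noncomputable def addedMass (q : ℝ) (T : ℕ) : ℝ≥0∞ :=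
  ∑ s ∈ (Finset.Ico 1 T).powerset,
    if s = Finset.Ico 1 T then 0 else setWeight q (T - 1) (s.card + 1)

lemma addedMass_mul_le [IsProbabilityMeasure P] (h : IsModel P T q σ F Y Δ μ X) (hq : 0 < q) :
    addedMass q T * ENNReal.ofReal (1 - q) ≤ ENNReal.ofReal q := by
  have hdisj : Set.PairwiseDisjoint (((Finset.Ico 1 T).powerset : Finset (Finset ℕ)) :
        Set (Finset ℕ)) (fun s => {ω | changePoints T Y ω = s}) := fun s _ s' _ hne =>
    Set.disjoint_left.2 fun ω h h' => hne ((show changePoints T Y ω = s from h).symm.trans h')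
  calc addedMass q T * ENNReal.ofReal (1 - q)
      ≤ ∑ s ∈ (Finset.Ico 1 T).powerset,
          ENNReal.ofReal q * P {ω | changePoints T Y ω = s} := by
        rw [addedMass, Finset.sum_mul]
        refine Finset.sum_le_sum fun s hs => ?_
        rw [Finset.mem_powerset] at hs
        split_ifs with hI
        · simp
        · have hlt := Finset.card_lt_card (Finset.ssubset_iff_subset_ne.2 ⟨hs, hI⟩)
          rw [Nat.card_Ico] at hlt
          rw [setWeight_succ q hlt, prob_changePoints h hq hs]
    _ = ENNReal.ofReal q * P (⋃ s ∈ (Finset.Ico 1 T).powerset, {ω | changePoints T Y ω = s}) := by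
        rw [measure_biUnion_finset hdisj fun s _ => measurableSet_changePoints h s, Finset.mul_sum]
    _ ≤ ENNReal.ofReal q := mul_le_of_le_one_right' prob_le_one

lemma probSome_eq_ofReal [IsProbabilityMeasure P] (h : IsModel P T q σ F Y Δ μ X) (hq0 : 0 < q)
    (hq1 : q < 1) : probSome P T Y = ENNReal.ofReal (1 - (1 - q) ^ (T - 1)) := by
  have hset : {ω | 1 ≤ (changePoints T Y ω).card} = {ω | changePoints T Y ω = ∅}ᶜ := by
    ext ω
    simp only [Set.mem_ofPred_eq, Set.mem_compl_iff, Nat.one_le_iff_ne_zero, ne_eq,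
      Finset.card_eq_zero]
  rw [probSome, hset, prob_compl_eq_one_sub (measurableSet_changePoints h ∅),
    prob_changePoints h hq0 (Finset.empty_subset _), setWeight, Finset.card_empty, pow_zero,
    one_mul, Nat.sub_zero, ← ENNReal.ofReal_pow (by linarith), ENNReal.ofReal_sub _ (by
      have : 0 < 1 - q := by linarith
      positivity), ENNReal.ofReal_one]

lemma probSome_ne_zero [IsProbabilityMeasure P] (h : IsModel P T q σ F Y Δ μ X) (hq0 : 0 < q)
    (hq1 : q < 1) (hT : 2 ≤ T) : probSome P T Y ≠ 0 := by
  rw [probSome_eq_ofReal h hq0 hq1]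
  have : (1 - q) ^ (T - 1) < 1 := pow_lt_one₀ (by linarith) (by linarith) (by omega)
  simpa using this

lemma addedMass_div_probSome_le [IsProbabilityMeasure P] (h : IsModel P T q σ F Y Δ μ X)
    (hq0 : 0 < q) (hq1 : q < 1) (hT : 2 ≤ T) :
    addedMass q T / probSome P T Y ≤
      ENNReal.ofReal ((((T - 1 : ℕ) : ℝ)⁻¹ + q) / (1 - q)) := by
  have h1q : 0 < 1 - q := by linarith
  set N := T - 1
  have hN : (0 : ℝ) < N := by
    have : 0 < N := by omega
    exact_mod_cast this
  refine ENNReal.div_le_of_le_mul ?_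
  have hA : addedMass q T ≤ ENNReal.ofReal (q / (1 - q)) := by
    rw [ENNReal.ofReal_div_of_pos h1q]
    exact (ENNReal.le_div_iff_mul_le (Or.inl (by simpa using hq1))
      (Or.inl ENNReal.ofReal_ne_top)).2 (addedMass_mul_le h hq0)
  refine hA.trans ?_
  rw [probSome_eq_ofReal h hq0 hq1, ← ENNReal.ofReal_mul (by positivity)]
  refine ENNReal.ofReal_le_ofReal ?_
  -- by Bernoulli's inequality, `(1 + N q) (1 - q) ^ N ≤ ((1 + q) (1 - q)) ^ N ≤ 1`
  have hbern : (1 + N * q) * (1 - q) ^ N ≤ 1 := by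
    have h1 := one_add_mul_le_pow (show (-2 : ℝ) ≤ q by linarith) N
    calc (1 + N * q) * (1 - q) ^ N ≤ (1 + q) ^ N * (1 - q) ^ N := by gcongr
      _ = ((1 + q) * (1 - q)) ^ N := (mul_pow _ _ _).symm
      _ ≤ 1 := pow_le_one₀ (by nlinarith) (by nlinarith)
  have h2 : ((N : ℝ)⁻¹ + q) * (1 - (1 - q) ^ N) - q =
      (N : ℝ)⁻¹ * (1 - (1 + N * q) * (1 - q) ^ N) := by
    field_simp; ring
  have h3 : q ≤ ((N : ℝ)⁻¹ + q) * (1 - (1 - q) ^ N) := by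
    have : 0 ≤ (N : ℝ)⁻¹ * (1 - (1 + N * q) * (1 - q) ^ N) :=
      mul_nonneg (by positivity) (by linarith)
    linarith
  rw [div_mul_eq_mul_div]
  gcongr

lemma totalLoss_eq (P : Measure Ω) (Y : ℕ → Ω → Bool) (Δ X : ℕ → Ω → ℝ)
    (A : Algorithm T) (φ : Finset ℕ → ℕ → Finset ℕ → ℝ → ℝ≥0∞) :
    totalLoss P Y Δ X A φ = ∑ s ∈ (Finset.Ico 1 T).powerset, ∑ t ∈ Finset.Ico 1 T \ s,
      lossAt P Y Δ X A φ (insert t s) t / ((s.card + 1 : ℕ) : ℝ≥0∞) := by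
  rw [totalLoss, sum_powerset_sum_mem]
  refine Finset.sum_congr rfl fun s _ => Finset.sum_congr rfl fun t ht => ?_
  rw [Finset.card_insert_of_notMem (Finset.mem_sdiff.1 ht).2]

lemma prob_insert [IsProbabilityMeasure P] (h : IsModel P T q σ F Y Δ μ X) (hq0 : 0 < q)
    {s : Finset ℕ} (hs : s ⊆ Finset.Ico 1 T) {t : ℕ} (ht : t ∈ Finset.Ico 1 T \ s) :
    P {ω | changePoints T Y ω = insert t s} = setWeight q (T - 1) (s.card + 1) := by
  obtain ⟨h1, h2⟩ := Finset.mem_sdiff.1 ht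
  rw [prob_changePoints h hq0 (Finset.insert_subset h1 hs), Finset.card_insert_of_notMem h2]

lemma probSome_eq_sum [IsProbabilityMeasure P] (h : IsModel P T q σ F Y Δ μ X)
    (A : Algorithm T) (hq0 : 0 < q) :
    probSome P T Y = ∑ s ∈ (Finset.Ico 1 T).powerset, ((Finset.Ico 1 T \ s).card : ℝ≥0∞) *
      (setWeight q (T - 1) (s.card + 1) / ((s.card + 1 : ℕ) : ℝ≥0∞)) := by
  rw [probSome_eq h A, sum_powerset_sum_mem]
  refine Finset.sum_congr rfl fun s hs => ?_
  rw [Finset.sum_congr rfl fun t ht => ?_, Finset.sum_const, nsmul_eq_mul]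
  rw [prob_insert h hq0 (Finset.mem_powerset.1 hs) ht,
    Finset.card_insert_of_notMem (Finset.mem_sdiff.1 ht).2]

lemma natCast_mul_div_le (c k : ℕ) (w : ℝ≥0∞) :
    (((c + 2) * (9 * k) : ℕ) : ℝ≥0∞) * (w / ((c + 1 : ℕ) : ℝ≥0∞)) ≤ (18 * k : ℕ) * w := by
  have hc : ((c + 1 : ℕ) : ℝ≥0∞) ≠ 0 := by simp
  calc (((c + 2) * (9 * k) : ℕ) : ℝ≥0∞) * (w / ((c + 1 : ℕ) : ℝ≥0∞))
      ≤ (((18 * k) * (c + 1) : ℕ) : ℝ≥0∞) * (w / ((c + 1 : ℕ) : ℝ≥0∞)) := by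
        refine mul_le_mul_left (Nat.cast_le.2 ?_) _
        nlinarith
    _ = _ := by
        rw [Nat.cast_mul, mul_assoc, ENNReal.mul_div_cancel hc (ENNReal.natCast_ne_top _)]

lemma natCast_mul_div_mul_div (k : ℕ) (hk : 0 < k) (w c I : ℝ≥0∞) :
    (k : ℝ≥0∞) * (w / c * (I / k)) = w * I / c := by
  have hk' : (k : ℝ≥0∞) ≠ 0 := by exact_mod_cast hk.ne'
  calc (k : ℝ≥0∞) * (w / c * (I / k)) = w / c * (k * (I / k)) := by ring
    _ = w / c * I := by rw [ENNReal.mul_div_cancel hk' (ENNReal.natCast_ne_top _)]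
    _ = _ := by rw [div_eq_mul_inv, div_eq_mul_inv]; ring

/-- If the loss is at most `1`, and the sum of the losses over the points of an isolated block also,
then the mean loss is essentially at most the mean of `exactRisk` divided by the block length. -/
lemma totalLoss_le [IsProbabilityMeasure P] (h : IsModel P T q σ F Y Δ μ X)
    (hF : F {0} = 0) (hσ : 0 < σ) (hq0 : 0 < q) (hq1 : q < 1) (A : Algorithm T) (n : ℕ)
    {φ : Finset ℕ → ℕ → Finset ℕ → ℝ → ℝ≥0∞} (hφ : ∀ s t shat, Measurable (φ s t shat))
    (hφ1 : ∀ s t shat δ, φ s t shat δ ≤ 1)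
    (hφ2 : ∀ s, ∀ m ∈ isolatedBlocks T (n + 1) s, ∀ shat δ, ∑ i ∈ Finset.range (n + 1),
      φ (insert (m * (n + 1) + i) s) (m * (n + 1) + i) shat δ ≤ 1) :
    totalLoss P Y Δ X A φ ≤
      probSome P T Y * ((∫⁻ x, exactRisk n (x / σ) ∂F) / (n + 1 : ℕ)) +
        (18 * (n + 1) : ℕ) * addedMass q T := by
  rw [totalLoss_eq, probSome_eq_sum h A hq0, addedMass, Finset.sum_mul, Finset.mul_sum,
    ← Finset.sum_add_distrib]
  refine Finset.sum_le_sum fun s hs => ?_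
  rw [Finset.mem_powerset] at hs
  split_ifs with hI
  · rw [hI, Finset.sdiff_self]; simp
  set w := setWeight q (T - 1) (s.card + 1)
  refine (sum_le_of_blocks T (Nat.succ_pos n) s _ (v := w / ((s.card + 1 : ℕ) : ℝ≥0∞))
    (r := w / ((s.card + 1 : ℕ) : ℝ≥0∞) * ((∫⁻ x, exactRisk n (x / σ) ∂F) / (n + 1 : ℕ)))
    (fun t ht => ?_) (fun m hm => ?_)).trans ?_
  · refine ENNReal.div_le_div_right ?_ _
    calc lossAt P Y Δ X A φ (insert t s) t
        ≤ ∫⁻ ω in {ω | changePoints T Y ω = insert t s}, 1 ∂P :=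
          lintegral_mono fun ω => hφ1 _ _ _ _
      _ = w := by rw [setLIntegral_one, prob_insert h hq0 hs ht]
  · rw [natCast_mul_div_mul_div _ (Nat.succ_pos n)]
    simp only [div_eq_mul_inv]
    rw [← Finset.sum_mul]
    exact mul_le_mul_left (by
      simpa only [div_eq_mul_inv] using
        sum_lossAt_block_le h hF hσ hq0 hq1 A hs hm hφ (hφ2 s m hm)) _
  · rw [mul_assoc]
    exact add_le_add le_rfl (natCast_mul_div_le _ _ _)

/-- If the loss over an isolated block is, on `D`, at least the distance to a point that does not
depend on the location of the change-point in the block, then the mean loss is essentially at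
least the mean of `medianRisk` on `D` divided by the block length. -/
lemma le_totalLoss [IsProbabilityMeasure P] (h : IsModel P T q σ F Y Δ μ X)
    (hF : F {0} = 0) (hσ : 0 < σ) (hq0 : 0 < q) (hq1 : q < 1) (A : Algorithm T) (n : ℕ)
    {φ : Finset ℕ → ℕ → Finset ℕ → ℝ → ℝ≥0∞} (hφ : ∀ s t shat, Measurable (φ s t shat))
    {D : Set ℝ} (hD : MeasurableSet D)
    (hφ1 : ∀ s, ∀ m ∈ isolatedBlocks T (n + 1) s, ∀ shat, ∀ δ ∈ D, ∃ u ≤ n, ∀ i ≤ n,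
      ((((i : ℤ) - u).natAbs : ℕ) : ℝ≥0∞) ≤
        φ (insert (m * (n + 1) + i) s) (m * (n + 1) + i) shat δ) :
    probSome P T Y * ((∫⁻ x in D, medianRisk n (x / σ) ∂F) / (n + 1 : ℕ)) ≤
      totalLoss P Y Δ X A φ + (18 * (n + 1) : ℕ) * addedMass q T *
        ((∫⁻ x in D, medianRisk n (x / σ) ∂F) / (n + 1 : ℕ)) := by
  set g := (∫⁻ x in D, medianRisk n (x / σ) ∂F) / ((n + 1 : ℕ) : ℝ≥0∞)
  rw [totalLoss_eq, probSome_eq_sum h A hq0, addedMass, Finset.sum_mul, Finset.mul_sum,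
    Finset.sum_mul, ← Finset.sum_add_distrib]
  refine Finset.sum_le_sum fun s hs => ?_
  rw [Finset.mem_powerset] at hs
  split_ifs with hI
  · rw [hI, Finset.sdiff_self]; simp
  set w := setWeight q (T - 1) (s.card + 1)
  rw [mul_assoc]
  refine (le_sum_of_blocks T (Nat.succ_pos n) s
    (fun t => lossAt P Y Δ X A φ (insert t s) t / ((s.card + 1 : ℕ) : ℝ≥0∞))
    fun m hm => ?_).trans (add_le_add le_rfl ?_)
  · rw [natCast_mul_div_mul_div _ (Nat.succ_pos n)]
    simp only [div_eq_mul_inv]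
    rw [← Finset.sum_mul]
    exact mul_le_mul_left (by
      simpa only [div_eq_mul_inv] using
        le_sum_lossAt_block h hF hσ hq0 hq1 A hs hm hφ hD (hφ1 s m hm)) _
  · rw [← mul_assoc]
    exact mul_le_mul_left (natCast_mul_div_le _ _ _) _

lemma selectE_eq_totalLoss (h : IsModel P T q σ F Y Δ μ X) (A : Algorithm T)
    {φ : Finset ℕ → ℕ → Finset ℕ → ℝ → ℝ≥0∞} (hφ : ∀ s t shat, Measurable (φ s t shat)) :
    selectE P (fun ω => points T (fun u => Y u ω))
        (fun ω t => φ (points T (fun u => Y u ω)) t (A.estimate X ω) (Δ t ω)) =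
      (probSome P T Y)⁻¹ * totalLoss P Y Δ X A φ :=
  selectE_eq h A hφ

/-- The bound for the probability of exact estimation, from blocks of length `n + 1`. -/
lemma beta_le [IsProbabilityMeasure P] (h : IsModel P T q σ F Y Δ μ X)
    (hF : F {0} = 0) (hσ : 0 < σ) (hq0 : 0 < q) (hq1 : q < 1) (hT : 2 ≤ T) (A : Algorithm T)
    (n : ℕ) : beta P Y X A ≤ (∫⁻ x, exactRisk n (x / σ) ∂F) / (n + 1 : ℕ) +
      (18 * (n + 1) : ℕ) * (addedMass q T / probSome P T Y) := by
  have hD0 := probSome_ne_zero h hq0 hq1 hT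
  have hDt : probSome P T Y ≠ ∞ := measure_ne_top _ _
  rw [ChangePoint.beta, selectE_eq_totalLoss h A (φ := fun s t shat _ => ind (t ∈ shat ∧ kappa T s shat t = 1))
    fun _ _ _ => measurable_const]
  refine (mul_le_mul_right (totalLoss_le h hF hσ hq0 hq1 A n (fun _ _ _ => measurable_const)
    (fun _ _ _ _ => ind_le_one _) fun s m hm shat δ => sum_ind_exact_le_one hm shat) _).trans ?_
  rw [mul_add, ← mul_assoc, ENNReal.inv_mul_cancel hD0 hDt, one_mul, div_eq_mul_inv _ (probSome P T Y)]
  refine add_le_add le_rfl (le_of_eq ?_)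
  ring

lemma measurable_ind {p : ℝ → Prop} (hp : MeasurableSet {x | p x}) :
    Measurable fun x => ind (p x) := by
  have : (fun x => ind (p x)) = {x | p x}.indicator 1 := by
    ext x
    by_cases hx : p x
    · rw [ind_of_true hx, Set.indicator_of_mem (show x ∈ {x | p x} from hx)]; rfl
    · rw [ind_of_false hx, Set.indicator_of_notMem (show x ∉ {x | p x} from hx)]
  rw [this]
  exact measurable_one.indicator hp

lemma measurableSet_le_abs (c : ℝ) : MeasurableSet {x : ℝ | c ≤ |x|} :=
  measurableSet_le measurable_const (by fun_prop)

lemma measurable_ind_and (p : Prop) (c : ℝ) : Measurable fun x : ℝ => ind (p ∧ c ≤ |x|) :=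
  measurable_ind ((MeasurableSet.const p).inter (measurableSet_le_abs c))

/-- The jump at the selected change-point has law `F`. -/
lemma selectE_large_jump_le [IsProbabilityMeasure P] (h : IsModel P T q σ F Y Δ μ X)
    (hq0 : 0 < q) (hq1 : q < 1) (hT : 2 ≤ T) (A : Algorithm T) (Δ₀ : ℝ) :
    selectE P (fun ω => points T (fun u => Y u ω)) (fun ω t =>
      ind (kappa T (points T (fun u => Y u ω)) (A.estimate X ω) t = 1 ∧ Δ₀ ≤ |Δ t ω|)) ≤
      F {x | Δ₀ ≤ |x|} := by
  have hD0 := probSome_ne_zero h hq0 hq1 hT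
  have hDt : probSome P T Y ≠ ∞ := measure_ne_top _ _
  rw [selectE_eq_totalLoss h A (φ := fun s t shat δ => ind (kappa T s shat t = 1 ∧ Δ₀ ≤ |δ|))
    fun _ _ _ => measurable_ind_and _ _]
  have hle : totalLoss P Y Δ X A (fun s t shat δ => ind (kappa T s shat t = 1 ∧ Δ₀ ≤ |δ|)) ≤
      probSome P T Y * F {x | Δ₀ ≤ |x|} := by
    rw [probSome_eq h A, totalLoss, Finset.sum_mul]
    refine Finset.sum_le_sum fun s hs => ?_
    rw [Finset.sum_mul]
    refine Finset.sum_le_sum fun t ht => ?_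
    rw [div_eq_mul_inv, div_eq_mul_inv, mul_right_comm]
    refine mul_le_mul_left ?_ _
    have hs' := Finset.mem_powerset.1 hs
    have hne : P {ω | changePoints T Y ω = s} ≠ 0 := by
      rw [prob_changePoints h hq0 hs']; exact setWeight_ne_zero hq0 hq1 _ _
    have hg := setLIntegral_jump h hs' ht hne (measurable_one.indicator (measurableSet_le_abs Δ₀))
    rw [lintegral_indicator_one (measurableSet_le_abs Δ₀)] at hg
    rw [← hg]
    refine lintegral_mono fun ω => ?_
    by_cases hω : Δ₀ ≤ |Δ t ω|
    · rw [Set.indicator_of_mem (show Δ t ω ∈ {x | Δ₀ ≤ |x|} from hω)]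
      exact ind_le_one _
    · exact (ind_of_false fun h => hω h.2).trans_le zero_le
  calc _ ≤ (probSome P T Y)⁻¹ * (probSome P T Y * F {x | Δ₀ ≤ |x|}) := mul_le_mul_right hle _
    _ = _ := by rw [← mul_assoc, ENNReal.inv_mul_cancel hD0 hDt, one_mul]

/-- The bound for the mean estimation error, from blocks of length `n + 1`. -/
lemma le_gamma [IsProbabilityMeasure P] [IsProbabilityMeasure F] (h : IsModel P T q σ F Y Δ μ X)
    (hF : F {0} = 0) (hσ : 0 < σ) (hq0 : 0 < q) (hq1 : q < 1) (hT : 2 ≤ T) (A : Algorithm T)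
    (n : ℕ) {Δ₀ : ℝ} (hpos : 0 < F {x | Δ₀ ≤ |x|}) :
    (∫⁻ x in {x | Δ₀ ≤ |x|}, medianRisk n (x / σ) ∂F) / (n + 1 : ℕ) ≤
      gamma P Y Δ X A Δ₀ * F {x | Δ₀ ≤ |x|} + n * alpha P Y X A +
        (18 * (n + 1) : ℕ) * (addedMass q T / probSome P T Y) *
          ((∫⁻ x in {x | Δ₀ ≤ |x|}, medianRisk n (x / σ) ∂F) / (n + 1 : ℕ)) := by
  have hD0 := probSome_ne_zero h hq0 hq1 hT
  have hDt : probSome P T Y ≠ ∞ := measure_ne_top _ _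
  set D := {x : ℝ | Δ₀ ≤ |x|}
  set g := (∫⁻ x in D, medianRisk n (x / σ) ∂F) / ((n + 1 : ℕ) : ℝ≥0∞)
  let φ₁ : Finset ℕ → ℕ → Finset ℕ → ℝ → ℝ≥0∞ := fun s t shat δ =>
    distTo t shat * ind (kappa T s shat t = 1 ∧ Δ₀ ≤ |δ|)
  let φ₂ : Finset ℕ → ℕ → Finset ℕ → ℝ → ℝ≥0∞ := fun s t shat _ => ind (kappa T s shat t ≠ 1)
  have hφ₁ : ∀ s t shat, Measurable (φ₁ s t shat) := fun s t shat =>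
    measurable_const.mul (measurable_ind_and _ _)
  have hφ₂ : ∀ s t shat, Measurable (φ₂ s t shat) := fun s t shat => measurable_const
  -- the change-points that are not estimated once are charged the largest error within a block
  have hsum : totalLoss P Y Δ X A (fun s t shat δ => φ₁ s t shat δ + n * φ₂ s t shat δ) =
      totalLoss P Y Δ X A φ₁ + n * totalLoss P Y Δ X A φ₂ := by
    simp only [totalLoss, Finset.mul_sum]
    rw [← Finset.sum_add_distrib]
    refine Finset.sum_congr rfl fun s hs => ?_
    rw [← Finset.sum_add_distrib]
    refine Finset.sum_congr rfl fun t ht => ?_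
    have htI := Finset.mem_powerset.1 hs ht
    rw [lossAt, lintegral_add_left (measurable_loss h A (hφ₁ s t) htI),
      lintegral_const_mul _ (measurable_loss h A (hφ₂ s t) htI), ENNReal.add_div,
      mul_div_assoc]
    rfl
  have hlow := le_totalLoss h hF hσ hq0 hq1 A n
    (φ := fun s t shat δ => φ₁ s t shat δ + n * φ₂ s t shat δ)
    (fun s t shat => (hφ₁ s t shat).add ((hφ₂ s t shat).const_mul _))
    (measurableSet_le_abs Δ₀) (fun s m hm shat δ hδ => by
      obtain ⟨u, hu, hui⟩ := exists_estimate_in_block hm shat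
      refine ⟨u, hu, fun i hi => ?_⟩
      by_cases hκ : kappa T (insert (m * (n + 1) + i) s) shat (m * (n + 1) + i) = 1
      · refine le_add_right ?_
        simp only [φ₁]
        rw [ind_of_true ⟨hκ, hδ⟩, mul_one]
        exact hui i hi hκ
      · refine le_add_left ?_
        simp only [φ₂]
        rw [ind_of_true hκ, mul_one]
        exact Nat.cast_le.2 (by omega))
  have hγ : (probSome P T Y)⁻¹ * totalLoss P Y Δ X A φ₁ ≤ gamma P Y Δ X A Δ₀ * F D := by
    rw [← ENNReal.div_le_iff hpos.ne' (measure_ne_top _ _), gamma,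
      selectE_eq_totalLoss h A (φ := φ₁) hφ₁]
    exact ENNReal.div_le_div_left (selectE_large_jump_le h hq0 hq1 hT A Δ₀) _
  have hα : (probSome P T Y)⁻¹ * totalLoss P Y Δ X A φ₂ = alpha P Y X A := by
    rw [alpha, selectE_eq_totalLoss h A (φ := φ₂) hφ₂]
  calc g = (probSome P T Y)⁻¹ * (probSome P T Y * g) := by
        rw [← mul_assoc, ENNReal.inv_mul_cancel hD0 hDt, one_mul]
    _ ≤ (probSome P T Y)⁻¹ * (totalLoss P Y Δ X A φ₁ + n * totalLoss P Y Δ X A φ₂ +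
          (18 * (n + 1) : ℕ) * addedMass q T * g) := by
        rw [← hsum]; exact mul_le_mul_right hlow _
    _ = (probSome P T Y)⁻¹ * totalLoss P Y Δ X A φ₁ +
          n * ((probSome P T Y)⁻¹ * totalLoss P Y Δ X A φ₂) +
          (18 * (n + 1) : ℕ) * (addedMass q T / probSome P T Y) * g := by
        rw [div_eq_mul_inv]; ring
    _ ≤ _ := by
        rw [hα]
        exact add_le_add (add_le_add hγ le_rfl) le_rfl

end Bounds

/-! ### The limits -/

lemma tendsto_error {q : ℕ → ℝ} (hq : Tendsto q atTop (𝓝 0)) :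
    Tendsto (fun T : ℕ => ENNReal.ofReal ((((T - 1 : ℕ) : ℝ)⁻¹ + q T) / (1 - q T))) atTop (𝓝 0) := by
  have h1 : Tendsto (fun T : ℕ => ((T - 1 : ℕ) : ℝ)⁻¹) atTop (𝓝 0) :=
    tendsto_inv_atTop_zero.comp (tendsto_natCast_atTop_atTop.comp (tendsto_sub_atTop_nat 1))
  have h2 := (h1.add hq).div (hq.const_sub 1) (by norm_num)
  rw [add_zero, zero_div] at h2
  simpa using ENNReal.tendsto_ofReal h2

lemma tendsto_natCast_div (j : ℕ) :
    Tendsto (fun n : ℕ => ((2 * j : ℕ) : ℝ≥0∞) / ((n + 1 : ℕ) : ℝ≥0∞)) atTop (𝓝 0) := by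
  have h := ENNReal.Tendsto.const_div (a := ((2 * j : ℕ) : ℝ≥0∞))
    (ENNReal.tendsto_nat_nhds_top.comp (tendsto_add_atTop_nat 1))
    (Or.inr (ENNReal.natCast_ne_top _))
  simpa using h

lemma tendsto_natCast_sub_div (j : ℕ) :
    Tendsto (fun n : ℕ => ((n + 1 - 2 * j : ℕ) : ℝ≥0∞) / ((n + 1 : ℕ) : ℝ≥0∞)) atTop (𝓝 1) := by
  have h := ENNReal.Tendsto.sub tendsto_const_nhds (tendsto_natCast_div j) (Or.inl ENNReal.one_ne_top)
  rw [tsub_zero] at h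
  refine h.congr fun n => ?_
  rw [ENNReal.natCast_sub, ENNReal.sub_div fun _ _ => by simp,
    ENNReal.div_self (by simp) (ENNReal.natCast_ne_top _)]

theorem theorem1 {Ω : ℕ → Type*} [∀ T, MeasurableSpace (Ω T)]
    (P : ∀ T, Measure (Ω T)) [∀ T, IsProbabilityMeasure (P T)]
    (F : Measure ℝ) [IsProbabilityMeasure F] (hF : F {0} = 0)
    (σ : ℝ) (hσ : 0 < σ)
    (q : ℕ → ℝ) (hq : ∀ T, 0 < q T ∧ q T < 1) (hq_lim : Tendsto q atTop (𝓝 0))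
    (Y : ∀ T, ℕ → Ω T → Bool) (Δ μ X : ∀ T, ℕ → Ω T → ℝ)
    (hmodel : ∀ T, ChangePoint.IsModel (P T) T (q T) σ F (Y T) (Δ T) (μ T) (X T))
    (A : ∀ T, ChangePoint.Algorithm T) :
    limsup (fun T => ChangePoint.beta (P T) (Y T) (X T) (A T)) atTop ≤
        ChangePoint.betaUpper (F.map (fun x => x / σ)) ∧
      ∀ Δ₀ : ℝ, 0 < Δ₀ → 0 < F {x | Δ₀ ≤ |x|} →
        Tendsto (fun T => ChangePoint.alpha (P T) (Y T) (X T) (A T)) atTop (𝓝 0) →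
        ChangePoint.gammaLower (F.map (fun x => x / σ)) (Δ₀ / σ) ≤
          liminf (fun T => ChangePoint.gamma (P T) (Y T) (Δ T) (X T) (A T) Δ₀) atTop := by
  have hdiv : Measurable fun x : ℝ => x / σ := by fun_prop
  have : IsProbabilityMeasure (F.map fun x => x / σ) :=
    Measure.isProbabilityMeasure_map hdiv.aemeasurable
  have herr0 : ∀ k : ℕ, Tendsto (fun T => (k : ℝ≥0∞) * (addedMass (q T) T / probSome (P T) T (Y T)))
      atTop (𝓝 0) := by
    intro k
    have hlim := ENNReal.Tendsto.const_mul (tendsto_error hq_lim)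
      (Or.inr (ENNReal.natCast_ne_top k))
    rw [mul_zero] at hlim
    refine tendsto_of_tendsto_of_tendsto_of_le_of_le' tendsto_const_nhds hlim
      (Eventually.of_forall fun _ => zero_le) ?_
    filter_upwards [eventually_ge_atTop 2] with T hT
    exact mul_le_mul_right (addedMass_div_probSome_le (hmodel T) (hq T).1 (hq T).2 hT) _
  constructor
  · have hn : ∀ n : ℕ, limsup (fun T => beta (P T) (Y T) (X T) (A T)) atTop ≤
        (∫⁻ x, exactRisk n (x / σ) ∂F) / (n + 1 : ℕ) := by
      intro n
      have hlim := (tendsto_const_nhds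
        (x := (∫⁻ x, exactRisk n (x / σ) ∂F) / ((n + 1 : ℕ) : ℝ≥0∞))).add (herr0 (18 * (n + 1)))
      rw [add_zero] at hlim
      rw [← hlim.limsup_eq]
      refine limsup_le_limsup ?_
      filter_upwards [eventually_ge_atTop 2] with T hT
      exact beta_le (hmodel T) hF hσ (hq T).1 (hq T).2 hT (A T) n
    have hG : (F.map fun x => x / σ) {0} = 0 := by
      rw [Measure.map_apply hdiv (measurableSet_singleton 0)]
      refine measure_mono_null (fun x hx => ?_) hF
      have hx' : x / σ = 0 := hx
      simpa [hσ.ne'] using hx'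
    refine le_trans (le_iInf fun j => ?_) (iInf_lintegral_negProb_le (F.map fun x => x / σ) hG)
    have hbound : ∀ n : ℕ, limsup (fun T => beta (P T) (Y T) (X T) (A T)) atTop ≤
        ∫⁻ x, negProb x j ^ 2 ∂(F.map fun x => x / σ) +
          ((2 * j : ℕ) : ℝ≥0∞) / ((n + 1 : ℕ) : ℝ≥0∞) := by
      intro n
      refine (hn n).trans (ENNReal.div_le_of_le_mul ?_)
      have hm : Measurable fun x => negProb x j ^ 2 := (measurable_negProb j).pow_const 2
      have hk : ((n + 1 : ℕ) : ℝ≥0∞) ≠ 0 := by simp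
      calc ∫⁻ x, exactRisk n (x / σ) ∂F
          = ∫⁻ x, exactRisk n x ∂(F.map fun x => x / σ) :=
            (lintegral_map (measurable_exactRisk n) hdiv).symm
        _ ≤ ∫⁻ x, ((n + 1 : ℕ) * negProb x j ^ 2 + (2 * j : ℕ)) ∂(F.map fun x => x / σ) :=
            lintegral_mono (exactRisk_le n j)
        _ = (n + 1 : ℕ) * ∫⁻ x, negProb x j ^ 2 ∂(F.map fun x => x / σ) + (2 * j : ℕ) := by
            rw [lintegral_add_right _ measurable_const, lintegral_const_mul _ hm, lintegral_const,
              measure_univ, mul_one]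
        _ = _ := by
            rw [add_mul, ENNReal.div_mul_cancel hk (ENNReal.natCast_ne_top _), mul_comm]
    refine ge_of_tendsto (x := atTop) ?_ (Eventually.of_forall hbound)
    simpa using (tendsto_const_nhds
      (x := ∫⁻ x, negProb x j ^ 2 ∂(F.map fun x => x / σ))).add (tendsto_natCast_div j)
  · intro Δ₀ hΔ₀ hpos hα
    set D := {x : ℝ | Δ₀ ≤ |x|}
    set Γ := liminf (fun T => gamma (P T) (Y T) (Δ T) (X T) (A T) Δ₀) atTop
    have hDt : F D ≠ ∞ := measure_ne_top _ _
    have hpre : (fun x => x / σ) ⁻¹' {x | Δ₀ / σ ≤ |x|} = D := by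
      ext x
      change Δ₀ / σ ≤ |x / σ| ↔ Δ₀ ≤ |x|
      rw [abs_div, abs_of_pos hσ, div_le_div_iff_of_pos_right hσ]
    have hn : ∀ n : ℕ, (∫⁻ x in D, medianRisk n (x / σ) ∂F) / (n + 1 : ℕ) ≤ Γ * F D := by
      intro n
      set g := (∫⁻ x in D, medianRisk n (x / σ) ∂F) / ((n + 1 : ℕ) : ℝ≥0∞)
      have hg : g ≠ ∞ := by
        refine ENNReal.div_ne_top (ne_top_of_le_ne_top ?_
          (lintegral_mono fun x => medianRisk_le n (x / σ))) (by simp)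
        rw [lintegral_const]
        exact ENNReal.mul_ne_top (ENNReal.natCast_ne_top _) (measure_ne_top _ _)
      have h1 : Tendsto (fun T => n * alpha (P T) (Y T) (X T) (A T) +
          (18 * (n + 1) : ℕ) * (addedMass (q T) T / probSome (P T) T (Y T)) * g) atTop (𝓝 0) := by
        have h1 := ENNReal.Tendsto.const_mul hα (Or.inr (ENNReal.natCast_ne_top n))
        have h2 := ENNReal.Tendsto.mul_const (herr0 (18 * (n + 1))) (Or.inr hg)
        simpa using h1.add h2
      -- solve the bound for fixed lengths for `gamma`; since `g` is finite, the subtracted terms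
      -- vanish in the limit
      rw [← ENNReal.div_le_iff hpos.ne' hDt]
      have h2 : Tendsto (fun T => (g - (n * alpha (P T) (Y T) (X T) (A T) +
          (18 * (n + 1) : ℕ) * (addedMass (q T) T / probSome (P T) T (Y T)) * g)) / F D)
          atTop (𝓝 (g / F D)) := by
        have h3 := ENNReal.Tendsto.div_const
          (ENNReal.Tendsto.sub (tendsto_const_nhds (x := g)) h1 (Or.inl hg)) (b := F D)
          (Or.inr hpos.ne')
        rwa [tsub_zero] at h3
      rw [← h2.liminf_eq]
      refine liminf_le_liminf ?_
      filter_upwards [eventually_ge_atTop 2] with T hT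
      rw [ENNReal.div_le_iff hpos.ne' hDt, tsub_le_iff_right, ← add_assoc]
      exact le_gamma (hmodel T) hF hσ (hq T).1 (hq T).2 hT (A T) n hpos
    refine (gammaLower_le _ (div_pos hΔ₀ hσ)).trans ?_
    rw [Measure.map_apply hdiv (measurableSet_le_abs _), hpre, mul_comm, ← div_eq_mul_inv,
      ENNReal.div_le_iff hpos.ne' hDt]
    refine iSup_le fun j => ?_
    have hL : Measurable fun x : ℝ => ∫⁻ z, lowMed j (x, z) ∂(gaussSeq.prod gaussSeq) :=
      (measurable_lowMed j).lintegral_prod_right'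
    have hL' : Measurable fun x : ℝ => ∫⁻ z, lowMed j (x / σ, z) ∂(gaussSeq.prod gaussSeq) :=
      hL.comp hdiv
    have hbound : ∀ n : ℕ, ((n + 1 - 2 * j : ℕ) : ℝ≥0∞) / ((n + 1 : ℕ) : ℝ≥0∞) *
        lowMedMean (F.map fun x => x / σ) (Δ₀ / σ) j ≤ Γ * F D := by
      intro n
      refine le_trans ?_ (hn n)
      rw [lowMedMean, setLIntegral_map (measurableSet_le_abs _) hL hdiv, hpre,
        ENNReal.div_eq_inv_mul, mul_assoc, ← ENNReal.div_eq_inv_mul,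
        ← lintegral_const_mul _ hL']
      exact ENNReal.div_le_div_right (lintegral_mono fun x => le_medianRisk n j (x / σ)) _
    refine le_of_tendsto (x := atTop) ?_ (Eventually.of_forall hbound)
    simpa using ENNReal.Tendsto.mul_const (tendsto_natCast_sub_div j)
      (Or.inl one_ne_zero) (b := lowMedMean (F.map fun x => x / σ) (Δ₀ / σ) j)
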